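/- Let $n,m\ge 1$ be integers, let $x_1,\dots,x_n>0$ be distinct, let $I\subseteq\{1,\dots,n\}$ with $r=|I|$, and let $y_i>0$ for $i\in I$. If $m=1$, assume $r\ge 1$. Put $$U(z)=\frac zn\sum_{i\in I}\frac{y_i}{1+y_iz},\qquad V(z)=\frac zn\sum_{j=1}^n\frac1{z-x_j},\qquad W(z)=\frac zn\sum_{j=1}^n\Big(\frac{mz^{m-1}}{z^m-x_j^m}-\frac1{z-x_j}\Big),$$ and, for $0\le\kappa<1$, $F_{\kappa,m}(z)=\frac{\kappa}{1-\kappa}U(z)+V(z)+\frac1{1-\kappa}W(z)$. The equation $$F_{\kappa,m}(z)=\frac{\chi}{1-\kappa}\qquad(*)$$ is read at $\kappa=1$ as $U(z)+W(z)=\chi$, where $W$ is continued analytically through its removable singularities $x_1,\dots,x_n$. Let $A(\kappa)=m+(\frac rn-1)\kappa$. Call a function $z_0$ on $\{(\chi,\kappa):0\le\kappa\le1,\ 0\le\chi<A(\kappa)\}$ a distinguished root if it is continuous, $z_0(\chi,\kappa)$ is a root of $(*)$ at every point, and (1) $\operatorname{Arg}z_0(\chi,0)=\pi/m$ for $0<\chi<m$;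 (2) $z_0(0,\kappa)=0$ for $0\le\kappa\le1$; (3) $z_0(\chi,\kappa)\to\infty$ as $\chi\uparrow A(\kappa)$, for $0\le\kappa\le1$; (4) $z_0(\chi,1)\in[0,\infty)$ for $0\le\chi<A(1)$; (5) if $m=1$, $\operatorname{Im}z_0\ge0$ everywhere. Given such a $z_0$, let the liquid region be $$\mathcal L=\{(\chi,\kappa):0\le\kappa<1,\ 0<\chi<A(\kappa),\ z_0(\chi,\kappa)\notin\mathbb R\},$$ let $\mathcal L_o$ be its interior in $\mathbb R^2$, and let $T_{\mathcal L}(\chi,\kappa)=z_0(\chi,\kappa)$. Then a distinguished root exists, and for every distinguished root $z_0$ the map $T_{\mathcal L}$ restricts to a homeomorphism from $\mathcal L_o$ onto the sector $\{z\in\mathbb C:0<\operatorname{Arg}z<\pi/m\}$, where $\operatorname{Arg}$ is the principal argument. Its inverse is $z\mapsto(\chi_{\mathcal L}(z),\kappa_{\mathcal L}(z))$, where $$\chi_{\mathcal L}(z)=\frac{W(\bar z)U(z)+V(\bar z)U(z)-U(\bar z)V(z)-W(\bar z)V(z)-W(z)U(\bar z)+W(z)V(\bar z)}{U(z)-U(\bar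 z)-V(z)+V(\bar z)},$$ $$\kappa_{\mathcal L}(z)=\frac{W(\bar z)-W(z)+V(\bar z)-V(z)}{U(z)-U(\bar z)-V(z)+V(\bar z)},$$ and the common denominator does not vanish on the sector. -/

import Mathlib

open Filter Topology

noncomputable section

namespace SquareHexagon

/- Data: a period `n`, the weights `x i > 0` and `y i > 0` of one period, the set `I` of the
indices in one period at which the edge of weight `y i` exists, and the parameter `m` of the
uniform boundary condition. -/

/-- `U(z) = (z/n) ∑_{i ∈ I} y_i / (1 + y_i z)`. -/
def U {n : ℕ} (y : Fin n → ℝ) (I : Finset (Fin n)) (z : ℂ) : ℂ :=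
  z / n * ∑ i ∈ I, (y i : ℂ) / (1 + y i * z)

/-- `V(z) = (z/n) ∑_j 1 / (z - x_j)`. -/
def V {n : ℕ} (x : Fin n → ℝ) (z : ℂ) : ℂ :=
  z / n * ∑ j, 1 / (z - x j)

/-- `W(z) = (z/n) ∑_j (m z^(m-1) / (z^m - x_j^m) - 1 / (z - x_j))`. -/
def W {n : ℕ} (x : Fin n → ℝ) (m : ℕ) (z : ℂ) : ℂ :=
  z / n * ∑ j, ((m : ℂ) * z ^ (m - 1) / (z ^ m - (x j : ℂ) ^ m) - 1 / (z - x j))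

/-- The rational function `F_{κ,m}`, for `κ < 1`. -/
def F {n : ℕ} (x y : Fin n → ℝ) (I : Finset (Fin n)) (κ : ℝ) (m : ℕ) (z : ℂ) : ℂ :=
  (κ : ℂ) * z / (n * (1 - κ)) * ∑ i ∈ I, (y i : ℂ) / (1 + y i * z)
    + ∑ j, z / (n * (z - x j))
    + z / (n * (1 - κ)) *
      ∑ j, ((m : ℂ) * z ^ (m - 1) / (z ^ m - (x j : ℂ) ^ m) - 1 / (z - x j))

/-- `g(z) = ∑_{k=0}^{m-1} z^k a^(m-1-k)`, that is, `(z^m - a^m) / (z - a)` without its removable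
singularity. -/
def g (m : ℕ) (a : ℝ) (z : ℂ) : ℂ :=
  ∑ k ∈ Finset.range m, z ^ k * (a : ℂ) ^ (m - 1 - k)

/-- The limit of `(1 - κ) F_{κ,m}` at `κ = 1`, with the removable singularities at the `x_j`
removed: `(z/n) ∑_{i ∈ I} y_i / (1 + y_i z) + (z/n) ∑_j g_j'(z) / g_j(z)`. -/
def P {n : ℕ} (x y : Fin n → ℝ) (I : Finset (Fin n)) (m : ℕ) (z : ℂ) : ℂ :=
  z / n * ∑ i ∈ I, (y i : ℂ) / (1 + y i * z)
    + z / n * ∑ j, deriv (g m (x j)) z / g m (x j) z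

/-- `z` is a root of `F_{κ,m}(z) = χ / (1 - κ)`, an equation that reads `P(z) = χ` at `κ = 1`.
A root is not a pole; the points `-1 / y_i` are no poles of `F_{0,m}`. -/
def IsRoot {n : ℕ} (x y : Fin n → ℝ) (I : Finset (Fin n)) (m : ℕ) (χ κ : ℝ) (z : ℂ) : Prop :=
  (κ ≠ 0 → ∀ i ∈ I, 1 + (y i : ℂ) * z ≠ 0) ∧
  (κ ≠ 1 → (∀ j, z ^ m ≠ (x j : ℂ) ^ m) ∧ F x y I κ m z = (χ : ℂ) / (1 - κ)) ∧
  (κ = 1 → (∀ j, g m (x j) z ≠ 0) ∧ P x y I m z = χ)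

/-- The right end `m + (r/n - 1) κ` of the horizontal section at height `κ`, `r = |I|`. -/
def rightEnd {n : ℕ} (I : Finset (Fin n)) (m : ℕ) (κ : ℝ) : ℝ :=
  m + ((I.card : ℝ) / n - 1) * κ

/-- The points `(χ, κ)` with `0 ≤ κ ≤ 1`, `0 ≤ χ < m + (r/n - 1) κ`. -/
def rootDomain {n : ℕ} (I : Finset (Fin n)) (m : ℕ) : Set (ℝ × ℝ) :=
  {p | 0 ≤ p.2 ∧ p.2 ≤ 1 ∧ 0 ≤ p.1 ∧ p.1 < rightEnd I m p.2}

/-- The region `𝓡`: the points `(χ, κ)` with `0 ≤ κ < 1`, `0 < χ < m + (r/n - 1) κ`. -/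
def region {n : ℕ} (I : Finset (Fin n)) (m : ℕ) : Set (ℝ × ℝ) :=
  {p | 0 ≤ p.2 ∧ p.2 < 1 ∧ 0 < p.1 ∧ p.1 < rightEnd I m p.2}

/-- `z₀` is a distinguished root `(χ, κ) ↦ z₀(χ, κ)` of `F_{κ,m}(z) = χ / (1 - κ)`. -/
structure IsDistinguishedRoot {n : ℕ} (x y : Fin n → ℝ) (I : Finset (Fin n)) (m : ℕ)
    (z₀ : ℝ × ℝ → ℂ) : Prop where
  isRoot : ∀ p ∈ rootDomain I m, IsRoot x y I m p.1 p.2 (z₀ p)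
  arg_bottom : ∀ χ : ℝ, 0 < χ → χ < m → (z₀ (χ, 0)).arg = Real.pi / m
  left : ∀ κ : ℝ, 0 ≤ κ → κ ≤ 1 → z₀ (0, κ) = 0
  right : ∀ κ : ℝ, 0 ≤ κ → κ ≤ 1 →
    Tendsto (fun χ : ℝ => ‖z₀ (χ, κ)‖) (𝓝[<] (rightEnd I m κ)) atTop
  top : ∀ χ : ℝ, 0 ≤ χ → χ < rightEnd I m 1 → ∃ t : ℝ, 0 ≤ t ∧ z₀ (χ, 1) = t
  continuousOn : ContinuousOn z₀ (rootDomain I m)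
  /-- For `m = 1` the other conditions do not tell `z₀` from its complex conjugate. -/
  im_nonneg : m = 1 → ∀ p ∈ rootDomain I m, 0 ≤ (z₀ p).im

/-- The liquid region `𝓛`: the part of `𝓡` where `z₀` is not real. -/
def liquidRegion {n : ℕ} (I : Finset (Fin n)) (m : ℕ) (z₀ : ℝ × ℝ → ℂ) : Set (ℝ × ℝ) :=
  {p | p ∈ region I m ∧ (z₀ p).im ≠ 0}

/-- The sector `0 < Arg z < π / m`. -/
def sector (m : ℕ) : Set ℂ :=
  {z | 0 < z.arg ∧ z.arg < Real.pi / m}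

open scoped ComplexConjugate in
/-- The common denominator of `χ_𝓛` and `κ_𝓛`. -/
def den {n : ℕ} (x y : Fin n → ℝ) (I : Finset (Fin n)) (z : ℂ) : ℂ :=
  U y I z - U y I (conj z) - V x z + V x (conj z)

open scoped ComplexConjugate in
/-- The function `χ_𝓛`. -/
def chiL {n : ℕ} (x y : Fin n → ℝ) (I : Finset (Fin n)) (m : ℕ) (z : ℂ) : ℂ :=
  (W x m (conj z) * U y I z + V x (conj z) * U y I z - U y I (conj z) * V x z
    - W x m (conj z) * V x z - W x m z * U y I (conj z) + W x m z * V x (conj z)) / den x y I z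

open scoped ComplexConjugate in
/-- The function `κ_𝓛`. -/
def kappaL {n : ℕ} (x y : Fin n → ℝ) (I : Finset (Fin n)) (m : ℕ) (z : ℂ) : ℂ :=
  (W x m (conj z) - W x m z + V x (conj z) - V x z) / den x y I z

end SquareHexagon

end

noncomputable section

namespace SquareHexagon

/-! Multiplied by 1 - κ, the equation reads f(z) = κ(U - V) + (V + W) = χ. At z = ρ e^{iθ}, with u =
cos θ, the imaginary part of f is sin θ/(2n) times κ D(u) - N(u). Here D = `denK` is a sum of terms
1/(d_i + u) and 1/(c_j - u), and N = `numK` is the sum of T_m'(u)/(T_m(c_j) - T_m(u)), where c_j =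
cosh(log ρ - log x_j) and d_i = cosh(log ρ + log y_i). The Chebyshev polynomial T_m enters because V
+ W depends on z only through z^m.

The heart of the matter is that N/D is strictly increasing on cos(π/m) < u < 1, with values in (0,
1) (`numK_mul_deriv_denK_lt`, `numK_lt_denK`). This rests on U_{m-1} having only real roots, none
beyond cos(π/m): to their right T_m is convex and T_m' is log-concave. So for given κ and ρ the sign
of Im f changes at most once in the angle, which singles out one point `zK κ ρ` of the closed
sector, continuous in (κ, ρ).

By the Cauchy-Riemann equations Re(z f') is the angular derivative of Im f. It is positive along the
level curve up to finitely many points on compact pieces, and this forces χ = Re f to increase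
strictly with ρ (`strictMonoOn_chiK`), from 0 to A(κ). Inverting in ρ produces a distinguished root
`zRoot`.

Conversely, at a point of the sector the imaginary part of the equation determines κ and the real
part then determines χ. The resulting map `phiS` is continuous with continuous left inverse `zRoot`,
and Cramer's rule gives its closed formulas. An arbitrary distinguished root must enter the sector
somewhere because of its boundary values, and connectedness of the sector propagates the identity z₀
∘ `phiS` = id (`apply_phiS`). The interior of the liquid region is then the image of `phiS`. -/

/-! ### Chebyshev polynomials to the right of their largest critical point -/

/-- The Chebyshev polynomial of the first kind as a real function. -/
def chebT (m : ℕ) (u : ℝ) : ℝ := (Polynomial.Chebyshev.T ℝ m).eval u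

/-- The derivative of `chebT`. -/
def chebT' (m : ℕ) (u : ℝ) : ℝ := (Polynomial.Chebyshev.T ℝ m).derivative.eval u

/-- The second derivative of `chebT`. -/
def chebT'' (m : ℕ) (u : ℝ) : ℝ := (Polynomial.Chebyshev.T ℝ m).derivative.derivative.eval u

/-- The largest critical point of `chebT m` for `2 ≤ m`. -/
def lo (m : ℕ) : ℝ := Real.cos (Real.pi / m)

theorem hasDerivAt_chebT (m : ℕ) (u : ℝ) : HasDerivAt (chebT m) (chebT' m u) u :=
  Polynomial.hasDerivAt _ _

theorem hasDerivAt_chebT' (m : ℕ) (u : ℝ) : HasDerivAt (chebT' m) (chebT'' m u) u :=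
  Polynomial.hasDerivAt _ _

theorem continuous_chebT (m : ℕ) : Continuous (chebT m) := Polynomial.continuous _

theorem continuous_chebT' (m : ℕ) : Continuous (chebT' m) := Polynomial.continuous _

theorem chebT_one (u : ℝ) : chebT 1 u = u := by simp [chebT]

theorem chebT'_one (u : ℝ) : chebT' 1 u = 1 := by simp [chebT']

theorem chebT''_one (u : ℝ) : chebT'' 1 u = 0 := by simp [chebT'']

theorem lo_one : lo 1 = -1 := by simp [lo]

theorem lo_lt_one {m : ℕ} (hm : 1 ≤ m) : lo m < 1 := by
  rw [lo, ← Real.cos_zero]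
  have hm' : (1 : ℝ) ≤ m := by exact_mod_cast hm
  exact Real.cos_lt_cos_of_nonneg_of_le_pi le_rfl (div_le_self Real.pi_pos.le hm') (by positivity)

theorem neg_one_le_lo (m : ℕ) : -1 ≤ lo m := Real.neg_one_le_cos _

theorem lo_nonneg {m : ℕ} (hm : 2 ≤ m) : 0 ≤ lo m := by
  have hm' : (2 : ℝ) ≤ m := by exact_mod_cast hm
  refine Real.cos_nonneg_of_neg_pi_div_two_le_of_le ?_ ?_
  · have : 0 < Real.pi / m := div_pos Real.pi_pos (by linarith)
    linarith [Real.pi_pos]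
  · exact div_le_div_of_nonneg_left Real.pi_pos.le (by norm_num) hm'

theorem chebT'_eq (k : ℕ) (u : ℝ) :
    chebT' (k + 1) u = (k + 1) * (Polynomial.Chebyshev.U ℝ k).eval u := by
  simp [chebT', Polynomial.Chebyshev.T_derivative_eq_U]

theorem chebT''_eq (k : ℕ) (u : ℝ) :
    chebT'' (k + 1) u = (k + 1) * (Polynomial.Chebyshev.U ℝ k).derivative.eval u := by
  have h : (Polynomial.Chebyshev.T ℝ ((k + 1 : ℕ) : ℤ)).derivative
      = Polynomial.C ((k : ℝ) + 1) * Polynomial.Chebyshev.U ℝ k := by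
    simp [Polynomial.Chebyshev.T_derivative_eq_U]
  rw [chebT'', h, Polynomial.derivative_C_mul, Polynomial.eval_C_mul]

/-- There are as many distinct real roots as the degree. Real-rootedness writes the logarithmic
derivative of T_m' as a sum of 1/(u - r), each term positive and decreasing beyond the largest root;
convexity and log-concavity below come from this. -/
theorem splits_chebU (k : ℕ) : (Polynomial.Chebyshev.U ℝ k).Splits := by
  rw [Polynomial.splits_iff_card_roots, Polynomial.Chebyshev.roots_U_real,
    Polynomial.Chebyshev.natDegree_U_natCast, Finset.card_val,
    Finset.card_image_of_injOn, Finset.card_range]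
  exact (Finset.range k).nodup_map_iff_injOn.mp (Polynomial.Chebyshev.roots_U_real_nodup k)

theorem le_lo_of_mem_roots_chebU {k : ℕ} {r : ℝ} (hr : r ∈ (Polynomial.Chebyshev.U ℝ k).roots) :
    r ≤ lo (k + 1) := by
  rw [Polynomial.Chebyshev.roots_U_real] at hr
  obtain ⟨j, hj, rfl⟩ := Finset.mem_image.mp (Finset.mem_val.mp hr)
  have hj' : (j : ℝ) + 1 ≤ k := by exact_mod_cast Finset.mem_range.mp hj
  have hk : (0 : ℝ) < k + 1 := by positivity
  rw [lo]
  push_cast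
  refine Real.cos_le_cos_of_nonneg_of_le_pi (by positivity) ?_ ?_
  · rw [div_le_iff₀ hk]
    nlinarith [Real.pi_pos]
  · gcongr
    nlinarith [Real.pi_pos, (Nat.cast_nonneg j : (0 : ℝ) ≤ j)]

theorem chebU_pos {k : ℕ} {u : ℝ} (hu : lo (k + 1) < u) :
    0 < (Polynomial.Chebyshev.U ℝ k).eval u := by
  rw [(splits_chebU k).eval_eq_prod_roots, Polynomial.Chebyshev.leadingCoeff_U_natCast]
  refine mul_pos (by positivity) (Multiset.prod_pos fun a ha => ?_)
  obtain ⟨r, hr, rfl⟩ := Multiset.mem_map.mp ha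
  linarith [le_lo_of_mem_roots_chebU hr]

theorem chebT'_pos {m : ℕ} (hm : 1 ≤ m) {u : ℝ} (hu : lo m < u) : 0 < chebT' m u := by
  obtain ⟨k, rfl⟩ := Nat.exists_eq_add_of_le' hm
  rw [chebT'_eq]
  exact mul_pos (by positivity) (chebU_pos hu)

theorem chebT''_eq_mul_sum {k : ℕ} {u : ℝ} (hu : lo (k + 1) < u) :
    chebT'' (k + 1) u = chebT' (k + 1) u *
      ((Polynomial.Chebyshev.U ℝ k).roots.map fun r => 1 / (u - r)).sum := by
  rw [chebT''_eq, chebT'_eq, (splits_chebU k).eval_derivative_eq_eval_mul_sum (chebU_pos hu).ne']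
  ring

/-- `chebT'` is log-concave to the right of its largest root. -/
theorem chebT''_mul_le {m : ℕ} (hm : 1 ≤ m) {u t : ℝ} (hu : lo m < u) (hut : u ≤ t) :
    chebT'' m t * chebT' m u ≤ chebT'' m u * chebT' m t := by
  have ht := hu.trans_le hut
  have h1 := chebT'_pos hm hu
  have h2 := chebT'_pos hm ht
  obtain ⟨k, rfl⟩ := Nat.exists_eq_add_of_le' hm
  rw [chebT''_eq_mul_sum hu, chebT''_eq_mul_sum ht]
  have : ((Polynomial.Chebyshev.U ℝ k).roots.map fun r => 1 / (t - r)).sum ≤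
      ((Polynomial.Chebyshev.U ℝ k).roots.map fun r => 1 / (u - r)).sum := by
    refine Multiset.sum_map_le_sum_map _ _ fun r hr => ?_
    have := le_lo_of_mem_roots_chebU hr
    exact one_div_le_one_div_of_le (by linarith) (by linarith)
  nlinarith [mul_le_mul_of_nonneg_left this (mul_pos h1 h2).le]

theorem chebT''_nonneg {m : ℕ} (hm : 1 ≤ m) {u : ℝ} (hu : lo m < u) : 0 ≤ chebT'' m u := by
  have h1 := chebT'_pos hm hu
  obtain ⟨k, rfl⟩ := Nat.exists_eq_add_of_le' hm
  rw [chebT''_eq_mul_sum hu]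
  refine mul_nonneg h1.le (Multiset.sum_nonneg fun a ha => ?_)
  obtain ⟨r, hr, rfl⟩ := Multiset.mem_map.mp ha
  have := le_lo_of_mem_roots_chebU hr
  exact one_div_nonneg.mpr (by linarith)

theorem chebT''_pos {m : ℕ} (hm : 2 ≤ m) {u : ℝ} (hu : lo m < u) : 0 < chebT'' m u := by
  have h1 := chebT'_pos (by omega) hu
  obtain ⟨k, rfl⟩ := Nat.exists_eq_add_of_le' (show 1 ≤ m by omega)
  rw [chebT''_eq_mul_sum hu]
  refine mul_pos h1 ?_
  -- For m ≥ 2 the number `lo m` is itself a root, so the sum is not empty and strictness follows.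
  have hr : (lo (k + 1)) ∈ (Polynomial.Chebyshev.U ℝ k).roots := by
    rw [Polynomial.Chebyshev.roots_U_real]
    refine Finset.mem_image.mpr ⟨0, Finset.mem_range.mpr (by omega), by simp [lo]⟩
  rw [← Multiset.cons_erase hr, Multiset.map_cons, Multiset.sum_cons]
  refine add_pos_of_pos_of_nonneg (one_div_pos.mpr (by linarith)) (Multiset.sum_nonneg fun a ha => ?_)
  obtain ⟨r, hr, rfl⟩ := Multiset.mem_map.mp ha
  have := le_lo_of_mem_roots_chebU (Multiset.mem_of_mem_erase hr)
  exact one_div_nonneg.mpr (by linarith)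

theorem chebT'_lo {m : ℕ} (hm : 2 ≤ m) : chebT' m (lo m) = 0 := by
  obtain ⟨k, rfl⟩ := Nat.exists_eq_add_of_le' (show 1 ≤ m by omega)
  rw [chebT'_eq]
  have hr : (lo (k + 1)) ∈ (Polynomial.Chebyshev.U ℝ k).roots := by
    rw [Polynomial.Chebyshev.roots_U_real]
    refine Finset.mem_image.mpr ⟨0, Finset.mem_range.mpr (by omega), by simp [lo]⟩
  rw [(Polynomial.isRoot_of_mem_roots hr).eq_zero, mul_zero]

theorem strictMonoOn_chebT {m : ℕ} (hm : 1 ≤ m) : StrictMonoOn (chebT m) (Set.Ici (lo m)) := by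
  refine strictMonoOn_of_deriv_pos (convex_Ici _) (continuous_chebT m).continuousOn fun u hu => ?_
  rw [interior_Ici] at hu
  rw [(hasDerivAt_chebT m u).deriv]
  exact chebT'_pos hm hu

theorem monotoneOn_chebT' {m : ℕ} (hm : 1 ≤ m) : MonotoneOn (chebT' m) (Set.Ici (lo m)) := by
  refine monotoneOn_of_deriv_nonneg (convex_Ici _) (continuous_chebT' m).continuousOn
    (fun u _ => (hasDerivAt_chebT' m u).differentiableAt.differentiableWithinAt) fun u hu => ?_
  rw [interior_Ici] at hu
  rw [(hasDerivAt_chebT' m u).deriv]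
  exact chebT''_nonneg hm hu

theorem strictMonoOn_chebT' {m : ℕ} (hm : 2 ≤ m) :
    StrictMonoOn (chebT' m) (Set.Ici (lo m)) := by
  refine strictMonoOn_of_deriv_pos (convex_Ici _) (continuous_chebT' m).continuousOn fun u hu => ?_
  rw [interior_Ici] at hu
  rw [(hasDerivAt_chebT' m u).deriv]
  exact chebT''_pos hm hu

theorem convexOn_chebT {m : ℕ} (hm : 1 ≤ m) : ConvexOn ℝ (Set.Ici (lo m)) (chebT m) := by
  refine MonotoneOn.convexOn_of_deriv (convex_Ici _) (continuous_chebT m).continuousOn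
    (fun u _ => (hasDerivAt_chebT m u).differentiableAt.differentiableWithinAt) ?_
  have : deriv (chebT m) = chebT' m := funext fun u => (hasDerivAt_chebT m u).deriv
  rw [this]
  exact (monotoneOn_chebT' hm).mono interior_subset

/-- The tangent line inequality for `chebT`. -/
theorem chebT'_mul_sub_le {m : ℕ} (hm : 1 ≤ m) {u c : ℝ} (hu : lo m ≤ u) (hc : u < c) :
    chebT' m u * (c - u) ≤ chebT m c - chebT m u := by
  obtain ⟨ξ, hξ, h⟩ := exists_hasDerivAt_eq_slope (chebT m) (chebT' m) hc
    (continuous_chebT m).continuousOn fun t _ => hasDerivAt_chebT m t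
  rw [eq_div_iff (by linarith)] at h
  rw [← h]
  have := monotoneOn_chebT' hm hu (hu.trans hξ.1.le) hξ.1.le
  exact mul_le_mul_of_nonneg_right this (by linarith)

theorem chebT'_mul_sub_lt {m : ℕ} (hm : 2 ≤ m) {u c : ℝ} (hu : lo m ≤ u) (hc : u < c) :
    chebT' m u * (c - u) < chebT m c - chebT m u := by
  obtain ⟨ξ, hξ, h⟩ := exists_hasDerivAt_eq_slope (chebT m) (chebT' m) hc
    (continuous_chebT m).continuousOn fun t _ => hasDerivAt_chebT m t
  rw [eq_div_iff (by linarith)] at h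
  rw [← h]
  have := strictMonoOn_chebT' hm hu (hu.trans hξ.1.le) hξ.1
  exact mul_lt_mul_of_pos_right this (by linarith)

/-- The logarithmic derivative in `u` of the slope of `chebT m` on `[u, c]` is at most that of
`chebT' m`. -/
theorem log_deriv_slope_chebT {m : ℕ} (hm : 2 ≤ m) {u c : ℝ} (hu : lo m < u) (hc : u < c) :
    1 / (c - u) < chebT'' m u / chebT' m u + chebT' m u / (chebT m c - chebT m u) := by
  have hm1 : 1 ≤ m := by omega
  set l := chebT'' m u / chebT' m u with hl
  have h1 := chebT'_pos hm1 hu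
  have hl0 : 0 < l := div_pos (chebT''_pos hm hu) h1
  have hT : ∀ t, u < t → 0 < chebT m t - chebT m u := fun t ht =>
    sub_pos.mpr (strictMonoOn_chebT hm1 hu.le (hu.le.trans ht.le) ht)
  -- Log-concavity gives T''(t) ≤ l T'(t) for t ≥ u; this is its integral from u to t.
  have hmono : ∀ t, u ≤ t → chebT' m t - chebT' m u ≤ l * (chebT m t - chebT m u) := by
    have : MonotoneOn (fun t => l * chebT m t - chebT' m t) (Set.Ici u) := by
      refine monotoneOn_of_deriv_nonneg (convex_Ici _) (by
        have := continuous_chebT m; have := continuous_chebT' m; fun_prop)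
        (fun t _ => (((hasDerivAt_chebT m t).const_mul l).sub
          (hasDerivAt_chebT' m t)).differentiableAt.differentiableWithinAt) fun t ht => ?_
      rw [interior_Ici] at ht
      have hd : HasDerivAt (fun t => l * chebT m t - chebT' m t) (l * chebT' m t - chebT'' m t) t :=
        ((hasDerivAt_chebT m t).const_mul l).sub (hasDerivAt_chebT' m t)
      rw [hd.deriv, hl, sub_nonneg, div_mul_eq_mul_div, le_div_iff₀ h1]
      exact chebT''_mul_le hm1 hu (le_of_lt ht)
    intro t ht
    have := this (Set.mem_Ici.mpr le_rfl) ht ht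
    simp only at this
    linarith
  -- The claim with denominators cleared and c replaced by a variable t. The function vanishes at t
  -- = u, and by `hmono` its derivative is at least (t - u) T'(t) l > 0.
  have hψ : StrictMonoOn (fun t => (t - u) * (chebT m t - chebT m u) * l + (t - u) * chebT' m u
      - (chebT m t - chebT m u)) (Set.Ici u) := by
    refine strictMonoOn_of_deriv_pos (convex_Ici _) (by
        have := continuous_chebT m; fun_prop) fun t ht => ?_
    rw [interior_Ici] at ht
    have hd := hasDerivAt_chebT m t
    have hi : HasDerivAt (fun t => t - u) 1 t := (hasDerivAt_id t).sub_const u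
    have hD := (((hi.mul (hd.sub_const (chebT m u))).mul_const l).add
      (hi.mul_const (chebT' m u))).sub (hd.sub_const (chebT m u))
    have hD' := hD.deriv
    simp only [Pi.mul_def, Pi.add_def, Pi.sub_def] at hD'
    rw [hD']
    have h3 := hmono t (le_of_lt ht)
    have h4 : 0 < (t - u) * chebT' m t * l :=
      mul_pos (mul_pos (sub_pos.mpr ht) (chebT'_pos hm1 (hu.trans ht))) hl0
    nlinarith
  have := hψ (Set.mem_Ici.mpr le_rfl) (Set.mem_Ici.mpr hc.le) hc
  simp only [sub_self, zero_mul, mul_zero, add_zero] at this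
  have h5 := hT c hc
  have h6 : 0 < c - u := sub_pos.mpr hc
  rw [div_lt_iff₀ h6, add_mul, div_mul_eq_mul_div (chebT' m u), ← sub_lt_iff_lt_add', lt_div_iff₀ h5]
  nlinarith

/-! ### Strict monotonicity of the ratio N/D -/

/-- A weighted Chebyshev sum inequality. -/
theorem sum_sq_mul_sum_le {ι : Type*} [Fintype ι] (v t : ι → ℝ)
    (h : ∀ i j, 0 ≤ (v i - v j) * (t i * v j - t j * v i)) :
    (∑ j, v j ^ 2) * ∑ j, t j ≤ (∑ j, v j * t j) * ∑ j, v j := by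
  -- Summed over all ordered pairs, the hypothesis is twice the inequality sought.
  have h1 : 0 ≤ ∑ i, ∑ j, (v i - v j) * (t i * v j - t j * v i) :=
    Finset.sum_nonneg fun i _ => Finset.sum_nonneg fun j _ => h i j
  have h2 : ∑ i, ∑ j, (v i - v j) * (t i * v j - t j * v i)
      = (∑ i, ∑ j, (v i * t i) * v j - ∑ i, ∑ j, v i ^ 2 * t j)
        + (∑ i, ∑ j, v i * (v j * t j) - ∑ i, ∑ j, t i * v j ^ 2) := by
    simp only [← Finset.sum_sub_distrib, ← Finset.sum_add_distrib]
    exact Finset.sum_congr rfl fun i _ => Finset.sum_congr rfl fun j _ => by ring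
  simp only [← Finset.sum_mul_sum] at h2
  rw [h2] at h1
  nlinarith

/-- `Im G / sin θ`, up to a negative constant, as a function of `u = cos θ`. -/
def numK {n : ℕ} (m : ℕ) (c : Fin n → ℝ) (u : ℝ) : ℝ :=
  ∑ j, chebT' m u / (chebT m (c j) - chebT m u)

/-- `Im (U - V) / sin θ`, up to a positive constant, as a function of `u = cos θ`. -/
def denK {n : ℕ} (I : Finset (Fin n)) (c d : Fin n → ℝ) (u : ℝ) : ℝ :=
  ∑ i ∈ I, 1 / (d i + u) + ∑ j, 1 / (c j - u)

section

variable {n m : ℕ} {I : Finset (Fin n)} {c d : Fin n → ℝ} {u : ℝ}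

theorem chebT_sub_pos (hm : 1 ≤ m) {a : ℝ} (hu : lo m ≤ u) (ha : u < a) :
    0 < chebT m a - chebT m u :=
  sub_pos.mpr (strictMonoOn_chebT hm hu (hu.trans ha.le) ha)

theorem denK_pos (hn : 0 < n) (hc : ∀ j, u < c j) (hd : ∀ i ∈ I, 0 < d i + u) : 0 < denK I c d u := by
  have : Nonempty (Fin n) := ⟨⟨0, hn⟩⟩
  refine add_pos_of_nonneg_of_pos (Finset.sum_nonneg fun i hi => (one_div_pos.mpr (hd i hi)).le)
    (Finset.sum_pos (fun j _ => one_div_pos.mpr (sub_pos.mpr (hc j))) Finset.univ_nonempty)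

theorem numK_pos (hn : 0 < n) (hm : 1 ≤ m) (hu : lo m < u) (hc : ∀ j, u < c j) :
    0 < numK m c u := by
  have : Nonempty (Fin n) := ⟨⟨0, hn⟩⟩
  exact Finset.sum_pos (fun j _ => div_pos (chebT'_pos hm hu) (chebT_sub_pos hm hu.le (hc j)))
    Finset.univ_nonempty

/-- Termwise this is the tangent line inequality for T_m. It is strict for m ≥ 2; for m = 1 it is an
equality, and strictness comes from the terms over I. -/
theorem numK_lt_denK (hn : 0 < n) (hm : 1 ≤ m) (hnd : 2 ≤ m ∨ I.Nonempty) (hu : lo m ≤ u)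
    (hc : ∀ j, u < c j) (hd : ∀ i ∈ I, 0 < d i + u) : numK m c u < denK I c d u := by
  have : Nonempty (Fin n) := ⟨⟨0, hn⟩⟩
  have h0 : 0 ≤ ∑ i ∈ I, 1 / (d i + u) := Finset.sum_nonneg fun i hi => (one_div_pos.mpr (hd i hi)).le
  rw [numK, denK]
  have hle : ∀ j, chebT' m u / (chebT m (c j) - chebT m u) ≤ 1 / (c j - u) := fun j => by
    rw [div_le_div_iff₀ (chebT_sub_pos hm hu (hc j)) (sub_pos.mpr (hc j)), one_mul]
    exact chebT'_mul_sub_le hm hu (hc j)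
  rcases hnd with hm2 | hI
  · have : ∑ j, chebT' m u / (chebT m (c j) - chebT m u) < ∑ j, 1 / (c j - u) := by
      refine Finset.sum_lt_sum_of_nonempty Finset.univ_nonempty fun j _ => ?_
      rw [div_lt_div_iff₀ (chebT_sub_pos hm hu (hc j)) (sub_pos.mpr (hc j)), one_mul]
      exact chebT'_mul_sub_lt hm2 hu (hc j)
    linarith
  · have : 0 < ∑ i ∈ I, 1 / (d i + u) :=
      Finset.sum_pos (fun i hi => one_div_pos.mpr (hd i hi)) hI
    linarith [Finset.sum_le_sum fun j (_ : j ∈ Finset.univ) => hle j]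

theorem hasDerivAt_numK (hm : 1 ≤ m) (hu : lo m ≤ u) (hc : ∀ j, u < c j) :
    HasDerivAt (numK m c) (chebT'' m u * ∑ j, 1 / (chebT m (c j) - chebT m u)
      + chebT' m u ^ 2 * ∑ j, (1 / (chebT m (c j) - chebT m u)) ^ 2) u := by
  have h : HasDerivAt (numK m c) (∑ j, (chebT'' m u * (chebT m (c j) - chebT m u)
      - chebT' m u * (-chebT' m u)) / (chebT m (c j) - chebT m u) ^ 2) u := by
    unfold numK
    exact HasDerivAt.fun_sum fun j _ => (hasDerivAt_chebT' m u).div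
      ((hasDerivAt_chebT m u).const_sub _) (chebT_sub_pos hm hu (hc j)).ne'
  convert h using 1
  rw [Finset.mul_sum, Finset.mul_sum, ← Finset.sum_add_distrib]
  refine Finset.sum_congr rfl fun j _ => ?_
  have := (chebT_sub_pos hm hu (hc j)).ne'
  field_simp
  ring

theorem hasDerivAt_denK (hc : ∀ j, u < c j) (hd : ∀ i ∈ I, 0 < d i + u) :
    HasDerivAt (denK I c d) (-∑ i ∈ I, (1 / (d i + u)) ^ 2 + ∑ j, (1 / (c j - u)) ^ 2) u := by
  have h : HasDerivAt (denK I c d) (∑ i ∈ I, -1 / (d i + u) ^ 2 + ∑ j, -(-1) / (c j - u) ^ 2) u := by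
    unfold denK
    refine (HasDerivAt.fun_sum fun i hi => ?_).add (HasDerivAt.fun_sum fun j _ => ?_)
    · simp only [one_div]
      exact ((hasDerivAt_id u).const_add (d i)).inv (hd i hi).ne'
    · simp only [one_div]
      exact ((hasDerivAt_id u).const_sub (c j)).inv (sub_pos.mpr (hc j)).ne'
  convert h using 1
  rw [← Finset.sum_neg_distrib]
  congr 1 <;> refine Finset.sum_congr rfl fun j _ => ?_
  · rw [div_pow, one_pow, neg_div]
  · rw [div_pow, one_pow, neg_neg]

/-- The Wronskian inequality that makes `numK / denK` strictly increasing. -/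
theorem numK_mul_deriv_denK_lt (hn : 0 < n) (hm : 1 ≤ m) (hnd : 2 ≤ m ∨ I.Nonempty)
    (hu : lo m < u) (hc : ∀ j, u < c j) (hd : ∀ i ∈ I, 0 < d i + u) :
    numK m c u * (-∑ i ∈ I, (1 / (d i + u)) ^ 2 + ∑ j, (1 / (c j - u)) ^ 2)
      < (chebT'' m u * ∑ j, 1 / (chebT m (c j) - chebT m u)
      + chebT' m u ^ 2 * ∑ j, (1 / (chebT m (c j) - chebT m u)) ^ 2) * denK I c d u := by
  have : Nonempty (Fin n) := ⟨⟨0, hn⟩⟩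
  have h1 := chebT'_pos hm hu
  have hv0 : ∀ j, 0 < 1 / (c j - u) := fun j => one_div_pos.mpr (sub_pos.mpr (hc j))
  have hT0 : ∀ j, 0 < chebT m (c j) - chebT m u := fun j => chebT_sub_pos hm hu.le (hc j)
  have hN : numK m c u = chebT' m u * ∑ j, 1 / (chebT m (c j) - chebT m u) := by
    rw [numK, Finset.mul_sum]
    exact Finset.sum_congr rfl fun j _ => by ring
  -- With v_j = 1/(c_j - u) and t_j = 1/(T(c_j) - T(u)), the quotient v_j/t_j is a secant slope of
  -- T, which grows with c_j by convexity, while v_j falls. This is the sign condition of the sum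
  -- inequality.
  have hcheb := sum_sq_mul_sum_le (fun j => 1 / (c j - u))
      (fun j => 1 / (chebT m (c j) - chebT m u)) fun i j => by
    have key : ∀ i j, c i ≤ c j → 0 ≤ (1 / (c i - u) - 1 / (c j - u)) *
        (1 / (chebT m (c i) - chebT m u) * (1 / (c j - u))
          - 1 / (chebT m (c j) - chebT m u) * (1 / (c i - u))) := by
      intro i j hij
      have hi := sub_pos.mpr (hc i)
      have hj := sub_pos.mpr (hc j)
      refine mul_nonneg (sub_nonneg.mpr (one_div_le_one_div_of_le hi (by linarith)))
        (sub_nonneg.mpr ?_)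
      rw [div_mul_div_comm, div_mul_div_comm, one_mul]
      refine one_div_le_one_div_of_le (mul_pos (hT0 i) hj) ?_
      rcases hij.eq_or_lt with h | h
      · rw [h]
      · have hsl := (convexOn_chebT hm).secant_mono_aux2 (Set.mem_Ici.mpr hu.le)
          (Set.mem_Ici.mpr (hu.le.trans (hc j).le)) (hc i) h
        rwa [div_le_div_iff₀ hi hj] at hsl
    rcases le_total (c i) (c j) with h | h
    · exact key i j h
    · have := key j i h
      nlinarith
  set t : Fin n → ℝ := fun j => 1 / (chebT m (c j) - chebT m u) with ht
  set v : Fin n → ℝ := fun j => 1 / (c j - u) with hv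
  have ht0 : ∀ j, 0 < t j := fun j => one_div_pos.mpr (hT0 j)
  have hst : 0 < ∑ j, t j := Finset.sum_pos (fun j _ => ht0 j) Finset.univ_nonempty
  have hsv : 0 < ∑ j, v j := Finset.sum_pos (fun j _ => hv0 j) Finset.univ_nonempty
  have hT2 := chebT''_nonneg hm hu
  have he0 : 0 ≤ ∑ i ∈ I, 1 / (d i + u) :=
    Finset.sum_nonneg fun i hi => (one_div_pos.mpr (hd i hi)).le
  have he2 : 0 ≤ ∑ i ∈ I, (1 / (d i + u)) ^ 2 := Finset.sum_nonneg fun i _ => sq_nonneg _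
  have ht2 : 0 ≤ ∑ j, t j ^ 2 := Finset.sum_nonneg fun i _ => sq_nonneg _
  have hterm : ∀ j, chebT' m u * (v j * t j) =
      (v j * chebT' m u) * t j := fun j => by ring
  rw [hN, denK]
  change chebT' m u * (∑ j, t j) * (-_ + ∑ j, v j ^ 2) <
    (chebT'' m u * (∑ j, t j) + chebT' m u ^ 2 * ∑ j, t j ^ 2) * (_ + ∑ j, v j)
  have hR : 0 ≤ chebT'' m u * (∑ j, t j) + chebT' m u ^ 2 * ∑ j, t j ^ 2 :=
    add_nonneg (mul_nonneg hT2 hst.le) (by positivity)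
  have hRe := mul_nonneg hR he0
  have hLe := mul_nonneg (mul_pos h1 hst).le he2
  have hcheb' := mul_le_mul_of_nonneg_left hcheb h1.le
  have hsum : chebT'' m u * (∑ j, t j) + chebT' m u ^ 2 * ∑ j, t j ^ 2
      = ∑ j, (chebT'' m u + chebT' m u ^ 2 * t j) * t j := by
    rw [Finset.mul_sum, Finset.mul_sum, ← Finset.sum_add_distrib]
    exact Finset.sum_congr rfl fun j _ => by ring
  -- The terms over I enter with favourable signs on both sides. What remains is T' ∑t ∑v² ≤ T' ∑vt
  -- ∑v ≤ (T'' ∑t + T'² ∑t²) ∑v, whose second step is `log_deriv_slope_chebT` multiplied by T' t_j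
  -- and summed.
  rcases hnd with hm2 | hI
  · have hlt : chebT' m u * ∑ j, v j * t j
        < chebT'' m u * (∑ j, t j) + chebT' m u ^ 2 * ∑ j, t j ^ 2 := by
      rw [hsum, Finset.mul_sum]
      refine Finset.sum_lt_sum_of_nonempty Finset.univ_nonempty fun j _ => ?_
      rw [hterm]
      refine mul_lt_mul_of_pos_right ?_ (ht0 j)
      have := mul_lt_mul_of_pos_right (log_deriv_slope_chebT hm2 hu (hc j)) h1
      rw [add_mul, div_mul_cancel₀ _ h1.ne'] at this
      simp only [hv, ht]
      refine this.trans_eq ?_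
      ring
    nlinarith [mul_lt_mul_of_pos_right hlt hsv]
  · have hle : chebT' m u * ∑ j, v j * t j
        ≤ chebT'' m u * (∑ j, t j) + chebT' m u ^ 2 * ∑ j, t j ^ 2 := by
      rw [hsum, Finset.mul_sum]
      refine Finset.sum_le_sum fun j _ => ?_
      rw [hterm]
      refine mul_le_mul_of_nonneg_right ?_ (ht0 j).le
      rcases hm.eq_or_lt with h | h
      · subst h
        simp only [hv, ht, chebT_one, chebT'_one, chebT''_one]
        apply le_of_eq; ring
      · have := mul_lt_mul_of_pos_right (log_deriv_slope_chebT h hu (hc j)) h1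
        rw [add_mul, div_mul_cancel₀ _ h1.ne'] at this
        simp only [hv, ht]
        refine this.le.trans_eq ?_
        ring
    -- The second step may be an equality here, as it is for m = 1, so strictness is taken from the
    -- squares over I.
    have he : 0 < ∑ i ∈ I, (1 / (d i + u)) ^ 2 :=
      Finset.sum_pos (fun i hi => pow_pos (one_div_pos.mpr (hd i hi)) 2) hI
    nlinarith [mul_le_mul_of_nonneg_right hle hsv.le, mul_pos (mul_pos h1 hst) he]

/-- `numK / denK` is strictly increasing in `u`. -/
theorem strictMonoOn_numK_div_denK (hn : 0 < n) (hm : 1 ≤ m) (hnd : 2 ≤ m ∨ I.Nonempty)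
    (hc : ∀ j, 1 ≤ c j) (hd : ∀ i ∈ I, 1 ≤ d i) :
    StrictMonoOn (fun u => numK m c u / denK I c d u) (Set.Ioo (lo m) 1) := by
  have hc' : ∀ u ∈ Set.Ioo (lo m) 1, ∀ j, u < c j := fun u hu j => hu.2.trans_le (hc j)
  have hd' : ∀ u ∈ Set.Ioo (lo m) 1, ∀ i ∈ I, 0 < d i + u := fun u hu i hi => by
    linarith [hd i hi, hu.1, neg_one_le_lo m]
  have hD : ∀ u ∈ Set.Ioo (lo m) 1, HasDerivAt (fun u => numK m c u / denK I c d u) _ u :=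
    fun u hu => (hasDerivAt_numK hm hu.1.le (hc' u hu)).div (hasDerivAt_denK (hc' u hu) (hd' u hu))
      (denK_pos hn (hc' u hu) (hd' u hu)).ne'
  refine strictMonoOn_of_deriv_pos (convex_Ioo _ _)
    (fun u hu => (hD u hu).continuousAt.continuousWithinAt) fun u hu => ?_
  rw [interior_Ioo] at hu
  rw [(hD u hu).deriv]
  have hp := denK_pos (I := I) hn (hc' u hu) (hd' u hu)
  exact div_pos (sub_pos.mpr (numK_mul_deriv_denK_lt hn hm hnd hu.1 (hc' u hu) (hd' u hu)))
    (by positivity)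

end

/-! ### Imaginary parts in polar coordinates -/

/-- The Joukowski function `(q + 1/q) / 2`. -/
def jouk (q : ℝ) : ℝ := (q + q⁻¹) / 2

theorem one_le_jouk {q : ℝ} (hq : 0 < q) : 1 ≤ jouk q := by
  rw [jouk, le_div_iff₀ two_pos]
  have : q * q⁻¹ = 1 := mul_inv_cancel₀ hq.ne'
  nlinarith [sq_nonneg (q - q⁻¹), inv_pos.mpr hq]

theorem one_lt_jouk {q : ℝ} (hq : 0 < q) (h1 : q ≠ 1) : 1 < jouk q := by
  refine (one_le_jouk hq).lt_of_ne fun h => h1 ?_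
  rw [jouk, eq_div_iff two_ne_zero] at h
  field_simp at h
  nlinarith [sq_nonneg (q - 1)]

theorem jouk_one : jouk 1 = 1 := by norm_num [jouk]

theorem continuousAt_jouk {q : ℝ} (hq : q ≠ 0) : ContinuousAt jouk q := by
  unfold jouk
  exact (continuousAt_id.add (continuousAt_inv₀ hq)).div_const 2

/-- For q = e^s the Joukowski value is cosh s, and T_m(cosh s) = cosh(ms). -/
theorem chebT_jouk (m : ℕ) {q : ℝ} (hq : 0 < q) : chebT m (jouk q) = jouk (q ^ m) := by
  have h : ∀ p : ℝ, 0 < p → jouk p = Real.cosh (Real.log p) := fun p hp => by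
    rw [Real.cosh_log hp, jouk]
  rw [h q hq, h _ (pow_pos hq m), chebT, Polynomial.Chebyshev.T_real_cosh, Real.log_pow]
  simp

theorem sin_mul_chebT' {m : ℕ} (hm : 1 ≤ m) (θ : ℝ) :
    Real.sin θ * chebT' m (Real.cos θ) = m * Real.sin (m * θ) := by
  obtain ⟨k, rfl⟩ := Nat.exists_eq_add_of_le' hm
  have := Polynomial.Chebyshev.U_real_cos θ k
  rw [chebT'_eq]
  push_cast at this ⊢
  rw [← this]
  ring

theorem chebT_cos (m : ℕ) (θ : ℝ) : chebT m (Real.cos θ) = Real.cos (m * θ) := by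
  rw [chebT, Polynomial.Chebyshev.T_real_cos]; simp

open Complex in
-- The numerator contributes -a R sin φ, and |z - a|² = 2Ra (jouk(R/a) - cos φ) for z = R e^{iφ}.
theorem im_div_sub {R a φ : ℝ} (hR : 0 < R) (ha : 0 < a) :
    ((R * exp (φ * I)) / (R * exp (φ * I) - a)).im
      = -(1 / 2) * (Real.sin φ / (jouk (R / a) - Real.cos φ)) := by
  have hre : (R * exp (φ * I) : ℂ).re = R * Real.cos φ := by
    rw [re_ofReal_mul, exp_ofReal_mul_I_re]
  have him : (R * exp (φ * I) : ℂ).im = R * Real.sin φ := by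
    rw [im_ofReal_mul, exp_ofReal_mul_I_im]
  have hns : normSq (R * exp (φ * I) - a) = 2 * R * a * (jouk (R / a) - Real.cos φ) := by
    rw [normSq_apply, sub_re, sub_im, hre, him, ofReal_re, ofReal_im, jouk]
    field_simp
    linear_combination (R ^ 2) * Real.sin_sq_add_cos_sq φ
  rw [div_im, hns, sub_re, sub_im, hre, him, ofReal_re, ofReal_im]
  -- This is the case z = a, where both sides are 0 by the convention on division by zero.
  by_cases h : jouk (R / a) - Real.cos φ = 0
  · simp [h]
  · field_simp
    ring

open Complex in
theorem im_mul_div_one_add {R a φ : ℝ} (hR : 0 < R) (ha : 0 < a) :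
    (a * (R * exp (φ * I)) / (1 + a * (R * exp (φ * I)))).im
      = 1 / 2 * (Real.sin φ / (jouk (R * a) + Real.cos φ)) := by
  have hre : (a * (R * exp (φ * I)) : ℂ).re = a * (R * Real.cos φ) := by
    rw [re_ofReal_mul, re_ofReal_mul, exp_ofReal_mul_I_re]
  have him : (a * (R * exp (φ * I)) : ℂ).im = a * (R * Real.sin φ) := by
    rw [im_ofReal_mul, im_ofReal_mul, exp_ofReal_mul_I_im]
  have hns : normSq (1 + a * (R * exp (φ * I))) = 2 * R * a * (jouk (R * a) + Real.cos φ) := by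
    rw [normSq_apply, add_re, add_im, hre, him, one_re, one_im, jouk]
    field_simp
    linear_combination (R ^ 2 * a ^ 2) * Real.sin_sq_add_cos_sq φ
  rw [div_im, hns, add_re, add_im, hre, him, one_re, one_im]
  by_cases h : jouk (R * a) + Real.cos φ = 0
  · simp [h]
  · field_simp
    ring

/-- `κ U + (1 - κ) V + W`, which is `(1 - κ) F_{κ,m}`. -/
def fK {n : ℕ} (x y : Fin n → ℝ) (I : Finset (Fin n)) (m : ℕ) (κ : ℝ) (z : ℂ) : ℂ :=
  κ * U y I z + (1 - κ) * V x z + W x m z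

/-- `V + W`. -/
def G {n : ℕ} (x : Fin n → ℝ) (m : ℕ) (z : ℂ) : ℂ :=
  m / n * ∑ j, z ^ m / (z ^ m - (x j : ℂ) ^ m)

section

variable {n m : ℕ} {x y : Fin n → ℝ} {I : Finset (Fin n)}

/-- The terms 1/(z - x_j) cancel, and what is left depends on z only through z^m. -/
theorem V_add_W (hm : 1 ≤ m) (z : ℂ) : V x z + W x m z = G x m z := by
  obtain ⟨k, rfl⟩ := Nat.exists_eq_add_of_le' hm
  rw [V, W, G, ← mul_add, ← Finset.sum_add_distrib, Finset.mul_sum, Finset.mul_sum]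
  refine Finset.sum_congr rfl fun j _ => ?_
  rw [Nat.add_sub_cancel, pow_succ z k]
  ring

theorem fK_eq (hm : 1 ≤ m) (κ : ℝ) (z : ℂ) :
    fK x y I m κ z = κ * (U y I z - V x z) + G x m z := by
  rw [fK, ← V_add_W hm]; ring

theorem F_eq {κ : ℝ} (hκ : κ ≠ 1) (z : ℂ) : F x y I κ m z = fK x y I m κ z / (1 - κ) := by
  have h : (1 - κ : ℂ) ≠ 0 := by
    rw [sub_ne_zero]; exact_mod_cast hκ.symm
  have h2 : ∑ j, z / (n * (z - x j)) = z / n * ∑ j, 1 / (z - x j) := by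
    rw [Finset.mul_sum]
    exact Finset.sum_congr rfl fun j _ => by rw [div_mul_div_comm, mul_one]
  rw [F, fK, U, V, W, h2]
  by_cases hn : (n : ℂ) = 0
  · simp [hn]
  · field_simp

/-- The arguments `cosh (log ρ - log x_j)` at modulus `ρ`. -/
def cx {n : ℕ} (x : Fin n → ℝ) (ρ : ℝ) (j : Fin n) : ℝ := jouk (ρ / x j)

/-- The arguments `cosh (log ρ + log y_i)` at modulus `ρ`. -/
def dy {n : ℕ} (y : Fin n → ℝ) (ρ : ℝ) (i : Fin n) : ℝ := jouk (ρ * y i)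

theorem one_le_cx (hx : ∀ j, 0 < x j) {ρ : ℝ} (hρ : 0 < ρ) (j : Fin n) : 1 ≤ cx x ρ j :=
  one_le_jouk (div_pos hρ (hx j))

theorem one_lt_cx (hx : ∀ j, 0 < x j) {ρ : ℝ} (hρ : 0 < ρ) {j : Fin n} (h : ρ ≠ x j) :
    1 < cx x ρ j :=
  one_lt_jouk (div_pos hρ (hx j)) (by rwa [ne_eq, div_eq_one_iff_eq (hx j).ne'])

theorem one_le_dy (hy : ∀ i ∈ I, 0 < y i) {ρ : ℝ} (hρ : 0 < ρ) : ∀ i ∈ I, 1 ≤ dy y ρ i :=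
  fun i hi => one_le_jouk (mul_pos hρ (hy i hi))

open Complex in
theorem im_U_sub_V (hx : ∀ j, 0 < x j) (hy : ∀ i ∈ I, 0 < y i) {ρ : ℝ} (hρ : 0 < ρ) (θ : ℝ) :
    (U y I (ρ * exp (θ * Complex.I)) - V x (ρ * exp (θ * Complex.I))).im
      = Real.sin θ / (2 * n) * denK I (cx x ρ) (dy y ρ) (Real.cos θ) := by
  set z : ℂ := ρ * exp (θ * Complex.I) with hz
  have hU : U y I z = ((1 / n : ℝ) : ℂ) * ∑ i ∈ I, y i * z / (1 + y i * z) := by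
    rw [U, Finset.mul_sum, Finset.mul_sum]
    refine Finset.sum_congr rfl fun i _ => ?_
    push_cast; ring
  have hV : V x z = ((1 / n : ℝ) : ℂ) * ∑ j, z / (z - x j) := by
    rw [V, Finset.mul_sum, Finset.mul_sum]
    refine Finset.sum_congr rfl fun i _ => ?_
    push_cast; ring
  rw [sub_im, hU, hV, im_ofReal_mul, im_ofReal_mul, im_sum, im_sum, denK,
    Finset.sum_congr rfl fun i hi => im_mul_div_one_add (φ := θ) hρ (hy i hi),
    Finset.sum_congr rfl fun j _ => im_div_sub (φ := θ) hρ (hx j), mul_add, ← mul_sub]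
  simp only [Finset.mul_sum]
  rw [mul_sub, Finset.mul_sum, Finset.mul_sum, sub_eq_add_neg, ← Finset.sum_neg_distrib]
  congr 1 <;> refine Finset.sum_congr rfl fun j _ => ?_
  · rw [dy]; ring
  · rw [cx]; ring

open Complex in
-- The m-th power has modulus ρ^m and argument mθ, so `im_div_sub` applies to ρ^m and x_j^m. The
-- identities for T_m at cosh and cos, and m sin mθ = sin θ T_m'(cos θ), return everything to u =
-- cos θ.
theorem im_G (hm : 1 ≤ m) (hx : ∀ j, 0 < x j) {ρ : ℝ} (hρ : 0 < ρ) (θ : ℝ) :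
    (G x m (ρ * exp (θ * Complex.I))).im
      = -(Real.sin θ / (2 * n) * numK m (cx x ρ) (Real.cos θ)) := by
  have hz : (ρ * exp (θ * Complex.I)) ^ m = ((ρ ^ m : ℝ) : ℂ) * exp ((m * θ : ℝ) * Complex.I) := by
    rw [mul_pow, ← exp_nat_mul]; push_cast; ring_nf
  have hG : G x m (ρ * exp (θ * Complex.I)) = ((m / n : ℝ) : ℂ) * ∑ j,
      ((ρ ^ m : ℝ) : ℂ) * exp ((m * θ : ℝ) * Complex.I) /
        (((ρ ^ m : ℝ) : ℂ) * exp ((m * θ : ℝ) * Complex.I) - ((x j ^ m : ℝ) : ℂ)) := by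
    rw [G, hz]; push_cast; rfl
  rw [hG, im_ofReal_mul, im_sum, Finset.sum_congr rfl fun j _ =>
    im_div_sub (φ := m * θ) (pow_pos hρ m) (pow_pos (hx j) m), numK, Finset.mul_sum,
    Finset.mul_sum, ← Finset.sum_neg_distrib]
  refine Finset.sum_congr rfl fun j _ => ?_
  rw [cx, chebT_jouk m (div_pos hρ (hx j)), chebT_cos, ← div_pow]
  have h := sin_mul_chebT' hm θ
  have e : Real.sin θ / (2 * n) * (chebT' m (Real.cos θ) /
      (jouk ((ρ / x j) ^ m) - Real.cos (m * θ))) = (Real.sin θ * chebT' m (Real.cos θ)) / (2 * n)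
        / (jouk ((ρ / x j) ^ m) - Real.cos (m * θ)) := by ring
  rw [e, h]
  ring

/-- `Im (κ U + (1 - κ) V + W) / sin θ`, up to a positive constant. -/
def bal {n : ℕ} (x y : Fin n → ℝ) (I : Finset (Fin n)) (m : ℕ) (κ ρ u : ℝ) : ℝ :=
  κ * denK I (cx x ρ) (dy y ρ) u - numK m (cx x ρ) u

open Complex in
theorem im_fK (hm : 1 ≤ m) (hx : ∀ j, 0 < x j) (hy : ∀ i ∈ I, 0 < y i) {ρ : ℝ} (hρ : 0 < ρ)
    (κ θ : ℝ) :
    (fK x y I m κ (ρ * exp (θ * Complex.I))).im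
      = Real.sin θ / (2 * n) * bal x y I m κ ρ (Real.cos θ) := by
  rw [fK_eq hm, add_im, im_ofReal_mul, im_U_sub_V hx hy hρ, im_G hm hx hρ, bal]
  ring

end

/-! ### The level curves of height κ, parametrized by the modulus -/

/-- The standing assumptions on the data. -/
structure Admissible {n : ℕ} (x y : Fin n → ℝ) (I : Finset (Fin n)) (m : ℕ) : Prop where
  n_pos : 0 < n
  one_le : 1 ≤ m
  x_pos : ∀ j, 0 < x j
  x_inj : Function.Injective x
  y_pos : ∀ i ∈ I, 0 < y i
  nondeg : 2 ≤ m ∨ I.Nonempty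

/-- The cosine of the argument of the point of modulus `ρ` on the level curve of height `κ`: the
place where `bal` changes its sign. -/
def uK {n : ℕ} (x y : Fin n → ℝ) (I : Finset (Fin n)) (m : ℕ) (κ ρ : ℝ) : ℝ :=
  sSup (insert (lo m) {u | u ∈ Set.Ioo (lo m) 1 ∧ 0 < bal x y I m κ ρ u})

section

variable {n m : ℕ} {x y : Fin n → ℝ} {I : Finset (Fin n)}

theorem Admissible.lt_cx (h : Admissible x y I m) {ρ u : ℝ} (hρ : 0 < ρ) (hu : u < 1) (j : Fin n) :
    u < cx x ρ j := hu.trans_le (one_le_cx h.x_pos hρ j)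

theorem Admissible.dy_add_pos (h : Admissible x y I m) {ρ u : ℝ} (hρ : 0 < ρ) (hu : -1 < u) :
    ∀ i ∈ I, 0 < dy y ρ i + u := fun i hi => by
  linarith [one_le_dy h.y_pos hρ i hi]

theorem Admissible.neg_one_lt (_ : Admissible x y I m) {u : ℝ} (hu : lo m < u) : -1 < u :=
  (neg_one_le_lo m).trans_lt hu

/-- The sign of `bal` is that of κ - N/D, and N/D is strictly increasing: there is at most one sign
change, from positive to negative. -/
theorem Admissible.bal_neg_of_lt (h : Admissible x y I m) {κ ρ u v : ℝ} (hρ : 0 < ρ)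
    (hu : u ∈ Set.Ioo (lo m) 1) (hv : v ∈ Set.Ioo (lo m) 1) (huv : u < v)
    (hb : bal x y I m κ ρ u ≤ 0) : bal x y I m κ ρ v < 0 := by
  have hmono := strictMonoOn_numK_div_denK h.n_pos h.one_le h.nondeg
    (one_le_cx h.x_pos hρ) (one_le_dy h.y_pos hρ) hu hv huv
  have hpu := denK_pos (I := I) h.n_pos (h.lt_cx hρ hu.2) (h.dy_add_pos hρ (h.neg_one_lt hu.1))
  have hpv := denK_pos (I := I) h.n_pos (h.lt_cx hρ hv.2) (h.dy_add_pos hρ (h.neg_one_lt hv.1))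
  rw [bal, sub_nonpos] at hb
  rw [bal, sub_neg]
  rw [← le_div_iff₀ hpu] at hb
  rw [← lt_div_iff₀ hpv]
  exact hb.trans_lt hmono

theorem hasDerivAt_bal (hm : 1 ≤ m) {κ ρ u : ℝ} (hu : lo m ≤ u)
    (hc : ∀ j, u < cx x ρ j) (hd : ∀ i ∈ I, 0 < dy y ρ i + u) :
    HasDerivAt (bal x y I m κ ρ)
      (κ * (-∑ i ∈ I, (1 / (dy y ρ i + u)) ^ 2 + ∑ j, (1 / (cx x ρ j - u)) ^ 2)
      - (chebT'' m u * ∑ j, 1 / (chebT m (cx x ρ j) - chebT m u)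
      + chebT' m u ^ 2 * ∑ j, (1 / (chebT m (cx x ρ j) - chebT m u)) ^ 2)) u :=
  ((hasDerivAt_denK hc hd).const_mul κ).sub (hasDerivAt_numK hm hu hc)

/-- `bal` crosses zero transversally. -/
theorem Admissible.exists_hasDerivAt_bal_neg (h : Admissible x y I m) {κ ρ u : ℝ} (hρ : 0 < ρ)
    (hu : u ∈ Set.Ioo (lo m) 1) (hb : bal x y I m κ ρ u = 0) :
    ∃ b' < 0, HasDerivAt (bal x y I m κ ρ) b' u := by
  have hc := h.lt_cx hρ hu.2
  have hd := h.dy_add_pos hρ (h.neg_one_lt hu.1)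
  refine ⟨_, ?_, hasDerivAt_bal h.one_le hu.1.le hc hd⟩
  have hp := denK_pos (I := I) h.n_pos hc hd
  have hlt := numK_mul_deriv_denK_lt h.n_pos h.one_le h.nondeg hu.1 hc hd
  -- At a zero κ equals N/D, so the derivative κ D' - N' is negative exactly by the Wronskian
  -- inequality.
  have hκ : κ = numK m (cx x ρ) u / denK I (cx x ρ) (dy y ρ) u := by
    rw [bal] at hb
    rw [eq_div_iff hp.ne']
    linarith
  rw [hκ, sub_neg, div_mul_eq_mul_div, div_lt_iff₀ hp]
  exact hlt

theorem continuousAt_cx (hx : ∀ j, 0 < x j) {ρ : ℝ} (hρ : 0 < ρ) (j : Fin n) :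
    ContinuousAt (fun ρ => cx x ρ j) ρ := by
  unfold cx
  exact (continuousAt_jouk (div_pos hρ (hx j)).ne').comp (f := fun ρ => ρ / x j)
    (continuousAt_id.div_const _)

theorem continuousAt_dy {ρ : ℝ} (hρ : 0 < ρ) {i : Fin n} (hi : 0 < y i) :
    ContinuousAt (fun ρ => dy y ρ i) ρ := by
  unfold dy
  exact (continuousAt_jouk (mul_pos hρ hi).ne').comp (f := fun ρ => ρ * y i)
    (continuousAt_id.mul_const _)

/-- `bal` is jointly continuous away from its poles. -/
theorem Admissible.continuousAt_bal (h : Admissible x y I m) {κ ρ u : ℝ} (hρ : 0 < ρ)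
    (hu : lo m ≤ u) (hc : ∀ j, u < cx x ρ j) (hd : ∀ i ∈ I, 0 < dy y ρ i + u) :
    ContinuousAt (fun p : ℝ × ℝ × ℝ => bal x y I m p.1 p.2.1 p.2.2) (κ, ρ, u) := by
  have h2 : ContinuousAt (fun p : ℝ × ℝ × ℝ => p.2.1) (κ, ρ, u) := by fun_prop
  have h3 : ContinuousAt (fun p : ℝ × ℝ × ℝ => p.2.2) (κ, ρ, u) := by fun_prop
  have hcx : ∀ j, ContinuousAt (fun p : ℝ × ℝ × ℝ => cx x p.2.1 j) (κ, ρ, u) := fun j =>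
    ContinuousAt.comp (g := fun ρ => cx x ρ j) (f := fun p : ℝ × ℝ × ℝ => p.2.1)
      (continuousAt_cx h.x_pos hρ j) h2
  have hT : ∀ {f : ℝ × ℝ × ℝ → ℝ}, ContinuousAt f (κ, ρ, u) →
      ContinuousAt (fun p => chebT m (f p)) (κ, ρ, u) := fun hf =>
    (continuous_chebT m).continuousAt.comp hf
  unfold bal denK numK
  refine (ContinuousAt.mul (by fun_prop) (ContinuousAt.add ?_ ?_)).sub ?_
  · refine tendsto_finsetSum _ fun i hi => ?_
    have hdy : ContinuousAt (fun p : ℝ × ℝ × ℝ => dy y p.2.1 i) (κ, ρ, u) :=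
      ContinuousAt.comp (g := fun ρ => dy y ρ i) (f := fun p : ℝ × ℝ × ℝ => p.2.1)
        (continuousAt_dy hρ (h.y_pos i hi)) h2
    exact continuousAt_const.div (hdy.add h3) (hd i hi).ne'
  · refine tendsto_finsetSum _ fun j _ => ?_
    exact continuousAt_const.div ((hcx j).sub h3) (sub_pos.mpr (hc j)).ne'
  · refine tendsto_finsetSum _ fun j _ => ?_
    exact ((continuous_chebT' m).continuousAt.comp h3).div ((hT (hcx j)).sub (hT h3))
      (chebT_sub_pos h.one_le hu (hc j)).ne'

theorem Admissible.continuousAt_bal_u (h : Admissible x y I m) {κ ρ u : ℝ} (hρ : 0 < ρ)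
    (hu : lo m ≤ u) (hc : ∀ j, u < cx x ρ j) (hd : ∀ i ∈ I, 0 < dy y ρ i + u) :
    ContinuousAt (bal x y I m κ ρ) u :=
  (h.continuousAt_bal hρ hu hc hd).comp (f := fun u : ℝ => (κ, ρ, u)) (by fun_prop)

theorem Admissible.bddAbove_uK (h : Admissible x y I m) (κ ρ : ℝ) :
    BddAbove (insert (lo m) {u | u ∈ Set.Ioo (lo m) 1 ∧ 0 < bal x y I m κ ρ u}) := by
  refine ⟨1, ?_⟩
  rintro u (rfl | hu)
  · exact (lo_lt_one h.one_le).le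
  · exact hu.1.2.le

theorem Admissible.lo_le_uK (h : Admissible x y I m) (κ ρ : ℝ) : lo m ≤ uK x y I m κ ρ :=
  le_csSup (h.bddAbove_uK κ ρ) (Set.mem_insert _ _)

theorem Admissible.uK_le_one (h : Admissible x y I m) (κ ρ : ℝ) : uK x y I m κ ρ ≤ 1 := by
  refine csSup_le (Set.insert_nonempty _ _) ?_
  rintro u (rfl | hu)
  · exact (lo_lt_one h.one_le).le
  · exact hu.1.2.le

theorem Admissible.le_uK (h : Admissible x y I m) {κ ρ u : ℝ} (hu : u ∈ Set.Ioo (lo m) 1)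
    (hb : 0 < bal x y I m κ ρ u) : u ≤ uK x y I m κ ρ :=
  le_csSup (h.bddAbove_uK κ ρ) (Set.mem_insert_of_mem _ ⟨hu, hb⟩)

/-- By the single sign change the set under the supremum is an initial segment of (lo m, 1). The
inserted point `lo m` only provides the supremum when that segment is empty. -/
theorem Admissible.bal_pos_of_lt_uK (h : Admissible x y I m) {κ ρ u : ℝ} (hρ : 0 < ρ)
    (hu : u ∈ Set.Ioo (lo m) 1) (hlt : u < uK x y I m κ ρ) : 0 < bal x y I m κ ρ u := by
  obtain ⟨v, hv, huv⟩ := exists_lt_of_lt_csSup (Set.insert_nonempty _ _) hlt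
  rcases hv with rfl | hv
  · exact absurd huv hu.1.not_gt
  · by_contra hb
    exact (h.bal_neg_of_lt hρ hu hv.1 huv (not_lt.mp hb)).not_gt hv.2

theorem Admissible.bal_neg_of_uK_lt (h : Admissible x y I m) {κ ρ u : ℝ} (hρ : 0 < ρ)
    (hu : u ∈ Set.Ioo (lo m) 1) (hlt : uK x y I m κ ρ < u) : bal x y I m κ ρ u < 0 := by
  obtain ⟨v, hv1, hv2⟩ := exists_between hlt
  have hv : v ∈ Set.Ioo (lo m) 1 := ⟨(h.lo_le_uK κ ρ).trans_lt hv1, hv2.trans hu.2⟩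
  exact h.bal_neg_of_lt hρ hv hu hv2 (not_lt.mp fun hb => (h.le_uK hv hb).not_gt hv1)

theorem Admissible.uK_le (h : Admissible x y I m) {κ ρ u : ℝ} (hρ : 0 < ρ)
    (hu : u ∈ Set.Ioo (lo m) 1) (hb : bal x y I m κ ρ u < 0) : uK x y I m κ ρ ≤ u :=
  not_lt.mp fun hlt => (h.bal_pos_of_lt_uK hρ hu hlt).not_gt hb

theorem Admissible.uK_eq (h : Admissible x y I m) {κ ρ u : ℝ} (hρ : 0 < ρ)
    (hu : u ∈ Set.Ioo (lo m) 1) (hb : bal x y I m κ ρ u = 0) : uK x y I m κ ρ = u := by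
  rcases lt_trichotomy (uK x y I m κ ρ) u with hlt | heq | hgt
  · exact absurd hb (h.bal_neg_of_uK_lt hρ hu hlt).ne
  · exact heq
  · exact absurd hb (h.bal_pos_of_lt_uK hρ hu hgt).ne'

/-- A limit from the left of positive values. It matters when `uK` = 1, where the curve is on the
positive real axis and `bal` need not vanish. -/
theorem Admissible.bal_uK_nonneg (h : Admissible x y I m) {κ ρ : ℝ} (hρ : 0 < ρ)
    (hlo : lo m < uK x y I m κ ρ) (hc : ∀ j, uK x y I m κ ρ < cx x ρ j) :
    0 ≤ bal x y I m κ ρ (uK x y I m κ ρ) := by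
  have hcont := h.continuousAt_bal_u (κ := κ) hρ hlo.le hc (h.dy_add_pos hρ (h.neg_one_lt hlo))
  refine ge_of_tendsto (hcont.tendsto.mono_left (nhdsWithin_le_nhds (s := Set.Iio (uK x y I m κ ρ)))) ?_
  filter_upwards [Ioo_mem_nhdsLT hlo] with u hu
  exact (h.bal_pos_of_lt_uK hρ ⟨hu.1, hu.2.trans_le (h.uK_le_one κ ρ)⟩ hu.2).le

theorem Admissible.bal_uK_nonpos (h : Admissible x y I m) {κ ρ : ℝ} (hρ : 0 < ρ)
    (h1 : uK x y I m κ ρ < 1) (hd : ∀ i ∈ I, 0 < dy y ρ i + uK x y I m κ ρ) :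
    bal x y I m κ ρ (uK x y I m κ ρ) ≤ 0 := by
  have hcont := h.continuousAt_bal_u (κ := κ) hρ (h.lo_le_uK κ ρ) (h.lt_cx hρ h1) hd
  refine le_of_tendsto (hcont.tendsto.mono_left (nhdsWithin_le_nhds (s := Set.Ioi (uK x y I m κ ρ)))) ?_
  filter_upwards [Ioo_mem_nhdsGT h1] with u hu
  exact (h.bal_neg_of_uK_lt hρ ⟨(h.lo_le_uK κ ρ).trans_lt hu.1, hu.2⟩ hu.1).le

theorem Admissible.bal_uK_eq_zero (h : Admissible x y I m) {κ ρ : ℝ} (hρ : 0 < ρ)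
    (hu : uK x y I m κ ρ ∈ Set.Ioo (lo m) 1) : bal x y I m κ ρ (uK x y I m κ ρ) = 0 :=
  le_antisymm (h.bal_uK_nonpos hρ hu.2 (h.dy_add_pos hρ (h.neg_one_lt hu.1)))
    (h.bal_uK_nonneg hρ hu.1 (h.lt_cx hρ hu.2))

/-- At a test value w on either side of `uK` the sign of `bal` is strict, hence stable under small
changes of (κ, ρ), and this traps `uK`. Test values lie in the open interval, so no pole interferes,
not even at ρ = x_j. -/
theorem Admissible.continuousAt_uK (h : Admissible x y I m) {κ ρ : ℝ} (hρ : 0 < ρ) :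
    ContinuousAt (fun p : ℝ × ℝ => uK x y I m p.1 p.2) (κ, ρ) := by
  have hev : ∀ w ∈ Set.Ioo (lo m) 1,
      ContinuousAt (fun p : ℝ × ℝ => bal x y I m p.1 p.2 w) (κ, ρ) := fun w hw =>
    ContinuousAt.comp (g := fun p : ℝ × ℝ × ℝ => bal x y I m p.1 p.2.1 p.2.2)
      (f := fun p : ℝ × ℝ => (p.1, p.2, w)) (x := (κ, ρ))
      (h.continuousAt_bal hρ hw.1.le (h.lt_cx hρ hw.2) (h.dy_add_pos hρ (h.neg_one_lt hw.1)))
      (by fun_prop)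
  have hpos : ∀ᶠ p : ℝ × ℝ in 𝓝 (κ, ρ), 0 < p.2 :=
    continuous_snd.continuousAt.eventually (lt_mem_nhds hρ)
  refine tendsto_order.mpr ⟨fun a ha => ?_, fun b hb => ?_⟩
  · simp only at ha
    rcases lt_or_ge a (lo m) with hal | hal
    · exact Eventually.of_forall fun p => hal.trans_le (h.lo_le_uK _ _)
    · obtain ⟨w, hw1, hw2⟩ := exists_between ha
      have hw : w ∈ Set.Ioo (lo m) 1 := ⟨hal.trans_lt hw1, hw2.trans_le (h.uK_le_one _ _)⟩
      filter_upwards [(hev w hw).eventually (lt_mem_nhds (h.bal_pos_of_lt_uK hρ hw hw2))] with p hp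
      exact hw1.trans_le (h.le_uK hw hp)
  · simp only at hb
    rcases lt_or_ge 1 b with hbl | hbl
    · exact Eventually.of_forall fun p => (h.uK_le_one _ _).trans_lt hbl
    · obtain ⟨w, hw1, hw2⟩ := exists_between hb
      have hw : w ∈ Set.Ioo (lo m) 1 := ⟨(h.lo_le_uK _ _).trans_lt hw1, hw2.trans_le hbl⟩
      filter_upwards [(hev w hw).eventually (gt_mem_nhds (h.bal_neg_of_uK_lt hρ hw hw1)), hpos]
        with p hp hp2
      exact (h.uK_le hp2 hw hp).trans_lt hw2

theorem Admissible.uK_zero (h : Admissible x y I m) {ρ : ℝ} (hρ : 0 < ρ) :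
    uK x y I m 0 ρ = lo m := by
  refine le_antisymm (not_lt.mp fun hlt => ?_) (h.lo_le_uK _ _)
  obtain ⟨w, hw1, hw2⟩ := exists_between hlt
  have hw : w ∈ Set.Ioo (lo m) 1 := ⟨hw1, hw2.trans_le (h.uK_le_one _ _)⟩
  have := h.bal_pos_of_lt_uK hρ hw hw2
  rw [bal, zero_mul, zero_sub] at this
  linarith [numK_pos h.n_pos h.one_le hw1 (h.lt_cx hρ hw.2)]

theorem Admissible.uK_one (h : Admissible x y I m) {ρ : ℝ} (hρ : 0 < ρ) :
    uK x y I m 1 ρ = 1 := by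
  refine le_antisymm (h.uK_le_one _ _) (not_lt.mp fun hlt => ?_)
  obtain ⟨w, hw1, hw2⟩ := exists_between hlt
  have hw : w ∈ Set.Ioo (lo m) 1 := ⟨(h.lo_le_uK _ _).trans_lt hw1, hw2⟩
  have := h.bal_neg_of_uK_lt hρ hw hw1
  rw [bal, one_mul] at this
  linarith [numK_lt_denK h.n_pos h.one_le h.nondeg hw.1.le (h.lt_cx hρ hw.2)
    (h.dy_add_pos hρ (h.neg_one_lt hw.1))]

/-- For m ≥ 2 one has T_m'(lo m) = 0, so N vanishes there while κ D does not. The curve of positive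
height therefore avoids the ray Arg z = π/m. -/
theorem Admissible.lo_lt_uK (h : Admissible x y I m) (hm : 2 ≤ m) {κ ρ : ℝ} (hρ : 0 < ρ)
    (hκ : 0 < κ) : lo m < uK x y I m κ ρ := by
  have hlo : -1 < lo m := by linarith [lo_nonneg hm]
  have hl1 := lo_lt_one h.one_le
  have hb : 0 < bal x y I m κ ρ (lo m) := by
    have hN : numK m (cx x ρ) (lo m) = 0 := by simp [numK, chebT'_lo hm]
    rw [bal, hN, sub_zero]
    exact mul_pos hκ (denK_pos h.n_pos (h.lt_cx hρ hl1) (h.dy_add_pos hρ hlo))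
  have hcont := h.continuousAt_bal_u (κ := κ) hρ le_rfl (h.lt_cx hρ hl1) (h.dy_add_pos hρ hlo)
  obtain ⟨w, hw1, hw2⟩ := (((hcont.eventually (lt_mem_nhds hb)).filter_mono
    (nhdsWithin_le_nhds (s := Set.Ioi (lo m)))).and (Ioo_mem_nhdsGT hl1)).exists
  exact hw2.1.trans_le (h.le_uK hw2 hw1)

/-- For m = 1 the boundary ray is the negative axis, which carries the pole -1/y_i. Near it D is at
least 1/(1 + u) while N stays bounded by n, so `bal` is positive and the curve keeps off the pole.
-/
theorem Admissible.neg_one_lt_uK (h : Admissible x y I 1) {κ : ℝ} (hκ : 0 < κ) {i : Fin n}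
    (hi : i ∈ I) : -1 < uK x y I 1 κ (1 / y i) := by
  have hρ : 0 < 1 / y i := one_div_pos.mpr (h.y_pos i hi)
  have hn : (0 : ℝ) < n := by exact_mod_cast h.n_pos
  -- The first bound makes κ/δ ≥ n + 1 > N; the second keeps -1 + δ inside (-1, 1).
  set δ : ℝ := min (κ / (n + 1)) (1 / 2) with hδ
  have hδ0 : 0 < δ := lt_min (by positivity) (by norm_num)
  have hδ2 : δ ≤ 1 / 2 := min_le_right _ _
  have hδ1 : δ * (n + 1) ≤ κ := by
    rw [← le_div_iff₀ (by positivity)]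
    exact min_le_left _ _
  have hu : -1 + δ ∈ Set.Ioo (lo 1) 1 := by
    rw [lo_one]; constructor <;> linarith
  have hdi : dy y (1 / y i) i = 1 := by
    rw [dy, one_div, inv_mul_cancel₀ (h.y_pos i hi).ne', jouk_one]
  have hd := h.dy_add_pos hρ (h.neg_one_lt hu.1)
  have hD : 1 / δ ≤ denK I (cx x (1 / y i)) (dy y (1 / y i)) (-1 + δ) := by
    have h1 := Finset.single_le_sum (f := fun i' => 1 / (dy y (1 / y i) i' + (-1 + δ)))
      (fun i' hi' => (one_div_pos.mpr (hd i' hi')).le) hi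
    have h2 : 0 ≤ ∑ j, 1 / (cx x (1 / y i) j - (-1 + δ)) :=
      Finset.sum_nonneg fun j _ => (one_div_pos.mpr (sub_pos.mpr (h.lt_cx hρ hu.2 j))).le
    rw [denK]
    simp only [hdi] at h1
    have : (1 : ℝ) + (-1 + δ) = δ := by ring
    rw [this] at h1
    linarith
  have hN : numK 1 (cx x (1 / y i)) (-1 + δ) ≤ n := by
    have : ∀ j ∈ (Finset.univ : Finset (Fin n)), chebT' 1 (-1 + δ) /
        (chebT 1 (cx x (1 / y i) j) - chebT 1 (-1 + δ)) ≤ 1 := fun j _ => by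
      have := one_le_cx h.x_pos hρ j
      rw [chebT'_one, chebT_one, chebT_one, div_le_one (by linarith)]
      linarith
    simpa [numK] using Finset.sum_le_card_nsmul _ _ _ this
  have hb : 0 < bal x y I 1 κ (1 / y i) (-1 + δ) := by
    have h3 := mul_le_mul_of_nonneg_left hD hκ.le
    have h4 : (n : ℝ) + 1 ≤ κ * (1 / δ) := by
      rw [mul_one_div, le_div_iff₀ hδ0]; linarith
    rw [bal]
    linarith
  linarith [h.le_uK hu hb]

/-- At ρ = x_j both D and N blow up at u = 1. Since the x_k are distinct only the j-th terms do, and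
each of them behaves like 1/(1 - u). So (1 - u) · `bal` is bounded above by a quantity tending to κ
- 1 < 0, and the curve keeps off the pole x_j. -/
theorem Admissible.uK_lt_one (h : Admissible x y I m) {κ : ℝ} (hκ : κ < 1)
    (j : Fin n) : uK x y I m κ (x j) < 1 := by
  have hρ := h.x_pos j
  have hl1 := lo_lt_one h.one_le
  have hcj : cx x (x j) j = 1 := by rw [cx, div_self (h.x_pos j).ne', jouk_one]
  have hck : ∀ k ∈ Finset.univ.erase j, 1 < cx x (x j) k := fun k hk =>
    one_lt_cx h.x_pos hρ fun e => (Finset.ne_of_mem_erase hk) (h.x_inj e.symm)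
  have hT1 : 0 < chebT' m 1 := chebT'_pos h.one_le hl1
  -- D without the one term that is singular at u = 1.
  set A : ℝ → ℝ := fun u => ∑ i ∈ I, 1 / (dy y (x j) i + u)
    + ∑ k ∈ Finset.univ.erase j, 1 / (cx x (x j) k - u) with hA
  have hAc : ContinuousAt A 1 := by
    refine ContinuousAt.add (tendsto_finsetSum _ fun i hi => ?_) (tendsto_finsetSum _ fun k hk => ?_)
    · exact continuousAt_const.div (by fun_prop)
        (h.dy_add_pos hρ (by norm_num : (-1 : ℝ) < 1) i hi).ne'
    · exact continuousAt_const.div (by fun_prop) (sub_pos.mpr (hck k hk)).ne'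
  have hlim : Tendsto (fun u => κ * ((1 - u) * A u + 1) - chebT' m u / slope (chebT m) 1 u)
      (𝓝[<] 1) (𝓝 (κ * ((1 - 1) * A 1 + 1) - chebT' m 1 / chebT' m 1)) := by
    refine Tendsto.sub ?_ (Tendsto.div ?_ ?_ hT1.ne')
    · refine (ContinuousAt.tendsto (f := fun u => κ * ((1 - u) * A u + 1)) ?_).mono_left
        nhdsWithin_le_nhds
      fun_prop
    · exact (continuous_chebT' m).continuousAt.tendsto.mono_left nhdsWithin_le_nhds
    · exact (hasDerivAt_iff_tendsto_slope.mp (hasDerivAt_chebT m 1)).mono_left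
        (nhdsWithin_mono _ fun u hu => ne_of_lt hu)
  have hneg : κ * ((1 - 1) * A 1 + 1) - chebT' m 1 / chebT' m 1 < 0 := by
    rw [div_self hT1.ne']; linarith
  obtain ⟨u, hu1, hu⟩ := ((hlim.eventually (gt_mem_nhds hneg)).and (Ioo_mem_nhdsLT hl1)).exists
  have hu0 : 0 < 1 - u := by linarith [hu.2]
  refine (h.uK_le hρ hu ?_).trans_lt hu.2
  have hden : denK I (cx x (x j)) (dy y (x j)) u = A u + 1 / (1 - u) := by
    rw [denK, hA, ← Finset.add_sum_erase _ _ (Finset.mem_univ j), hcj]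
    ring
  have hnum : chebT' m u / (chebT m 1 - chebT m u) ≤ numK m (cx x (x j)) u := by
    have := Finset.single_le_sum (f := fun k => chebT' m u / (chebT m (cx x (x j) k) - chebT m u))
      (fun k _ => (div_pos (chebT'_pos h.one_le hu.1)
        (chebT_sub_pos h.one_le hu.1.le (h.lt_cx hρ hu.2 k))).le) (Finset.mem_univ j)
    simp only [hcj] at this
    exact this
  have hTp := chebT_sub_pos h.one_le hu.1.le hu.2
  have hsl : chebT' m u / slope (chebT m) 1 u
      = (1 - u) * (chebT' m u / (chebT m 1 - chebT m u)) := by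
    rw [slope_def_field, div_div_eq_mul_div, ← neg_div_neg_eq]
    rw [show -(chebT m u - chebT m 1) = chebT m 1 - chebT m u by ring]
    ring
  rw [hsl] at hu1
  have h5 : (1 - u) * bal x y I m κ (x j) u < 0 := by
    rw [bal, hden]
    have h6 := mul_le_mul_of_nonneg_left hnum hu0.le
    have h7 : (1 - u) * (κ * (A u + 1 / (1 - u))) = κ * ((1 - u) * A u + 1) := by
      field_simp
    nlinarith
  exact (mul_neg_iff.mp h5).resolve_right (fun h8 => h8.1.not_gt hu0) |>.2

end

/-! ### Increase of the real part along a level curve -/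

/-- If χ b ≤ χ a, then χ b is the minimum on [a, b], since local increase forbids an interior one.
An interior c has χ c > χ b, so the maximum on [c, b] is attained before b, which is again
forbidden. Extrema replace derivatives because the level curve is only known to be continuous. -/
theorem lt_of_local_increase {χ : ℝ → ℝ} {a b : ℝ} (hab : a < b) (hc : ContinuousOn χ (Set.Icc a b))
    (hl : ∀ t ∈ Set.Ioo a b, ∀ᶠ s in 𝓝 t, s ≠ t → 0 < (χ s - χ t) * (s - t)) : χ a < χ b := by
  have hright : ∀ t ∈ Set.Ioo a b, ∀ e > t, ∃ s ∈ Set.Ioo t e, χ t < χ s := fun t ht e he => by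
    obtain ⟨s, hs, hse⟩ := (((hl t ht).filter_mono (nhdsWithin_le_nhds (s := Set.Ioi t))).and
      (Ioo_mem_nhdsGT he)).exists
    exact ⟨s, hse, by nlinarith [hs hse.1.ne', hse.1]⟩
  have hleft : ∀ t ∈ Set.Ioo a b, ∃ s ∈ Set.Ioo a t, χ s < χ t := fun t ht => by
    obtain ⟨s, hs, hse⟩ := (((hl t ht).filter_mono (nhdsWithin_le_nhds (s := Set.Iio t))).and
      (Ioo_mem_nhdsLT ht.1)).exists
    exact ⟨s, hse, by nlinarith [hs hse.2.ne, hse.2]⟩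
  by_contra! hle
  obtain ⟨p, hp, hpm⟩ := isCompact_Icc.exists_isMinOn (Set.nonempty_Icc.mpr hab.le) hc
  have hmin : ∀ t ∈ Set.Icc a b, χ b ≤ χ t := fun t ht => by
    have hpt := hpm ht
    rcases hp.1.eq_or_lt with h | h
    · subst h; exact hle.trans hpt
    rcases hp.2.eq_or_lt with h' | h'
    · subst h'; exact hpt
    · obtain ⟨s, hs, hlt⟩ := hleft p ⟨h, h'⟩
      exact absurd (hpm ⟨hs.1.le, hs.2.le.trans hp.2⟩) (not_le.mpr hlt)
  obtain ⟨c, hac, hcb⟩ := exists_between hab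
  have hbc : χ b < χ c := by
    obtain ⟨s, hs, hlt⟩ := hleft c ⟨hac, hcb⟩
    exact (hmin s ⟨hs.1.le, (hs.2.trans hcb).le⟩).trans_lt hlt
  obtain ⟨q, hq, hqm⟩ := isCompact_Icc.exists_isMaxOn (Set.nonempty_Icc.mpr hcb.le)
    (hc.mono (Set.Icc_subset_Icc_left hac.le))
  rcases hq.2.eq_or_lt with h' | h'
  · subst h'
    exact absurd (hqm ⟨le_rfl, hcb.le⟩) (not_le.mpr hbc)
  · obtain ⟨s, hs, hlt⟩ := hright q ⟨hac.trans_le hq.1, h'⟩ b h'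
    exact absurd (hqm ⟨hq.1.trans hs.1.le, hs.2.le⟩) (not_le.mpr hlt)

theorem lt_of_local_increase_off_finite {χ : ℝ → ℝ} {E : Set ℝ} (hE : E.Finite) :
    ∀ {a b : ℝ}, a < b → ContinuousOn χ (Set.Icc a b) →
    (∀ t ∈ Set.Ioo a b, t ∉ E → ∀ᶠ s in 𝓝 t, s ≠ t → 0 < (χ s - χ t) * (s - t)) → χ a < χ b := by
  induction E, hE using Set.Finite.induction_on with
  | empty => exact fun hab hc hl => lt_of_local_increase hab hc fun t ht => hl t ht (by simp)
  | @insert e E _ _ ih =>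
    intro a b hab hc hl
    by_cases he : e ∈ Set.Ioo a b
    · refine (ih he.1 (hc.mono (Set.Icc_subset_Icc_right he.2.le)) fun t ht hte =>
        hl t ⟨ht.1, ht.2.trans he.2⟩ ?_).trans (ih he.2 (hc.mono (Set.Icc_subset_Icc_left he.1.le))
        fun t ht hte => hl t ⟨he.1.trans ht.1, ht.2⟩ ?_)
      · exact fun h => h.elim (fun h => ht.2.ne h) hte
      · exact fun h => h.elim (fun h => ht.1.ne' h) hte
    · exact ih hab hc fun t ht hte => hl t ht fun h => h.elim (fun h => he (h ▸ ht)) hte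

open Complex in
/-- If `f` is real along a curve parametrized by the modulus and `Re (z f'(z)) > 0`, then `f` increases
locally along the curve. -/
theorem local_increase_of_re_pos {f : ℂ → ℂ} {f' : ℂ} {γ : ℝ → ℂ} {t : ℝ} (ht : 0 < t)
    (hf : HasDerivAt f f' (γ t)) (hγ : ContinuousAt γ t) (hn : ∀ᶠ s in 𝓝 t, ‖γ s‖ = s)
    (him : ∀ᶠ s in 𝓝 t, (f (γ s)).im = 0) (hpos : 0 < (γ t * f').re) :
    ∀ᶠ s in 𝓝 t, s ≠ t → 0 < ((f (γ s)).re - (f (γ t)).re) * (s - t) := by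
  set z := γ t with hz
  set q := (z * f').re with hq
  have hf0 : f' ≠ 0 := by rintro rfl; simp [hq] at hpos
  have hF : 0 < ‖f'‖ := norm_pos_iff.mpr hf0
  have hnt : ‖z‖ = t := hn.self_of_nhds
  -- The first bound lets the linear error be absorbed, giving |h| |f'| ≤ 2|r|; the second makes its
  -- contribution at most |r| q/4.
  set ε : ℝ := min (‖f'‖ / 2) (q / (8 * t)) with hε
  have hε0 : 0 < ε := lt_min (by positivity) (by positivity)
  have hε1 : ε ≤ ‖f'‖ / 2 := min_le_left _ _
  have hε2 : 8 * t * ε ≤ q := by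
    have : ε ≤ q / (8 * t) := min_le_right _ _
    rw [le_div_iff₀ (by positivity)] at this
    linarith
  have h1 := hγ.eventually ((hasDerivAt_iff_isLittleO.mp hf).def hε0)
  have h2 : ∀ᶠ s in 𝓝 t, ‖γ s - z‖ < q / (4 * ‖f'‖) := by
    have : ContinuousAt (fun s => ‖γ s - z‖) t := (hγ.sub continuousAt_const).norm
    refine this.eventually (gt_mem_nhds ?_)
    simp only [← hz, sub_self, norm_zero]
    positivity
  filter_upwards [h1, h2, hn, him, lt_mem_nhds ht] with s hs1 hs2 hsn hsi hspos hne
  set h := γ s - z with hh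
  set r := (f (γ s)).re - (f z).re with hr
  set e := f (γ s) - f z - h • f' with he
  have hre : h * f' = (r : ℂ) - e := by
    have : f (γ s) - f z = (r : ℂ) := by
      apply Complex.ext
      · simp [hr]
      · simp [hsi, him.self_of_nhds, hz]
    rw [he, this, smul_eq_mul]; ring
  have hh0 : h ≠ 0 := fun h0 => hne (by
    rw [← hsn, ← hnt]
    rw [hh, sub_eq_zero] at h0
    rw [h0])
  have hhp : 0 < ‖h‖ := norm_pos_iff.mpr hh0
  have hbd : ‖h‖ * ‖f'‖ ≤ 2 * |r| := by
    have h3 : ‖h * f'‖ ≤ |r| + ε * ‖h‖ := by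
      rw [hre]
      refine (norm_sub_le _ _).trans (add_le_add ?_ hs1)
      rw [norm_real, Real.norm_eq_abs]
    rw [norm_mul] at h3
    nlinarith
  have hr0 : 0 < |r| := by nlinarith [mul_pos hhp hF]
  -- Expand s² - t² = |z + h|² - |z|² and substitute h f' = r - e. The main term is r q and the two
  -- others are each at most |r| q/4, so s - t has the sign of r.
  have hid : ‖f'‖ ^ 2 * (s ^ 2 - t ^ 2) / 2
      = r * q - (starRingEnd ℂ (z * f') * e).re + ‖f'‖ ^ 2 * ‖h‖ ^ 2 / 2 := by
    have hgs : γ s = z + h := by rw [hh]; ring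
    have e1 : s ^ 2 - t ^ 2 = 2 * (starRingEnd ℂ z * h).re + ‖h‖ ^ 2 := by
      rw [← hsn, ← hnt, hgs, ← normSq_eq_norm_sq, ← normSq_eq_norm_sq, ← normSq_eq_norm_sq,
        normSq_apply, normSq_apply, normSq_apply]
      simp
      ring
    have e2 : ‖f'‖ ^ 2 * (starRingEnd ℂ z * h).re = r * q - (starRingEnd ℂ (z * f') * e).re := by
      have : (starRingEnd ℂ z * h) * (starRingEnd ℂ f' * f')
          = starRingEnd ℂ (z * f') * ((r : ℂ) - e) := by
        rw [map_mul, ← hre]; ring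
      have hnn : starRingEnd ℂ f' * f' = ((‖f'‖ ^ 2 : ℝ) : ℂ) := by
        rw [mul_comm, mul_conj, normSq_eq_norm_sq]
      rw [hnn] at this
      have := congrArg Complex.re this
      rw [mul_comm, re_ofReal_mul, mul_sub (starRingEnd ℂ (z * f')), sub_re, mul_comm _ (r : ℂ),
        re_ofReal_mul, conj_re] at this
      exact this
    rw [e1]
    linarith
  have herr : |(starRingEnd ℂ (z * f') * e).re| ≤ |r| * (q / 4) := by
    refine (abs_re_le_norm _).trans ?_
    rw [norm_mul, norm_conj, norm_mul, hnt]
    have : t * ‖f'‖ * ‖e‖ ≤ t * ‖f'‖ * (ε * ‖h‖) := mul_le_mul_of_nonneg_left hs1 (by positivity)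
    have h6 : t * ε * (‖h‖ * ‖f'‖) ≤ t * ε * (2 * |r|) := mul_le_mul_of_nonneg_left hbd (by positivity)
    nlinarith
  have herr2 : ‖f'‖ ^ 2 * ‖h‖ ^ 2 / 2 ≤ |r| * (q / 4) := by
    rw [lt_div_iff₀ (by positivity)] at hs2
    have : (‖h‖ * ‖f'‖) * (‖h‖ * ‖f'‖) ≤ 2 * |r| * (q / 4) :=
      mul_le_mul hbd (by linarith) (by positivity) (by positivity)
    nlinarith
  have hsgn : 0 < r * (s ^ 2 - t ^ 2) := by
    have h7 : 0 < ‖f'‖ ^ 2 := by positivity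
    have h8 := abs_le.mp herr
    have h9 : 0 ≤ ‖f'‖ ^ 2 * ‖h‖ ^ 2 / 2 := by positivity
    refine (mul_pos_iff_of_pos_left h7).mp ?_
    rcases lt_or_gt_of_ne (abs_pos.mp hr0) with hneg | hpos'
    · rw [abs_of_neg hneg] at *
      have : ‖f'‖ ^ 2 * (s ^ 2 - t ^ 2) / 2 < 0 := by
        rw [hid]; nlinarith [mul_pos (neg_pos.mpr hneg) hpos]
      nlinarith
    · rw [abs_of_pos hpos'] at *
      have : 0 < ‖f'‖ ^ 2 * (s ^ 2 - t ^ 2) / 2 := by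
        rw [hid]; nlinarith [mul_pos hpos' hpos]
      nlinarith
  have : r * (s ^ 2 - t ^ 2) = (r * (s - t)) * (s + t) := by ring
  rw [this] at hsgn
  exact (mul_pos_iff_of_pos_right (by linarith)).mp hsgn

/-! ### Poles, angular derivative and critical points -/

/-- The point of modulus `ρ` in the closed upper half plane whose argument has cosine `u`. -/
def pt (ρ u : ℝ) : ℂ := ρ * Complex.exp (Real.arccos u * Complex.I)

theorem norm_pt {ρ : ℝ} (hρ : 0 ≤ ρ) (u : ℝ) : ‖pt ρ u‖ = ρ := by
  rw [pt, norm_mul, Complex.norm_exp_ofReal_mul_I, mul_one, Complex.norm_real,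
    Real.norm_of_nonneg hρ]

theorem arg_pt {ρ : ℝ} (hρ : 0 < ρ) (u : ℝ) : (pt ρ u).arg = Real.arccos u := by
  rw [pt, Complex.exp_mul_I]
  exact Complex.arg_mul_cos_add_sin_mul_I hρ
    ⟨by linarith [Real.pi_pos, Real.arccos_nonneg u], Real.arccos_le_pi u⟩

theorem pt_norm_cos_arg {z : ℂ} (hz : 0 ≤ z.arg) : pt ‖z‖ (Real.cos z.arg) = z := by
  rw [pt, Real.arccos_cos hz (Complex.arg_le_pi z), Complex.norm_mul_exp_arg_mul_I]

theorem pt_one (ρ : ℝ) : pt ρ 1 = ρ := by simp [pt]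

theorem pt_neg_one (ρ : ℝ) : pt ρ (-1) = -ρ := by simp [pt]

theorem continuous_pt : Continuous fun p : ℝ × ℝ => pt p.1 p.2 := by
  unfold pt
  have := Real.continuous_arccos
  fun_prop

theorem arccos_lo {m : ℕ} (hm : 1 ≤ m) : Real.arccos (lo m) = Real.pi / m := by
  have hm' : (1 : ℝ) ≤ m := by exact_mod_cast hm
  exact Real.arccos_cos (by positivity) (div_le_self Real.pi_pos.le hm')

theorem pt_mem_sector_iff {m : ℕ} (hm : 1 ≤ m) {ρ u : ℝ} (hρ : 0 < ρ) (hu : u ≤ 1) : pt ρ u ∈ sector m ↔ u ∈ Set.Ioo (lo m) 1 := by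
  have hl := neg_one_le_lo m
  rw [sector, Set.mem_ofPred_eq, arg_pt hρ, Real.arccos_pos, ← arccos_lo hm]
  constructor
  · exact fun h => ⟨not_le.mp fun h' => (Real.arccos_le_arccos h').not_gt h.2, h.1⟩
  · exact fun h => ⟨h.2, Real.arccos_lt_arccos hl h.1 hu⟩

theorem mem_sector_iff {m : ℕ} (hm : 1 ≤ m) {z : ℂ} :
    z ∈ sector m ↔ ∃ ρ u, 0 < ρ ∧ u ∈ Set.Ioo (lo m) 1 ∧ z = pt ρ u := by
  constructor
  · intro hz
    have h0 : z ≠ 0 := by rintro rfl; simp [sector] at hz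
    have hpt := pt_norm_cos_arg hz.1.le
    refine ⟨‖z‖, Real.cos z.arg, norm_pos_iff.mpr h0, ?_, hpt.symm⟩
    exact (pt_mem_sector_iff hm (norm_pos_iff.mpr h0) (Real.cos_le_one _)).mp (by rwa [hpt])
  · rintro ⟨ρ, u, hρ, hu, rfl⟩
    exact (pt_mem_sector_iff hm hρ hu.2.le).mpr hu

open Complex in
-- Equal moduli force ρ = a, and then cos(mθ) = 1 with 0 < mθ ≤ π is impossible. In the closed
-- sector the only pole from a is a itself.
theorem pt_pow_ne {m : ℕ} (hm : 1 ≤ m) {ρ u a : ℝ} (hρ : 0 < ρ) (ha : 0 < a)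
    (hu : u ∈ Set.Icc (lo m) 1) (hne : u ≠ 1 ∨ ρ ≠ a) : pt ρ u ^ m ≠ (a : ℂ) ^ m := by
  intro heq
  have hm0 : m ≠ 0 := by omega
  have hra : ρ = a := by
    have := congrArg norm heq
    rw [norm_pow, norm_pow, norm_pt hρ.le, norm_real, Real.norm_of_nonneg ha.le] at this
    exact (pow_left_inj₀ hρ.le ha.le hm0).mp this
  subst hra
  refine hne.elim (fun h1 => ?_) fun h => h rfl
  rw [pt, mul_pow, mul_eq_left₀ (pow_ne_zero _ (by exact_mod_cast hρ.ne')), ← exp_nat_mul,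
    ← mul_assoc] at heq
  have hre := congrArg Complex.re heq
  rw [one_re, ← ofReal_natCast, ← ofReal_mul, exp_ofReal_mul_I_re] at hre
  have hθ0 : 0 < Real.arccos u := Real.arccos_pos.mpr (lt_of_le_of_ne hu.2 h1)
  have hθ1 : Real.arccos u ≤ Real.pi / m := by
    rw [← arccos_lo hm]; exact Real.arccos_le_arccos hu.1
  have hm' : (0 : ℝ) < m := by exact_mod_cast hm
  rw [le_div_iff₀ hm'] at hθ1
  have := Real.cos_lt_cos_of_nonneg_of_le_pi le_rfl (by linarith : (m : ℝ) * Real.arccos u ≤ Real.pi)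
    (by positivity)
  rw [hre, Real.cos_zero] at this
  exact lt_irrefl _ this

theorem one_add_mul_pt_ne {ρ u a : ℝ} (hρ : 0 < ρ) (ha : 0 < a)
    (hne : -1 < u ∨ ρ ≠ 1 / a) : 1 + (a : ℂ) * pt ρ u ≠ 0 := by
  intro heq
  have ha' : (a : ℂ) ≠ 0 := by exact_mod_cast ha.ne'
  have hz : pt ρ u = ((-(1 / a) : ℝ) : ℂ) := by
    push_cast
    rw [eq_neg_iff_add_eq_zero]
    field_simp
    linear_combination heq
  have h1 : ρ = 1 / a := by
    have := congrArg norm hz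
    rwa [norm_pt hρ.le, Complex.norm_real, norm_neg, Real.norm_of_nonneg (by positivity)] at this
  have h2 := congrArg Complex.arg hz
  rw [arg_pt hρ, Complex.arg_ofReal_of_neg (by simpa using ha), Real.arccos_eq_pi] at h2
  exact hne.elim (fun h => h2.not_gt h) fun h => h h1

/-- The points that are poles neither of `U` nor of `G`. -/
def regDom {n : ℕ} (x y : Fin n → ℝ) (I : Finset (Fin n)) (m : ℕ) : Set ℂ :=
  {z | (∀ i ∈ I, 1 + (y i : ℂ) * z ≠ 0) ∧ ∀ j, z ^ m ≠ (x j : ℂ) ^ m}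

/-- The point of modulus `ρ` on the level curve of height `κ`. -/
def zK {n : ℕ} (x y : Fin n → ℝ) (I : Finset (Fin n)) (m : ℕ) (κ ρ : ℝ) : ℂ :=
  pt ρ (uK x y I m κ ρ)

/-- The value of `χ` at the point of modulus `ρ` on the level curve of height `κ`. -/
def chiK {n : ℕ} (x y : Fin n → ℝ) (I : Finset (Fin n)) (m : ℕ) (κ ρ : ℝ) : ℝ :=
  if κ = 1 then (P x y I m ρ).re else (fK x y I m κ (zK x y I m κ ρ)).re

section

variable {n m : ℕ} {x y : Fin n → ℝ} {I : Finset (Fin n)}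

theorem finite_compl_regDom (hm : 1 ≤ m) : (regDom x y I m)ᶜ.Finite := by
  have h1 : ∀ i, {z : ℂ | 1 + (y i : ℂ) * z = 0}.Finite := fun i => by
    by_cases hy : (y i : ℂ) = 0
    · simp [hy]
    · refine (Set.finite_singleton (-(y i : ℂ)⁻¹)).subset fun z hz => ?_
      have hz' : 1 + (y i : ℂ) * z = 0 := hz
      rw [Set.mem_singleton_iff]
      field_simp
      linear_combination hz'
  have h2 : ∀ j, {z : ℂ | z ^ m = (x j : ℂ) ^ m}.Finite := fun j => by
    refine ((Polynomial.nthRoots m ((x j : ℂ) ^ m)).toFinset.finite_toSet).subset fun z hz => ?_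
    rw [Finset.mem_coe, Multiset.mem_toFinset, Polynomial.mem_nthRoots (by omega)]
    exact hz
  refine ((Set.finite_iUnion h1).union (Set.finite_iUnion h2)).subset fun z hz => ?_
  by_contra hz'
  refine hz ⟨fun i _ h0 => hz' (Or.inl (Set.mem_iUnion.mpr ⟨i, h0⟩)),
    fun j h0 => hz' (Or.inr (Set.mem_iUnion.mpr ⟨j, h0⟩))⟩

theorem isOpen_regDom (hm : 1 ≤ m) : IsOpen (regDom x y I m) :=
  isClosed_compl_iff.mp (finite_compl_regDom hm).isClosed

theorem isPreconnected_regDom (hm : 1 ≤ m) : IsPreconnected (regDom x y I m) := by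
  rw [← compl_compl (regDom x y I m)]
  exact ((finite_compl_regDom hm).countable.isConnected_compl_of_one_lt_rank
    (by simp)).isPreconnected

theorem Admissible.zero_mem_regDom (h : Admissible x y I m) : (0 : ℂ) ∈ regDom x y I m := by
  refine ⟨fun i _ => by simp, fun j => ?_⟩
  have hm : m ≠ 0 := by have := h.one_le; omega
  rw [zero_pow hm]
  exact (pow_ne_zero _ (by exact_mod_cast (h.x_pos j).ne')).symm

theorem ne_of_pow_ne {z a : ℂ} (h : z ^ m ≠ a ^ m) : z - a ≠ 0 := fun h0 => h (by
  rw [sub_eq_zero.mp h0])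

theorem differentiableAt_U {z : ℂ} (hz : ∀ i ∈ I, 1 + (y i : ℂ) * z ≠ 0) :
    DifferentiableAt ℂ (U y I) z := by
  unfold U
  refine DifferentiableAt.mul (by fun_prop) (DifferentiableAt.fun_sum fun i hi => ?_)
  exact (differentiableAt_const _).fun_div (by fun_prop) (hz i hi)

theorem differentiableAt_V {z : ℂ} (hz : ∀ j, z - x j ≠ 0) : DifferentiableAt ℂ (V x) z := by
  unfold V
  refine DifferentiableAt.mul (by fun_prop) (DifferentiableAt.fun_sum fun j _ => ?_)
  exact (differentiableAt_const _).fun_div (by fun_prop) (hz j)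

theorem differentiableAt_W {z : ℂ} (hz : ∀ j, z ^ m ≠ (x j : ℂ) ^ m) :
    DifferentiableAt ℂ (W x m) z := by
  unfold W
  refine DifferentiableAt.mul (by fun_prop) (DifferentiableAt.fun_sum fun j _ => ?_)
  refine DifferentiableAt.fun_sub ?_ ?_
  · exact DifferentiableAt.fun_div (by fun_prop) (by fun_prop) (sub_ne_zero.mpr (hz j))
  · exact DifferentiableAt.fun_div (by fun_prop) (by fun_prop) (ne_of_pow_ne (hz j))

theorem differentiableAt_G {z : ℂ} (hz : ∀ j, z ^ m ≠ (x j : ℂ) ^ m) :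
    DifferentiableAt ℂ (G x m) z := by
  unfold G
  refine DifferentiableAt.mul (by fun_prop) (DifferentiableAt.fun_sum fun j _ => ?_)
  exact DifferentiableAt.fun_div (by fun_prop) (by fun_prop) (sub_ne_zero.mpr (hz j))

theorem differentiableAt_fK {κ : ℝ} {z : ℂ} (hz : z ∈ regDom x y I m) :
    DifferentiableAt ℂ (fK x y I m κ) z := by
  have h1 := differentiableAt_U hz.1
  have h2 := differentiableAt_V (fun j => ne_of_pow_ne (hz.2 j))
  have h3 := differentiableAt_W hz.2
  unfold fK
  fun_prop

theorem continuousAt_fK {κ : ℝ} {z : ℂ} (hz : z ∈ regDom x y I m) :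
    ContinuousAt (fun p : ℝ × ℂ => fK x y I m p.1 p.2) (κ, z) := by
  have h1 : ContinuousAt (fun p : ℝ × ℂ => U y I p.2) (κ, z) :=
    ContinuousAt.comp (g := U y I) (f := Prod.snd) (differentiableAt_U hz.1).continuousAt
      continuousAt_snd
  have h2 : ContinuousAt (fun p : ℝ × ℂ => V x p.2) (κ, z) :=
    ContinuousAt.comp (g := V x) (f := Prod.snd)
      (differentiableAt_V (fun j => ne_of_pow_ne (hz.2 j))).continuousAt continuousAt_snd
  have h3 : ContinuousAt (fun p : ℝ × ℂ => W x m p.2) (κ, z) :=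
    ContinuousAt.comp (g := W x m) (f := Prod.snd) (differentiableAt_W hz.2).continuousAt
      continuousAt_snd
  have h4 : ContinuousAt (fun p : ℝ × ℂ => (p.1 : ℂ)) (κ, z) := by fun_prop
  unfold fK
  exact ((h4.mul h1).add ((continuousAt_const.sub h4).mul h2)).add h3

theorem Admissible.uK_mem (h : Admissible x y I m) (κ ρ : ℝ) :
    uK x y I m κ ρ ∈ Set.Icc (lo m) 1 := ⟨h.lo_le_uK κ ρ, h.uK_le_one κ ρ⟩

theorem norm_zK {κ ρ : ℝ} (hρ : 0 ≤ ρ) : ‖zK x y I m κ ρ‖ = ρ := norm_pt hρ _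

theorem Admissible.zK_one (h : Admissible x y I m) {ρ : ℝ} (hρ : 0 < ρ) :
    zK x y I m 1 ρ = ρ := by rw [zK, h.uK_one hρ, pt_one]

theorem Admissible.continuousAt_zK (h : Admissible x y I m) {κ ρ : ℝ} (hρ : 0 < ρ) :
    ContinuousAt (fun p : ℝ × ℝ => zK x y I m p.1 p.2) (κ, ρ) :=
  ContinuousAt.comp (g := fun p : ℝ × ℝ => pt p.1 p.2)
    (f := fun p : ℝ × ℝ => (p.2, uK x y I m p.1 p.2)) continuous_pt.continuousAt
    (continuousAt_snd.prodMk (h.continuousAt_uK hρ))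

theorem Admissible.continuousAt_zK_right (h : Admissible x y I m) {κ ρ : ℝ} (hρ : 0 < ρ) :
    ContinuousAt (zK x y I m κ) ρ :=
  ContinuousAt.comp (g := fun p : ℝ × ℝ => zK x y I m p.1 p.2) (f := fun ρ => (κ, ρ))
    (h.continuousAt_zK hρ) (by fun_prop)

theorem Admissible.continuousAt_zK_left (h : Admissible x y I m) {κ ρ : ℝ} (hρ : 0 < ρ) :
    ContinuousAt (fun κ => zK x y I m κ ρ) κ :=
  ContinuousAt.comp (g := fun p : ℝ × ℝ => zK x y I m p.1 p.2) (f := fun κ => (κ, ρ))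
    (h.continuousAt_zK hρ) (by fun_prop)

theorem Admissible.zK_pow_ne (h : Admissible x y I m) {κ ρ : ℝ} (hρ : 0 < ρ)
    (hne : κ < 1 ∨ ∀ j, ρ ≠ x j) (j : Fin n) : zK x y I m κ ρ ^ m ≠ (x j : ℂ) ^ m := by
  refine pt_pow_ne h.one_le hρ (h.x_pos j) (h.uK_mem κ ρ) ?_
  rcases hne with hκ | hne
  · by_cases he : ρ = x j
    · subst he; exact Or.inl (h.uK_lt_one hκ j).ne
    · exact Or.inr he
  · exact Or.inr (hne j)

theorem Admissible.one_add_mul_zK_ne (h : Admissible x y I m) {κ ρ : ℝ} (hρ : 0 < ρ)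
    (hne : 0 < κ ∨ ∀ i ∈ I, ρ ≠ 1 / y i) : ∀ i ∈ I, 1 + (y i : ℂ) * zK x y I m κ ρ ≠ 0 := by
  intro i hi
  refine one_add_mul_pt_ne hρ (h.y_pos i hi) ?_
  rcases hne with hκ | hne
  · rcases h.one_le.eq_or_lt with rfl | hm
    · by_cases he : ρ = 1 / y i
      · subst he; exact Or.inl (h.neg_one_lt_uK hκ hi)
      · exact Or.inr he
    · exact Or.inl (h.neg_one_lt (h.lo_lt_uK hm hρ hκ))
  · exact Or.inr (hne i hi)

theorem Admissible.zK_mem_regDom (h : Admissible x y I m) {κ ρ : ℝ} (hρ : 0 < ρ)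
    (hx : κ < 1 ∨ ∀ j, ρ ≠ x j) (hy : 0 < κ ∨ ∀ i ∈ I, ρ ≠ 1 / y i) :
    zK x y I m κ ρ ∈ regDom x y I m :=
  ⟨h.one_add_mul_zK_ne hρ hy, h.zK_pow_ne hρ hx⟩

theorem Admissible.im_fK_pt (h : Admissible x y I m) {ρ u : ℝ} (hρ : 0 < ρ) (κ : ℝ)
    (hu : u ∈ Set.Icc (lo m) 1) :
    (fK x y I m κ (pt ρ u)).im = √(1 - u ^ 2) / (2 * n) * bal x y I m κ ρ u := by
  rw [pt, im_fK h.one_le h.x_pos h.y_pos hρ, Real.sin_arccos,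
    Real.cos_arccos ((neg_one_le_lo m).trans hu.1) hu.2]

theorem Admissible.im_fK_zK (h : Admissible x y I m) {κ ρ : ℝ} (hρ : 0 < ρ) (hκ : 0 ≤ κ) :
    (fK x y I m κ (zK x y I m κ ρ)).im = 0 := by
  rw [zK, h.im_fK_pt hρ κ (h.uK_mem κ ρ)]
  rcases (h.uK_le_one κ ρ).eq_or_lt with h1 | h1
  · simp [h1]
  -- On the boundary ray `bal` may be nonzero if m = 1, but then the sine factor vanishes. If m ≥ 2,
  -- the ray is reached only for κ = 0, where T_m'(lo m) = 0.
  rcases (h.lo_le_uK κ ρ).eq_or_lt with h2 | h2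
  · rcases h.one_le.eq_or_lt with rfl | hm
    · rw [lo_one] at h2
      simp [← h2]
    · rcases hκ.eq_or_lt with rfl | hκ
      · rw [← h2]
        simp [bal, numK, chebT'_lo hm]
      · exact absurd h2 (h.lo_lt_uK hm hρ hκ).ne
  · rw [h.bal_uK_eq_zero hρ ⟨h2, h1⟩, mul_zero]

/-- The angular derivative of `Im f`. -/
theorem Admissible.re_mul_deriv (h : Admissible x y I m) {κ ρ u b' : ℝ} {f' : ℂ} (hρ : 0 < ρ)
    (hu : u ∈ Set.Icc (lo m) 1) (hf : HasDerivAt (fK x y I m κ) f' (pt ρ u))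
    (hb : HasDerivAt (bal x y I m κ ρ) b' u) :
    (pt ρ u * f').re = (u * bal x y I m κ ρ u - (1 - u ^ 2) * b') / (2 * n) := by
  have hu1 : -1 ≤ u := (neg_one_le_lo m).trans hu.1
  set θ := Real.arccos u with hθ
  have hcos : Real.cos θ = u := Real.cos_arccos hu1 hu.2
  -- Along the circle the derivative of f is i z f', whose imaginary part is Re(z f'). It is
  -- compared with the derivative of the polar formula for Im f.
  have hE : HasDerivAt (fun t : ℝ => (ρ : ℂ) * Complex.exp (t * Complex.I))
      (ρ * (Complex.exp (θ * Complex.I) * (1 * Complex.I))) θ :=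
    ((((hasDerivAt_id θ).ofReal_comp).mul_const Complex.I).cexp).const_mul _
  have h1 : HasDerivAt (fun t : ℝ => (fK x y I m κ ((ρ : ℂ) * Complex.exp (t * Complex.I))).im)
      ((ρ * (Complex.exp (θ * Complex.I) * (1 * Complex.I))) • f').im θ :=
    Complex.imCLM.hasFDerivAt.comp_hasDerivAt θ
      (HasDerivAt.scomp (g₁ := fK x y I m κ)
        (h := fun t : ℝ => (ρ : ℂ) * Complex.exp (t * Complex.I)) θ hf hE)
  have h2 : HasDerivAt (fun t : ℝ => Real.sin t / (2 * n) * bal x y I m κ ρ (Real.cos t))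
      (Real.cos θ / (2 * n) * bal x y I m κ ρ (Real.cos θ)
        + Real.sin θ / (2 * n) * (b' * -Real.sin θ)) θ := by
    refine ((Real.hasDerivAt_sin θ).div_const _).mul ?_
    refine HasDerivAt.comp θ (h₂ := bal x y I m κ ρ) ?_ (Real.hasDerivAt_cos θ)
    rwa [hcos]
  have h3 := h1.unique (h2.congr_of_eventuallyEq (Eventually.of_forall fun t =>
    im_fK h.one_le h.x_pos h.y_pos hρ κ t))
  have h4 : (pt ρ u * f').re
      = ((ρ * (Complex.exp (θ * Complex.I) * (1 * Complex.I))) • f').im := by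
    rw [smul_eq_mul, show (ρ : ℂ) * (Complex.exp (θ * Complex.I) * (1 * Complex.I)) * f'
      = pt ρ u * f' * Complex.I by rw [pt]; ring, Complex.mul_I_im]
  have hs : Real.sin θ * Real.sin θ = 1 - u ^ 2 := by
    rw [← hcos]; linarith [Real.sin_sq_add_cos_sq θ]
  rw [h4, h3, hcos, ← hs]
  ring

/-- On the real axis `f'` is real. -/
theorem Admissible.im_deriv_eq_zero (h : Admissible x y I m) {κ a : ℝ} {f' : ℂ} (ha : a ≠ 0)
    (hf : HasDerivAt (fK x y I m κ) f' (a : ℂ)) : f'.im = 0 := by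
  have h1 : HasDerivAt (fun t : ℝ => (fK x y I m κ (t : ℂ)).im) ((1 : ℂ) • f').im a :=
    Complex.imCLM.hasFDerivAt.comp_hasDerivAt a
      (HasDerivAt.scomp a hf (hasDerivAt_id a).ofReal_comp)
  have hev : (fun t : ℝ => (fK x y I m κ (t : ℂ)).im) =ᶠ[𝓝 a] fun _ => (0 : ℝ) := by
    filter_upwards [isOpen_ne.mem_nhds ha] with t ht
    rcases lt_or_gt_of_ne ht with h0 | h0
    · have := im_fK h.one_le h.x_pos h.y_pos (neg_pos.mpr h0) κ Real.pi
      rw [Complex.exp_pi_mul_I, Real.sin_pi] at this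
      simpa using this
    · have := im_fK h.one_le h.x_pos h.y_pos h0 κ 0
      simpa using this
  have := h1.unique ((hasDerivAt_const a (0 : ℝ)).congr_of_eventuallyEq hev)
  simpa using this

/-- Off the real axis `bal` vanishes with negative slope, and Re(z f') = -(1 - u²) b'/(2n). At u =
±1 it equals ±`bal`/(2n), which has the right weak sign as a one-sided limit. If it is 0, then f' =
0 because f' is real there; at κ = 1 this is excluded by N < D. -/
theorem Admissible.re_mul_deriv_pos_or (h : Admissible x y I m) {κ ρ : ℝ} {f' : ℂ} (hρ : 0 < ρ)
    (hκ0 : 0 < κ) (hx : κ < 1 ∨ ∀ j, ρ ≠ x j)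
    (hf : HasDerivAt (fK x y I m κ) f' (zK x y I m κ ρ)) :
    0 < (zK x y I m κ ρ * f').re ∨ f' = 0 ∧ κ < 1 := by
  have hn : (0 : ℝ) < n := by exact_mod_cast h.n_pos
  have hl1 := lo_lt_one h.one_le
  by_cases hint : uK x y I m κ ρ ∈ Set.Ioo (lo m) 1
  · obtain ⟨b', hb', hd⟩ := h.exists_hasDerivAt_bal_neg hρ hint (h.bal_uK_eq_zero hρ hint)
    left
    rw [zK, h.re_mul_deriv hρ (h.uK_mem κ ρ) hf hd, h.bal_uK_eq_zero hρ hint]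
    have : uK x y I m κ ρ ^ 2 < 1 := by nlinarith [h.neg_one_lt hint.1, hint.2]
    exact div_pos (by nlinarith) (by positivity)
  rcases (h.uK_le_one κ ρ).eq_or_lt with h1 | h1
  · have hne : ∀ j, ρ ≠ x j := fun j => by
      rcases hx with hκ | hx
      · intro he
        subst he
        exact (h.uK_lt_one hκ j).ne h1
      · exact hx j
    have hc : ∀ j, 1 < cx x ρ j := fun j => one_lt_cx h.x_pos hρ (hne j)
    have hd := h.dy_add_pos hρ (u := 1) (by norm_num)
    have hb0 : 0 ≤ bal x y I m κ ρ 1 := by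
      have := h.bal_uK_nonneg (κ := κ) hρ (by rw [h1]; exact hl1) (by rwa [h1])
      rwa [h1] at this
    rw [zK, h1] at hf ⊢
    have hre := h.re_mul_deriv hρ ⟨hl1.le, le_rfl⟩ hf (hasDerivAt_bal h.one_le hl1.le hc hd)
    rw [one_pow, sub_self, zero_mul, sub_zero, one_mul] at hre
    rcases hb0.eq_or_lt with hb | hb
    · right
      rw [← hb, zero_div] at hre
      refine ⟨?_, ?_⟩
      · rw [pt_one] at hf hre
        rw [Complex.re_ofReal_mul] at hre
        exact Complex.ext ((mul_eq_zero.mp hre).resolve_left hρ.ne')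
          (h.im_deriv_eq_zero hρ.ne' hf)
      · by_contra hκ
        have : denK I (cx x ρ) (dy y ρ) 1 ≤ κ * denK I (cx x ρ) (dy y ρ) 1 :=
          le_mul_of_one_le_left (denK_pos h.n_pos hc hd).le (not_lt.mp hκ)
        rw [bal] at hb
        linarith [numK_lt_denK h.n_pos h.one_le h.nondeg hl1.le hc hd]
    · left
      rw [hre]
      positivity
  · have h2 : uK x y I m κ ρ = lo m := by
      by_contra h2
      exact hint ⟨lt_of_le_of_ne (h.lo_le_uK κ ρ) (Ne.symm h2), h1⟩
    rcases h.one_le.eq_or_lt with rfl | hm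
    · rw [lo_one] at h2
      have hκ1 : κ < 1 := by
        by_contra hκ
        obtain ⟨w, hw1, hw2⟩ := exists_between h1
        have hw : w ∈ Set.Ioo (lo 1) 1 := ⟨(h.lo_le_uK _ _).trans_lt hw1, hw2⟩
        have hb := h.bal_neg_of_uK_lt hρ hw hw1
        have hc := h.lt_cx hρ hw.2
        have hd := h.dy_add_pos hρ (h.neg_one_lt hw.1)
        have : denK I (cx x ρ) (dy y ρ) w ≤ κ * denK I (cx x ρ) (dy y ρ) w :=
          le_mul_of_one_le_left (denK_pos h.n_pos hc hd).le (not_lt.mp hκ)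
        rw [bal] at hb
        linarith [numK_lt_denK h.n_pos h.one_le h.nondeg hw.1.le hc hd]
      have hc := h.lt_cx hρ (u := -1) (by norm_num)
      -- The curve keeps off u = -1 at modulus 1/y_i, so ρ y_i ≠ 1 here.
      have hd : ∀ i ∈ I, 0 < dy y ρ i + -1 := fun i hi => by
        have : ρ * y i ≠ 1 := fun he => by
          have := h.neg_one_lt_uK hκ0 hi
          rw [one_div, ← eq_inv_of_mul_eq_one_left he] at this
          exact this.ne' h2
        linarith [one_lt_jouk (mul_pos hρ (h.y_pos i hi)) this, show dy y ρ i = jouk (ρ * y i) from rfl]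
      have hb0 : bal x y I 1 κ ρ (-1) ≤ 0 := by
        have := h.bal_uK_nonpos (κ := κ) hρ h1 (by rwa [h2])
        rwa [h2] at this
      rw [zK, h2] at hf ⊢
      have hlo : lo 1 ≤ -1 := lo_one.le
      have hre := h.re_mul_deriv hρ ⟨hlo, by norm_num⟩ hf (hasDerivAt_bal le_rfl hlo hc hd)
      rw [show (1 : ℝ) - (-1) ^ 2 = 0 by norm_num, zero_mul, sub_zero] at hre
      rcases hb0.eq_or_lt with hb | hb
      · right
        refine ⟨?_, hκ1⟩
        rw [hb, mul_zero, zero_div] at hre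
        rw [pt_neg_one, ← Complex.ofReal_neg] at hf hre
        rw [Complex.re_ofReal_mul] at hre
        have hρ' : -ρ ≠ 0 := neg_ne_zero.mpr hρ.ne'
        exact Complex.ext ((mul_eq_zero.mp hre).resolve_left hρ') (h.im_deriv_eq_zero hρ' hf)
      · left
        rw [hre]
        exact div_pos (by linarith) (by positivity)
    · exact absurd h2 (h.lo_lt_uK hm hρ hκ0).ne'

/-- The critical points on a compact piece of a level curve are finitely many. -/
theorem Admissible.finite_critical (h : Admissible x y I m) {κ a b : ℝ} (ha : 0 < a)
    (hκ0 : 0 < κ) (hκ1 : κ < 1) :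
    {ρ | ρ ∈ Set.Icc a b ∧ deriv (fK x y I m κ) (zK x y I m κ ρ) = 0}.Finite := by
  by_contra hinf
  have hpos : ∀ ρ ∈ Set.Icc a b, 0 < ρ := fun ρ hρ => ha.trans_le hρ.1
  set S := {ρ | ρ ∈ Set.Icc a b ∧ deriv (fK x y I m κ) (zK x y I m κ ρ) = 0} with hS
  have hinj : Set.InjOn (zK x y I m κ) S := fun s hs t ht hst => by
    have := congrArg norm hst
    rwa [norm_zK (hpos s hs.1).le, norm_zK (hpos t ht.1).le] at this
  have hcomp : IsCompact (zK x y I m κ '' Set.Icc a b) :=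
    isCompact_Icc.image_of_continuousOn fun ρ hρ =>
      (h.continuousAt_zK_right (hpos ρ hρ)).continuousWithinAt
  obtain ⟨p, hp, hacc⟩ := (Set.Infinite.image hinj hinf).exists_accPt_of_subset_isCompact hcomp
    (Set.image_mono fun ρ hρ => hρ.1)
  obtain ⟨ρ, hρ, rfl⟩ := hp
  have hpd := h.zK_mem_regDom (hpos ρ hρ) (Or.inl hκ1) (Or.inl hκ0)
  have hfd : DifferentiableOn ℂ (fK x y I m κ) (regDom x y I m) := fun z hz =>
    (differentiableAt_fK hz).differentiableWithinAt
  have hdan : AnalyticOnNhd ℂ (deriv (fK x y I m κ)) (regDom x y I m) :=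
    (hfd.analyticOnNhd (isOpen_regDom h.one_le)).deriv
  -- By the identity theorem f' then vanishes on the connected set of regular points, so f is
  -- constantly f(0) = 0. This makes `bal` vanish on a whole interval at modulus 1, against the
  -- single sign change.
  have hfreq : ∃ᶠ z in 𝓝[≠] (zK x y I m κ ρ), deriv (fK x y I m κ) z = 0 := by
    refine (accPt_iff_frequently_nhdsNE.mp hacc).mono ?_
    rintro _ ⟨s, hs, rfl⟩
    exact hs.2
  have hzero := hdan.eqOn_zero_of_preconnected_of_frequently_eq_zero
    (isPreconnected_regDom h.one_le) hpd hfreq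
  have hconst : ∀ z ∈ regDom x y I m, fK x y I m κ z = 0 := fun z hz => by
    have := (isOpen_regDom h.one_le).is_const_of_deriv_eq_zero (isPreconnected_regDom h.one_le)
      hfd hzero hz h.zero_mem_regDom
    rw [this]
    simp [fK, U, V, W]
  have hbal : ∀ u ∈ Set.Ioo (lo m) 1, bal x y I m κ 1 u = 0 := fun u hu => by
    have hmem : pt 1 u ∈ regDom x y I m :=
      ⟨fun i hi => one_add_mul_pt_ne one_pos (h.y_pos i hi) (Or.inl (h.neg_one_lt hu.1)),
        fun j => pt_pow_ne h.one_le one_pos (h.x_pos j) ⟨hu.1.le, hu.2.le⟩ (Or.inl hu.2.ne)⟩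
    have him := h.im_fK_pt one_pos κ ⟨hu.1.le, hu.2.le⟩
    rw [hconst _ hmem, Complex.zero_im] at him
    have hn : (0 : ℝ) < n := by exact_mod_cast h.n_pos
    have hs : 0 < √(1 - u ^ 2) := Real.sqrt_pos.mpr (by nlinarith [h.neg_one_lt hu.1, hu.2])
    exact (mul_eq_zero.mp him.symm).resolve_left (by positivity)
  obtain ⟨u, hu1, hu2⟩ := exists_between (lo_lt_one h.one_le)
  obtain ⟨v, hv1, hv2⟩ := exists_between hu2
  exact (h.bal_neg_of_lt one_pos ⟨hu1, hu2⟩ ⟨hu1.trans hv1, hv2⟩ hv1 (hbal u ⟨hu1, hu2⟩).le).ne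
    (hbal v ⟨hu1.trans hv1, hv2⟩)

end

/-! ### The function χ along a level curve -/

section

variable {n m : ℕ} {x y : Fin n → ℝ} {I : Finset (Fin n)}

theorem hasDerivAt_g (m : ℕ) (a : ℝ) (z : ℂ) :
    HasDerivAt (g m a) (∑ k ∈ Finset.range m, (k * z ^ (k - 1)) * (a : ℂ) ^ (m - 1 - k)) z := by
  unfold g
  exact HasDerivAt.fun_sum fun k _ => (hasDerivAt_pow k z).mul_const _

theorem g_mul_sub (m : ℕ) (a : ℝ) (z : ℂ) : g m a z * (z - a) = z ^ m - (a : ℂ) ^ m :=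
  geom_sum₂_mul z a m

theorem deriv_g_mul_sub (m : ℕ) (a : ℝ) (z : ℂ) :
    deriv (g m a) z * (z - a) + g m a z = m * z ^ (m - 1) := by
  have h1 : HasDerivAt (fun z => g m a z * (z - a)) (deriv (g m a) z * (z - a) + g m a z * 1) z :=
    (hasDerivAt_g m a z).differentiableAt.hasDerivAt.mul ((hasDerivAt_id z).sub_const _)
  have h2 : HasDerivAt (fun z => g m a z * (z - a)) (m * z ^ (m - 1)) z := by
    simp only [g_mul_sub]
    exact (hasDerivAt_pow m z).sub_const _
  rw [← h1.unique h2, mul_one]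

/-- The logarithmic derivative of g(z)(z - a) = z^m - a^m. Hence `P` continues U + W through the
points x_j. -/
theorem deriv_g_div_g {a : ℝ} {z : ℂ} (hz : z - a ≠ 0) (hg : g m a z ≠ 0) :
    deriv (g m a) z / g m a z = (m : ℂ) * z ^ (m - 1) / (z ^ m - (a : ℂ) ^ m) - 1 / (z - a) := by
  rw [← g_mul_sub, ← deriv_g_mul_sub m a]
  field_simp
  ring

theorem P_eq_fK {z : ℂ} (hz : ∀ j, z - x j ≠ 0) (hg : ∀ j, g m (x j) z ≠ 0) :
    P x y I m z = fK x y I m 1 z := by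
  rw [P, fK, U, W, Finset.sum_congr rfl fun j _ => deriv_g_div_g (hz j) (hg j)]
  simp

theorem g_ofReal (m : ℕ) (a ρ : ℝ) :
    g m a ρ = ((∑ k ∈ Finset.range m, ρ ^ k * a ^ (m - 1 - k) : ℝ) : ℂ) := by
  simp [g]

theorem g_ofReal_ne_zero (hm : 1 ≤ m) {a ρ : ℝ} (ha : 0 < a) (hρ : 0 ≤ ρ) : g m a ρ ≠ 0 := by
  rw [g_ofReal, Complex.ofReal_ne_zero]
  refine ne_of_gt (Finset.sum_pos' (fun k _ => by positivity)
    ⟨0, Finset.mem_range.mpr (by omega), ?_⟩)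
  rw [pow_zero, one_mul]
  positivity

theorem continuous_g (m : ℕ) (a : ℝ) : Continuous (g m a) := by
  unfold g; fun_prop

theorem continuous_deriv_g (m : ℕ) (a : ℝ) : Continuous (deriv (g m a)) := by
  have : deriv (g m a) = fun z => ∑ k ∈ Finset.range m, (k * z ^ (k - 1)) * (a : ℂ) ^ (m - 1 - k) :=
    funext fun z => (hasDerivAt_g m a z).deriv
  rw [this]; fun_prop

theorem Admissible.one_add_mul_ofReal_ne (h : Admissible x y I m) {ρ : ℝ} (hρ : 0 ≤ ρ) :
    ∀ i ∈ I, 1 + (y i : ℂ) * ρ ≠ 0 := fun i hi => by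
  have := h.y_pos i hi
  rw [← Complex.ofReal_mul, ← Complex.ofReal_one, ← Complex.ofReal_add, Complex.ofReal_ne_zero]
  positivity

theorem Admissible.continuousAt_P (h : Admissible x y I m) {ρ : ℝ} (hρ : 0 ≤ ρ) :
    ContinuousAt (fun ρ : ℝ => P x y I m ρ) ρ := by
  unfold P
  refine (ContinuousAt.mul (by fun_prop) ?_).add (ContinuousAt.mul (by fun_prop) ?_)
  · refine tendsto_finsetSum _ fun i hi => ?_
    exact ContinuousAt.div (by fun_prop) (by fun_prop) (h.one_add_mul_ofReal_ne hρ i hi)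
  · refine tendsto_finsetSum _ fun j _ => ?_
    exact ContinuousAt.div ((continuous_deriv_g m (x j)).comp Complex.continuous_ofReal).continuousAt
      ((continuous_g m (x j)).comp Complex.continuous_ofReal).continuousAt
      (g_ofReal_ne_zero h.one_le (h.x_pos j) hρ)

theorem im_P_ofReal (ρ : ℝ) : (P x y I m ρ).im = 0 := by
  have hd : ∀ a : ℝ, deriv (g m a) ρ
      = ((∑ k ∈ Finset.range m, (k * ρ ^ (k - 1)) * a ^ (m - 1 - k) : ℝ) : ℂ) := fun a => by
    rw [(hasDerivAt_g m a ρ).deriv]; simp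
  have : P x y I m ρ = ((ρ / n * ∑ i ∈ I, y i / (1 + y i * ρ) + ρ / n * ∑ j,
      (∑ k ∈ Finset.range m, (k * ρ ^ (k - 1)) * x j ^ (m - 1 - k)) /
        (∑ k ∈ Finset.range m, ρ ^ k * x j ^ (m - 1 - k)) : ℝ) : ℂ) := by
    simp only [P, hd, g_ofReal]
    push_cast
    rfl
  rw [this, Complex.ofReal_im]

theorem Admissible.chiK_eq (h : Admissible x y I m) {κ ρ : ℝ} (hρ : 0 < ρ)
    (hne : κ ≠ 1 ∨ ∀ j, ρ ≠ x j) : chiK x y I m κ ρ = (fK x y I m κ (zK x y I m κ ρ)).re := by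
  by_cases hκ : κ = 1
  · subst hκ
    rw [chiK, if_pos rfl, h.zK_one hρ, P_eq_fK (fun j => ?_)
      fun j => g_ofReal_ne_zero h.one_le (h.x_pos j) hρ.le]
    rw [sub_ne_zero]
    exact_mod_cast hne.resolve_left (by simp) j
  · rw [chiK, if_neg hκ]

theorem pt_lo_pow (hm : 1 ≤ m) (ρ : ℝ) : pt ρ (lo m) ^ m = -(ρ : ℂ) ^ m := by
  have hm' : (m : ℂ) ≠ 0 := by exact_mod_cast (by omega : m ≠ 0)
  rw [pt, mul_pow, ← Complex.exp_nat_mul, arccos_lo hm]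
  push_cast
  rw [show (m : ℂ) * (Real.pi / m * Complex.I) = Real.pi * Complex.I by field_simp,
    Complex.exp_pi_mul_I]
  ring

/-- At κ = 0 the curve is the ray Arg z = π/m, where z^m = -ρ^m. The explicit value is needed
because for m = 1 this ray meets the poles of U, so regularity of `fK` is not available there. -/
theorem Admissible.chiK_zero (h : Admissible x y I m) {ρ : ℝ} (hρ : 0 < ρ) :
    chiK x y I m 0 ρ = m / n * ∑ j, ρ ^ m / (ρ ^ m + x j ^ m) := by
  have h0 : fK x y I m 0 (zK x y I m 0 ρ)
      = ((m / n * ∑ j, ρ ^ m / (ρ ^ m + x j ^ m) : ℝ) : ℂ) := by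
    rw [fK_eq h.one_le, zK, h.uK_zero hρ, G, pt_lo_pow h.one_le]
    push_cast
    rw [zero_mul, zero_add]
    congr 1
    refine Finset.sum_congr rfl fun j _ => ?_
    rw [← neg_div_neg_eq]
    ring
  rw [chiK, if_neg zero_ne_one, h0, Complex.ofReal_re]

theorem Admissible.continuousOn_chiK (h : Admissible x y I m) {κ : ℝ} (hκ0 : 0 ≤ κ) (hκ1 : κ ≤ 1) :
    ContinuousOn (chiK x y I m κ) (Set.Ioi 0) := by
  intro ρ hρ
  rcases hκ1.eq_or_lt with rfl | hκ1
  · have : chiK x y I m 1 = fun ρ : ℝ => (P x y I m ρ).re := funext fun ρ => if_pos rfl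
    rw [this]
    exact (Complex.continuous_re.continuousAt.comp
      (h.continuousAt_P (le_of_lt hρ))).continuousWithinAt
  rcases hκ0.eq_or_lt with rfl | hκ0
  · refine ContinuousWithinAt.congr (f := fun ρ => m / n * ∑ j, ρ ^ m / (ρ ^ m + x j ^ m)) ?_
      (fun t ht => h.chiK_zero ht) (h.chiK_zero hρ)
    refine ContinuousAt.continuousWithinAt (ContinuousAt.mul (by fun_prop)
      (tendsto_finsetSum _ fun j _ => ?_))
    have h1 : 0 < ρ ^ m := pow_pos hρ m
    have h2 : 0 < x j ^ m := pow_pos (h.x_pos j) m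
    exact ContinuousAt.div (by fun_prop) (by fun_prop) (by positivity)
  · have : chiK x y I m κ = fun ρ => (fK x y I m κ (zK x y I m κ ρ)).re :=
      funext fun ρ => if_neg hκ1.ne
    rw [this]
    have hd := h.zK_mem_regDom (κ := κ) hρ (Or.inl hκ1) (Or.inl hκ0)
    exact (Complex.continuous_re.continuousAt.comp (ContinuousAt.comp (g := fK x y I m κ)
      (differentiableAt_fK hd).continuousAt (h.continuousAt_zK_right hρ))).continuousWithinAt

theorem Admissible.strictMonoOn_chiK (h : Admissible x y I m) {κ : ℝ} (hκ0 : 0 ≤ κ) (hκ1 : κ ≤ 1) :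
    StrictMonoOn (chiK x y I m κ) (Set.Ioi 0) := by
  intro a ha b hb hab
  have ha : 0 < a := ha
  have hn : (0 : ℝ) < n := by exact_mod_cast h.n_pos
  have hm : (0 : ℝ) < m := by exact_mod_cast h.one_le
  have : Nonempty (Fin n) := ⟨⟨0, h.n_pos⟩⟩
  rcases hκ0.eq_or_lt with rfl | hκ0
  · rw [h.chiK_zero ha, h.chiK_zero hb]
    refine mul_lt_mul_of_pos_left (Finset.sum_lt_sum_of_nonempty Finset.univ_nonempty fun j _ => ?_)
      (by positivity)
    have h1 : 0 < a ^ m := pow_pos ha m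
    have h4 : 0 < b ^ m := pow_pos hb m
    have h2 : 0 < x j ^ m := pow_pos (h.x_pos j) m
    have h3 : a ^ m < b ^ m := pow_lt_pow_left₀ hab ha.le (by have := h.one_le; omega)
    rw [div_lt_div_iff₀ (by positivity) (by positivity)]
    nlinarith
  -- The condition κ < 1 empties the first set at κ = 1, where there are no critical points to
  -- remove. The x_j are removed because at κ = 1 the function `fK` is not regular there.
  set E : Set ℝ := {ρ | ρ ∈ Set.Icc a b ∧ deriv (fK x y I m κ) (zK x y I m κ ρ) = 0 ∧ κ < 1}
    ∪ Set.range x with hE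
  have hEf : E.Finite := by
    refine Set.Finite.union ?_ (Set.finite_range x)
    rcases hκ1.eq_or_lt with rfl | hκ1
    · simp
    · exact (h.finite_critical ha hκ0 hκ1).subset fun ρ hρ => ⟨hρ.1, hρ.2.1⟩
  have hcont : ContinuousOn (chiK x y I m κ) (Set.Icc a b) :=
    (h.continuousOn_chiK hκ0.le hκ1).mono fun t ht => ha.trans_le ht.1
  refine lt_of_local_increase_off_finite hEf hab hcont fun t ht htE => ?_
  have ht0 : 0 < t := ha.trans ht.1
  have htx : ∀ j, t ≠ x j := fun j hj => htE (Or.inr ⟨j, hj.symm⟩)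
  have hd := h.zK_mem_regDom (κ := κ) ht0 (Or.inr htx) (Or.inl hκ0)
  have hf := (differentiableAt_fK (κ := κ) hd).hasDerivAt
  have hpos := (h.re_mul_deriv_pos_or ht0 hκ0 (Or.inr htx) hf).resolve_right
    fun hz => htE (Or.inl ⟨⟨ht.1.le, ht.2.le⟩, hz⟩)
  have hgt : ∀ᶠ s in 𝓝 t, 0 < s := lt_mem_nhds ht0
  have hloc := local_increase_of_re_pos ht0 hf (h.continuousAt_zK_right ht0)
    (hgt.mono fun s hs => norm_zK hs.le) (hgt.mono fun s hs => h.im_fK_zK hs hκ0.le) hpos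
  have hnx : ∀ᶠ s in 𝓝 t, ∀ j, s ≠ x j :=
    eventually_all.mpr fun j => isOpen_ne.mem_nhds (htx j)
  filter_upwards [hloc, hgt, hnx] with s hs hs0 hsx hst
  rw [h.chiK_eq hs0 (Or.inr hsx), h.chiK_eq ht0 (Or.inr htx)]
  exact hs hst

theorem Admissible.tendsto_chiK_zero (h : Admissible x y I m) (κ : ℝ) :
    Tendsto (chiK x y I m κ) (𝓝[>] 0) (𝓝 0) := by
  have hz : Tendsto (zK x y I m κ) (𝓝[>] 0) (𝓝 0) := by
    rw [tendsto_zero_iff_norm_tendsto_zero]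
    refine Tendsto.congr' (f₁ := fun ρ => ρ) ?_ (tendsto_id.mono_left nhdsWithin_le_nhds)
    filter_upwards [self_mem_nhdsWithin] with ρ hρ
    exact (norm_zK (le_of_lt hρ)).symm
  have hf : Tendsto (fun ρ => (fK x y I m κ (zK x y I m κ ρ)).re) (𝓝[>] 0) (𝓝 0) := by
    have h1 := (differentiableAt_fK (κ := κ) h.zero_mem_regDom).continuousAt.tendsto.comp hz
    have h2 := (Complex.continuous_re.tendsto _).comp h1
    have h0 : fK x y I m κ 0 = 0 := by simp [fK, U, V, W]
    rw [h0] at h2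
    exact h2
  have hnx : ∀ᶠ s in 𝓝[>] (0 : ℝ), ∀ j, s ≠ x j :=
    (eventually_all.mpr fun j => isOpen_ne.mem_nhds (h.x_pos j).ne).filter_mono nhdsWithin_le_nhds
  refine hf.congr' ?_
  filter_upwards [self_mem_nhdsWithin, hnx] with ρ hρ hx
  exact (h.chiK_eq hρ (Or.inr hx)).symm

open Bornology in
theorem Admissible.tendsto_fK_cobounded (h : Admissible x y I m) (κ : ℝ) :
    Tendsto (fK x y I m κ) (cobounded ℂ) (𝓝 (rightEnd I m κ : ℝ)) := by
  have hn : (n : ℂ) ≠ 0 := by exact_mod_cast h.n_pos.ne'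
  have hm0 : m ≠ 0 := by have := h.one_le; omega
  -- This is f in the coordinate w = 1/z, continuous at w = 0, with value A(κ) there.
  set R : ℂ → ℂ := fun w => κ * (1 / n * ∑ i ∈ I, (y i : ℂ) / (w + y i)
    - 1 / n * ∑ j, 1 / (1 - x j * w)) + m / n * ∑ j, 1 / (1 - (x j : ℂ) ^ m * w ^ m) with hR
  have hR0 : ContinuousAt R 0 := by
    refine ContinuousAt.add (ContinuousAt.mul (by fun_prop) (ContinuousAt.sub
      (ContinuousAt.mul (by fun_prop) ?_) (ContinuousAt.mul (by fun_prop) ?_)))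
      (ContinuousAt.mul (by fun_prop) ?_) <;> refine tendsto_finsetSum _ fun i hi => ?_
    · refine ContinuousAt.div (by fun_prop) (by fun_prop) ?_
      have := (h.y_pos i hi).ne'
      simpa using this
    · exact ContinuousAt.div (by fun_prop) (by fun_prop) (by simp)
    · exact ContinuousAt.div (by fun_prop) (by fun_prop) (by simp [hm0])
  have hval : R 0 = (rightEnd I m κ : ℝ) := by
    have h1 : ∑ i ∈ I, (y i : ℂ) / (0 + y i) = I.card := by
      rw [Finset.sum_congr rfl fun i hi => ?_, Finset.sum_const, nsmul_one]
      have : (y i : ℂ) ≠ 0 := by exact_mod_cast (h.y_pos i hi).ne'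
      rw [zero_add, div_self this]
    simp only [hR, h1, rightEnd]
    simp [hm0]
    field_simp
    ring
  rw [← hval]
  refine (hR0.tendsto.comp tendsto_inv₀_cobounded).congr' ?_
  filter_upwards [eventually_ne_cobounded 0] with z hz
  rw [fK_eq h.one_le, U, V, G, Function.comp_apply]
  simp only [hR]
  congr 1
  · congr 2
    · rw [Finset.mul_sum, Finset.mul_sum]
      refine Finset.sum_congr rfl fun i _ => ?_
      rw [show z⁻¹ + (y i : ℂ) = (1 + y i * z) / z by field_simp]
      rw [div_div_eq_mul_div]; ring
    · rw [Finset.mul_sum, Finset.mul_sum]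
      refine Finset.sum_congr rfl fun i _ => ?_
      rw [show 1 - (x i : ℂ) * z⁻¹ = (z - x i) / z by field_simp]
      rw [div_div_eq_mul_div]; ring
  · congr 1
    refine Finset.sum_congr rfl fun j _ => ?_
    have hzm : z ^ m ≠ 0 := pow_ne_zero _ hz
    rw [show 1 - (x j : ℂ) ^ m * z⁻¹ ^ m = (z ^ m - (x j : ℂ) ^ m) / z ^ m by
      rw [inv_pow]; field_simp]
    rw [div_div_eq_mul_div, one_mul]

theorem Admissible.tendsto_chiK_atTop (h : Admissible x y I m) (κ : ℝ) :
    Tendsto (chiK x y I m κ) atTop (𝓝 (rightEnd I m κ)) := by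
  have hz : Tendsto (zK x y I m κ) atTop (Bornology.cobounded ℂ) := by
    rw [← tendsto_norm_atTop_iff_cobounded]
    refine tendsto_id.congr' ?_
    filter_upwards [eventually_ge_atTop 0] with ρ hρ
    exact (norm_zK hρ).symm
  have hf : Tendsto (fun ρ => (fK x y I m κ (zK x y I m κ ρ)).re) atTop (𝓝 (rightEnd I m κ)) :=
    (Complex.continuous_re.tendsto _).comp ((h.tendsto_fK_cobounded κ).comp hz)
  have hnx : ∀ᶠ s in (atTop : Filter ℝ), ∀ j, s ≠ x j :=
    eventually_all.mpr fun j => (eventually_gt_atTop (x j)).mono fun s hs => hs.ne'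
  refine hf.congr' ?_
  filter_upwards [eventually_gt_atTop 0, hnx] with ρ hρ hx
  exact (h.chiK_eq hρ (Or.inr hx)).symm

theorem Admissible.continuousAt_chiK_left (h : Admissible x y I m) {κ ρ : ℝ} (hρ : 0 < ρ)
    (hx : ∀ j, ρ ≠ x j) (hy : ∀ i ∈ I, ρ ≠ 1 / y i) :
    ContinuousAt (fun κ => chiK x y I m κ ρ) κ := by
  have : (fun κ => chiK x y I m κ ρ) = fun κ => (fK x y I m κ (zK x y I m κ ρ)).re :=
    funext fun κ => h.chiK_eq hρ (Or.inr hx)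
  rw [this]
  have hd := h.zK_mem_regDom (κ := κ) hρ (Or.inr hx) (Or.inr hy)
  exact Complex.continuous_re.continuousAt.comp
    (ContinuousAt.comp (g := fun p : ℝ × ℂ => fK x y I m p.1 p.2)
      (f := fun κ => (κ, zK x y I m κ ρ)) (continuousAt_fK hd)
      (continuousAt_id.prodMk (h.continuousAt_zK_left hρ)))

end

/-! ### Inversion in the modulus and existence of a distinguished root -/

open Classical in
/-- The inverse of `ρ ↦ chiK κ ρ`; its value is `0` where there is none. -/
def rhoK {n : ℕ} (x y : Fin n → ℝ) (I : Finset (Fin n)) (m : ℕ) (p : ℝ × ℝ) : ℝ :=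
  if h : ∃ ρ, 0 < ρ ∧ chiK x y I m p.2 ρ = p.1 then h.choose else 0

/-- The distinguished root. -/
def zRoot {n : ℕ} (x y : Fin n → ℝ) (I : Finset (Fin n)) (m : ℕ) (p : ℝ × ℝ) : ℂ :=
  zK x y I m p.2 (rhoK x y I m p)

section

variable {n m : ℕ} {x y : Fin n → ℝ} {I : Finset (Fin n)}

theorem Admissible.chiK_pos (h : Admissible x y I m) {κ ρ : ℝ} (hκ0 : 0 ≤ κ) (hκ1 : κ ≤ 1)
    (hρ : 0 < ρ) : 0 < chiK x y I m κ ρ := by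
  have hmono := h.strictMonoOn_chiK hκ0 hκ1
  have hρ2 : 0 < ρ / 2 := by positivity
  refine lt_of_le_of_lt (le_of_tendsto (h.tendsto_chiK_zero κ) ?_)
    (hmono (Set.mem_Ioi.mpr hρ2) (Set.mem_Ioi.mpr hρ) (by linarith))
  filter_upwards [Ioo_mem_nhdsGT hρ2] with s hs
  exact (hmono (Set.mem_Ioi.mpr hs.1) (Set.mem_Ioi.mpr hρ2) hs.2).le

theorem Admissible.chiK_lt (h : Admissible x y I m) {κ ρ : ℝ} (hκ0 : 0 ≤ κ) (hκ1 : κ ≤ 1)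
    (hρ : 0 < ρ) : chiK x y I m κ ρ < rightEnd I m κ := by
  have hmono := h.strictMonoOn_chiK hκ0 hκ1
  have hρ2 : 0 < ρ + 1 := by positivity
  refine lt_of_lt_of_le (hmono (Set.mem_Ioi.mpr hρ) (Set.mem_Ioi.mpr hρ2) (by linarith))
    (ge_of_tendsto (h.tendsto_chiK_atTop κ) ?_)
  filter_upwards [eventually_gt_atTop (ρ + 1)] with s hs
  exact (hmono (Set.mem_Ioi.mpr hρ2) (Set.mem_Ioi.mpr (hρ2.trans hs)) hs).le

theorem Admissible.rightEnd_pos (h : Admissible x y I m) {κ : ℝ} (hκ0 : 0 ≤ κ) (hκ1 : κ ≤ 1) :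
    0 < rightEnd I m κ :=
  (h.chiK_pos hκ0 hκ1 one_pos).trans (h.chiK_lt hκ0 hκ1 one_pos)

theorem Admissible.exists_chiK_eq (h : Admissible x y I m) {χ κ : ℝ} (hκ0 : 0 ≤ κ) (hκ1 : κ ≤ 1)
    (hχ0 : 0 < χ) (hχ1 : χ < rightEnd I m κ) : ∃ ρ, 0 < ρ ∧ chiK x y I m κ ρ = χ := by
  obtain ⟨a, ha, ha0⟩ := (((h.tendsto_chiK_zero κ).eventually (gt_mem_nhds hχ0)).and
    self_mem_nhdsWithin).exists
  obtain ⟨b, hb, hab⟩ := (((h.tendsto_chiK_atTop κ).eventually (lt_mem_nhds hχ1)).and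
    (eventually_gt_atTop a)).exists
  have ha0 : 0 < a := ha0
  obtain ⟨ρ, hρ, he⟩ := intermediate_value_Icc hab.le
    ((h.continuousOn_chiK hκ0 hκ1).mono fun t ht => ha0.trans_le ht.1) ⟨ha.le, hb.le⟩
  exact ⟨ρ, ha0.trans_le hρ.1, he⟩

theorem rhoK_spec {p : ℝ × ℝ} (hp : ∃ ρ, 0 < ρ ∧ chiK x y I m p.2 ρ = p.1) :
    0 < rhoK x y I m p ∧ chiK x y I m p.2 (rhoK x y I m p) = p.1 := by
  rw [rhoK, dif_pos hp]
  exact hp.choose_spec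

theorem rhoK_nonneg (p : ℝ × ℝ) : 0 ≤ rhoK x y I m p := by
  by_cases hp : ∃ ρ, 0 < ρ ∧ chiK x y I m p.2 ρ = p.1
  · exact (rhoK_spec hp).1.le
  · rw [rhoK, dif_neg hp]

theorem Admissible.rhoK_eq (h : Admissible x y I m) {κ ρ : ℝ} (hκ0 : 0 ≤ κ) (hκ1 : κ ≤ 1)
    (hρ : 0 < ρ) : rhoK x y I m (chiK x y I m κ ρ, κ) = ρ := by
  have hs := rhoK_spec (p := (chiK x y I m κ ρ, κ)) ⟨ρ, hρ, rfl⟩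
  exact (h.strictMonoOn_chiK hκ0 hκ1).injOn (Set.mem_Ioi.mpr hs.1) (Set.mem_Ioi.mpr hρ) hs.2

theorem Admissible.rhoK_left (h : Admissible x y I m) {κ : ℝ} (hκ0 : 0 ≤ κ) (hκ1 : κ ≤ 1) :
    rhoK x y I m (0, κ) = 0 := by
  rw [rhoK, dif_neg]
  rintro ⟨ρ, hρ, he⟩
  exact (h.chiK_pos hκ0 hκ1 hρ).ne' he

theorem Admissible.rhoK_spec' (h : Admissible x y I m) {p : ℝ × ℝ} (hp : p ∈ rootDomain I m)
    (h0 : 0 < p.1) :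
    0 < rhoK x y I m p ∧ chiK x y I m p.2 (rhoK x y I m p) = p.1 :=
  rhoK_spec (h.exists_chiK_eq hp.1 hp.2.1 h0 hp.2.2.2)

theorem Admissible.lt_rhoK_iff (h : Admissible x y I m) {p : ℝ × ℝ} (hp : p ∈ rootDomain I m)
    {ρ : ℝ} (hρ : 0 < ρ) : ρ < rhoK x y I m p ↔ chiK x y I m p.2 ρ < p.1 := by
  obtain ⟨χ, κ⟩ := p
  have hp' := hp
  obtain ⟨hκ0, hκ1, hχ0, hχ1⟩ := hp'
  rcases hχ0.eq_or_lt with h0 | h0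
  · simp only at h0
    subst h0
    rw [h.rhoK_left hκ0 hκ1]
    exact iff_of_false hρ.not_gt (h.chiK_pos hκ0 hκ1 hρ).not_gt
  · obtain ⟨h1, h2⟩ := h.rhoK_spec' hp h0
    rw [← (h.strictMonoOn_chiK hκ0 hκ1).lt_iff_lt (Set.mem_Ioi.mpr hρ) (Set.mem_Ioi.mpr h1), h2]

theorem Admissible.rhoK_lt_iff (h : Admissible x y I m) {p : ℝ × ℝ} (hp : p ∈ rootDomain I m)
    {ρ : ℝ} (hρ : 0 < ρ) : rhoK x y I m p < ρ ↔ p.1 < chiK x y I m p.2 ρ := by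
  obtain ⟨χ, κ⟩ := p
  have hp' := hp
  obtain ⟨hκ0, hκ1, hχ0, hχ1⟩ := hp'
  rcases hχ0.eq_or_lt with h0 | h0
  · simp only at h0
    subst h0
    rw [h.rhoK_left hκ0 hκ1]
    exact iff_of_true hρ (h.chiK_pos hκ0 hκ1 hρ)
  · obtain ⟨h1, h2⟩ := h.rhoK_spec' hp h0
    rw [← (h.strictMonoOn_chiK hκ0 hκ1).lt_iff_lt (Set.mem_Ioi.mpr h1) (Set.mem_Ioi.mpr hρ), h2]

theorem exists_regular_between (x y : Fin n → ℝ) {a b : ℝ} (hab : a < b) :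
    ∃ ρ ∈ Set.Ioo a b, (∀ j, ρ ≠ x j) ∧ ∀ i, ρ ≠ 1 / y i := by
  obtain ⟨ρ, hρ, hne⟩ := ((Set.Ioo_infinite hab).sdiff
    ((Set.finite_range x).union (Set.finite_range fun i => 1 / y i))).nonempty
  exact ⟨ρ, hρ, fun j hj => hne (Or.inl ⟨j, hj.symm⟩), fun i hi => hne (Or.inr ⟨i, hi.symm⟩)⟩

/-- Since χ increases with ρ, comparing `rhoK` with a test modulus is a strict inequality on χ,
stable under perturbation. Test moduli avoid the x_j and 1/y_i, where continuity of χ in κ could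
fail at κ = 1 or κ = 0. -/
theorem Admissible.continuousOn_rhoK (h : Admissible x y I m) :
    ContinuousOn (rhoK x y I m) (rootDomain I m) := by
  intro p hp
  have hcont : ∀ ρ, 0 < ρ → (∀ j, ρ ≠ x j) → (∀ i, ρ ≠ 1 / y i) →
      ContinuousWithinAt (fun q : ℝ × ℝ => chiK x y I m q.2 ρ - q.1) (rootDomain I m) p :=
    fun ρ hρ hx hy => by
      have h1 : ContinuousAt (fun q : ℝ × ℝ => chiK x y I m q.2 ρ) p :=
        ContinuousAt.comp (g := fun κ => chiK x y I m κ ρ) (f := Prod.snd)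
          (h.continuousAt_chiK_left hρ hx fun i _ => hy i) continuousAt_snd
      exact (h1.sub continuousAt_fst).continuousWithinAt
  refine tendsto_order.mpr ⟨fun a ha => ?_, fun b hb => ?_⟩
  · rcases lt_or_ge a 0 with ha0 | ha0
    · exact Eventually.of_forall fun q => ha0.trans_le (rhoK_nonneg q)
    · obtain ⟨ρ, hρ, hx, hy⟩ := exists_regular_between x y ha
      have hρ0 := ha0.trans_lt hρ.1
      have hneg := sub_neg.mpr ((h.lt_rhoK_iff hp hρ0).mp hρ.2)
      filter_upwards [(hcont ρ hρ0 hx hy).eventually (gt_mem_nhds hneg), self_mem_nhdsWithin]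
        with q hq hqd
      exact hρ.1.trans ((h.lt_rhoK_iff hqd hρ0).mpr (sub_neg.mp hq))
  · obtain ⟨ρ, hρ, hx, hy⟩ := exists_regular_between x y hb
    have hρ0 := (rhoK_nonneg p).trans_lt hρ.1
    have hpos := sub_pos.mpr ((h.rhoK_lt_iff hp hρ0).mp hρ.1)
    filter_upwards [(hcont ρ hρ0 hx hy).eventually (lt_mem_nhds hpos), self_mem_nhdsWithin]
      with q hq hqd
    exact ((h.rhoK_lt_iff hqd hρ0).mpr (sub_pos.mp hq)).trans hρ.2

theorem norm_zRoot (p : ℝ × ℝ) : ‖zRoot x y I m p‖ = rhoK x y I m p := norm_zK (rhoK_nonneg p)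

theorem Admissible.continuousOn_zRoot (h : Admissible x y I m) :
    ContinuousOn (zRoot x y I m) (rootDomain I m) := by
  intro p hp
  have hr := h.continuousOn_rhoK p hp
  rcases (rhoK_nonneg (x := x) (y := y) (I := I) (m := m) p).eq_or_lt with h0 | h0
  · have hz : zRoot x y I m p = 0 := by rw [← norm_eq_zero, norm_zRoot, ← h0]
    rw [ContinuousWithinAt, hz, tendsto_zero_iff_norm_tendsto_zero]
    simp only [norm_zRoot]
    rw [ContinuousWithinAt, ← h0] at hr
    exact hr
  · exact ContinuousAt.comp_continuousWithinAt (g := fun q : ℝ × ℝ => zK x y I m q.1 q.2)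
      (f := fun q : ℝ × ℝ => (q.2, rhoK x y I m q)) (h.continuousAt_zK h0)
      (continuousWithinAt_snd.prodMk hr)

theorem zRoot_eq_zero {p : ℝ × ℝ} (h0 : rhoK x y I m p = 0) : zRoot x y I m p = 0 := by
  rw [← norm_eq_zero, norm_zRoot, h0]

theorem Admissible.isRoot_zero (h : Admissible x y I m) (κ : ℝ) : IsRoot x y I m 0 κ 0 := by
  refine ⟨fun _ i _ => by simp, fun _ => ⟨h.zero_mem_regDom.2, ?_⟩, fun _ => ⟨fun j => ?_, ?_⟩⟩
  · simp [F]
  · simpa using g_ofReal_ne_zero h.one_le (h.x_pos j) le_rfl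
  · simp [P]

theorem Admissible.isRoot_zK (h : Admissible x y I m) {κ ρ : ℝ} (hκ0 : 0 ≤ κ) (hκ1 : κ ≤ 1)
    (hρ : 0 < ρ) : IsRoot x y I m (chiK x y I m κ ρ) κ (zK x y I m κ ρ) := by
  refine ⟨fun hκ => ?_, fun hκ => ⟨?_, ?_⟩, fun hκ => ?_⟩
  · exact h.one_add_mul_zK_ne hρ (Or.inl (lt_of_le_of_ne hκ0 hκ.symm))
  · exact h.zK_pow_ne hρ (Or.inl (lt_of_le_of_ne hκ1 hκ))
  · rw [F_eq hκ, chiK, if_neg hκ]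
    congr 1
    exact Complex.ext (by simp) (by simp [h.im_fK_zK hρ hκ0])
  · subst hκ
    rw [h.zK_one hρ, chiK, if_pos rfl]
    exact ⟨fun j => g_ofReal_ne_zero h.one_le (h.x_pos j) hρ.le,
      Complex.ext (by simp) (by simp [im_P_ofReal])⟩

theorem Admissible.isDistinguishedRoot_zRoot (h : Admissible x y I m) :
    IsDistinguishedRoot x y I m (zRoot x y I m) where
  isRoot p hp := by
    obtain ⟨χ, κ⟩ := p
    have hp' := hp
    obtain ⟨hκ0, hκ1, hχ0, hχ1⟩ := hp'
    rcases hχ0.eq_or_lt with h0 | h0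
    · simp only at h0
      subst h0
      rw [zRoot_eq_zero (h.rhoK_left hκ0 hκ1)]
      exact h.isRoot_zero κ
    · obtain ⟨h1, h2⟩ := h.rhoK_spec' hp h0
      have := h.isRoot_zK hκ0 hκ1 h1
      rwa [h2] at this
  arg_bottom χ h0 h1 := by
    have hp : (χ, (0 : ℝ)) ∈ rootDomain I m := ⟨le_rfl, zero_le_one, h0.le, by simpa [rightEnd]⟩
    have hs := h.rhoK_spec' hp h0
    rw [zRoot, zK, h.uK_zero hs.1, arg_pt hs.1, arccos_lo h.one_le]
  left κ h0 h1 := zRoot_eq_zero (h.rhoK_left h0 h1)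
  right κ h0 h1 := by
    simp only [norm_zRoot]
    refine tendsto_atTop.mpr fun b => ?_
    have hb : 0 < max b 1 := lt_max_of_lt_right one_pos
    filter_upwards [Ioo_mem_nhdsLT (h.rightEnd_pos h0 h1), Ioo_mem_nhdsLT (h.chiK_lt h0 h1 hb)]
      with χ hχ hχ'
    exact (le_max_left b 1).trans
      ((h.lt_rhoK_iff (p := (χ, κ)) ⟨h0, h1, hχ.1.le, hχ.2⟩ hb).mpr hχ'.1).le
  top χ h0 h1 := by
    refine ⟨rhoK x y I m (χ, 1), rhoK_nonneg _, ?_⟩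
    rcases (rhoK_nonneg (x := x) (y := y) (I := I) (m := m) (χ, 1)).eq_or_lt with hr | hr
    · rw [zRoot_eq_zero hr.symm, ← hr, Complex.ofReal_zero]
    · rw [zRoot, h.zK_one hr]
  continuousOn := h.continuousOn_zRoot
  im_nonneg _ p _ := by
    rw [zRoot, zK, pt, Complex.im_ofReal_mul, Complex.exp_ofReal_mul_I_im, Real.sin_arccos]
    exact mul_nonneg (rhoK_nonneg p) (Real.sqrt_nonneg _)

end

open scoped ComplexConjugate

/-! ### The inverse map on the sector -/

/-- The height of the level curve through a point of the sector. -/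
def kapS {n : ℕ} (x y : Fin n → ℝ) (I : Finset (Fin n)) (m : ℕ) (z : ℂ) : ℝ :=
  -(G x m z).im / (U y I z - V x z).im

/-- The point `(χ, κ)` at which a point of the sector is a root. -/
def phiS {n : ℕ} (x y : Fin n → ℝ) (I : Finset (Fin n)) (m : ℕ) (z : ℂ) : ℝ × ℝ :=
  ((fK x y I m (kapS x y I m z) z).re, kapS x y I m z)

section

variable {n m : ℕ} {x y : Fin n → ℝ} {I : Finset (Fin n)}

theorem U_conj (z : ℂ) : U y I (conj z) = conj (U y I z) := by
  simp [U, map_sum]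

theorem V_conj (z : ℂ) : V x (conj z) = conj (V x z) := by
  simp [V, map_sum]

theorem W_conj (z : ℂ) : W x m (conj z) = conj (W x m z) := by
  simp [W, map_sum]

theorem fK_conj (κ : ℝ) (z : ℂ) : fK x y I m κ (conj z) = conj (fK x y I m κ z) := by
  simp [fK, U_conj, V_conj, W_conj]

theorem den_eq (z : ℂ) : den x y I z = 2 * (U y I z - V x z).im * Complex.I := by
  have := Complex.sub_conj (U y I z - V x z)
  rw [map_sub] at this
  push_cast at this
  rw [den, U_conj, V_conj]
  linear_combination this

/-- As f has real coefficients, z and its conjugate satisfy the same equation. These are two linear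
equations in (χ, κ), solved by Cramer's rule with determinant `den` up to sign. -/
theorem kappaL_eq_and_chiL_eq {κ χ : ℝ} {z : ℂ} (hf : fK x y I m κ z = χ)
    (hd : den x y I z ≠ 0) : chiL x y I m z = χ ∧ kappaL x y I m z = κ := by
  have hc : fK x y I m κ (conj z) = χ := by rw [fK_conj, hf, Complex.conj_ofReal]
  rw [fK] at hf hc
  rw [chiL, kappaL, div_eq_iff hd, div_eq_iff hd, den]
  constructor
  · linear_combination (U y I (conj z) - V x (conj z)) * -hf + (U y I z - V x z) * hc
  · linear_combination hc - hf

theorem Admissible.im_U_sub_V_pos (h : Admissible x y I m) {z : ℂ} (hz : z ∈ sector m) :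
    0 < (U y I z - V x z).im := by
  obtain ⟨ρ, u, hρ, hu, rfl⟩ := (mem_sector_iff h.one_le).mp hz
  have hu1 := h.neg_one_lt hu.1
  have hn : (0 : ℝ) < n := by exact_mod_cast h.n_pos
  rw [pt, im_U_sub_V h.x_pos h.y_pos hρ, Real.sin_arccos, Real.cos_arccos hu1.le hu.2.le]
  have hs : 0 < √(1 - u ^ 2) := Real.sqrt_pos.mpr (by nlinarith [hu.2])
  exact mul_pos (by positivity) (denK_pos h.n_pos (h.lt_cx hρ hu.2) (h.dy_add_pos hρ hu1))

theorem Admissible.den_ne_zero (h : Admissible x y I m) {z : ℂ} (hz : z ∈ sector m) :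
    den x y I z ≠ 0 := by
  rw [den_eq]
  have : ((U y I z - V x z).im : ℂ) ≠ 0 := by exact_mod_cast (h.im_U_sub_V_pos hz).ne'
  exact mul_ne_zero (mul_ne_zero two_ne_zero this) Complex.I_ne_zero

theorem Admissible.kapS_pt (h : Admissible x y I m) {ρ u : ℝ} (hρ : 0 < ρ)
    (hu : u ∈ Set.Ioo (lo m) 1) :
    kapS x y I m (pt ρ u) = numK m (cx x ρ) u / denK I (cx x ρ) (dy y ρ) u := by
  have hu1 := h.neg_one_lt hu.1
  have hn : (0 : ℝ) < n := by exact_mod_cast h.n_pos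
  have hs : 0 < √(1 - u ^ 2) := Real.sqrt_pos.mpr (by nlinarith [hu.2])
  rw [kapS, pt, im_U_sub_V h.x_pos h.y_pos hρ, im_G h.one_le h.x_pos hρ, Real.sin_arccos,
    Real.cos_arccos hu1.le hu.2.le, neg_neg]
  exact mul_div_mul_left _ _ (by positivity)

theorem Admissible.kapS_mem (h : Admissible x y I m) {z : ℂ} (hz : z ∈ sector m) :
    kapS x y I m z ∈ Set.Ioo (0 : ℝ) 1 := by
  obtain ⟨ρ, u, hρ, hu, rfl⟩ := (mem_sector_iff h.one_le).mp hz
  rw [h.kapS_pt hρ hu]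
  have hc := h.lt_cx hρ hu.2
  have hd := h.dy_add_pos hρ (h.neg_one_lt hu.1)
  have hp := denK_pos h.n_pos hc hd
  exact ⟨div_pos (numK_pos h.n_pos h.one_le hu.1 hc) hp,
    (div_lt_one hp).mpr (numK_lt_denK h.n_pos h.one_le h.nondeg hu.1.le hc hd)⟩

/-- The height is N/D at z, so `bal` vanishes at the cosine of Arg z, and its zero is unique. -/
theorem Admissible.zK_kapS (h : Admissible x y I m) {z : ℂ} (hz : z ∈ sector m) :
    zK x y I m (kapS x y I m z) ‖z‖ = z := by
  obtain ⟨ρ, u, hρ, hu, rfl⟩ := (mem_sector_iff h.one_le).mp hz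
  have hp := denK_pos (I := I) h.n_pos (h.lt_cx hρ hu.2) (h.dy_add_pos hρ (h.neg_one_lt hu.1))
  rw [norm_pt hρ.le, zK, h.uK_eq hρ hu]
  rw [h.kapS_pt hρ hu, bal, div_mul_cancel₀ _ hp.ne', sub_self]

theorem ne_zero_of_mem_sector {z : ℂ} (hz : z ∈ sector m) : z ≠ 0 := by
  rintro rfl; simp [sector] at hz

theorem Admissible.phiS_eq (h : Admissible x y I m) {z : ℂ} (hz : z ∈ sector m) :
    phiS x y I m z = (chiK x y I m (kapS x y I m z) ‖z‖, kapS x y I m z) := by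
  rw [phiS, chiK, if_neg (h.kapS_mem hz).2.ne, h.zK_kapS hz]

theorem Admissible.phiS_mem (h : Admissible x y I m) {z : ℂ} (hz : z ∈ sector m) :
    0 < (phiS x y I m z).2 ∧ (phiS x y I m z).2 < 1 ∧ 0 < (phiS x y I m z).1 ∧
      (phiS x y I m z).1 < rightEnd I m (phiS x y I m z).2 := by
  have hκ := h.kapS_mem hz
  have hρ := norm_pos_iff.mpr (ne_zero_of_mem_sector hz)
  rw [h.phiS_eq hz]
  exact ⟨hκ.1, hκ.2, h.chiK_pos hκ.1.le hκ.2.le hρ, h.chiK_lt hκ.1.le hκ.2.le hρ⟩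

theorem Admissible.zRoot_phiS (h : Admissible x y I m) {z : ℂ} (hz : z ∈ sector m) :
    zRoot x y I m (phiS x y I m z) = z := by
  have hκ := h.kapS_mem hz
  rw [h.phiS_eq hz, zRoot, h.rhoK_eq hκ.1.le hκ.2.le
    (norm_pos_iff.mpr (ne_zero_of_mem_sector hz))]
  exact h.zK_kapS hz

/-- The imaginary part of the equation determines κ, since Im(U - V) > 0 on the sector, and then the
real part is χ. A point of the sector is thus a root for one parameter pair only. -/
theorem Admissible.phiS_of_fK (h : Admissible x y I m) {χ κ : ℝ} {z : ℂ} (hz : z ∈ sector m)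
    (hf : fK x y I m κ z = χ) : phiS x y I m z = (χ, κ) := by
  have hκ : kapS x y I m z = κ := by
    have him := congrArg Complex.im hf
    rw [fK_eq h.one_le, Complex.add_im, Complex.im_ofReal_mul, Complex.ofReal_im] at him
    rw [kapS, div_eq_iff (h.im_U_sub_V_pos hz).ne']
    linarith
  rw [phiS, hκ, hf, Complex.ofReal_re]

theorem Admissible.fK_phiS (h : Admissible x y I m) {z : ℂ} (hz : z ∈ sector m) :
    fK x y I m (phiS x y I m z).2 z = (phiS x y I m z).1 := by
  have := h.im_fK_zK (norm_pos_iff.mpr (ne_zero_of_mem_sector hz)) (h.kapS_mem hz).1.le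
  rw [h.zK_kapS hz] at this
  exact Complex.ext rfl (by simpa [phiS] using this)

theorem IsRoot.fK_eq' {χ κ : ℝ} {z : ℂ} (hr : IsRoot x y I m χ κ z) (hz : ∀ j, z - x j ≠ 0) :
    fK x y I m κ z = χ := by
  by_cases hκ : κ = 1
  · subst hκ
    obtain ⟨hg, hP⟩ := hr.2.2 rfl
    rw [← P_eq_fK hz hg, hP]
  · have h1 : (1 - κ : ℂ) ≠ 0 := by
      rw [sub_ne_zero]; exact_mod_cast Ne.symm hκ
    have := (hr.2.1 hκ).2
    rwa [F_eq hκ, div_left_inj' h1] at this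

theorem sub_ofReal_ne_zero {z : ℂ} (hz : z.im ≠ 0) (a : ℝ) : z - a ≠ 0 := fun h0 => hz (by
  rw [sub_eq_zero.mp h0, Complex.ofReal_im])

theorem im_pos_of_mem_sector (hm : 1 ≤ m) {z : ℂ} (hz : z ∈ sector m) : 0 < z.im := by
  have hm' : (1 : ℝ) ≤ m := by exact_mod_cast hm
  have : z.arg < Real.pi := hz.2.trans_le (div_le_self Real.pi_pos.le hm')
  rw [← Complex.norm_mul_sin_arg]
  exact mul_pos (norm_pos_iff.mpr (ne_zero_of_mem_sector hz))
    (Real.sin_pos_of_pos_of_lt_pi hz.1 this)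

theorem Admissible.phiS_of_isRoot (h : Admissible x y I m) {χ κ : ℝ} {z : ℂ} (hz : z ∈ sector m)
    (hr : IsRoot x y I m χ κ z) : phiS x y I m z = (χ, κ) :=
  h.phiS_of_fK hz (hr.fK_eq' fun _ => sub_ofReal_ne_zero (im_pos_of_mem_sector h.one_le hz).ne' _)

theorem Admissible.phiS_conj_of_isRoot (h : Admissible x y I m) {χ κ : ℝ} {z : ℂ}
    (hz : conj z ∈ sector m) (hr : IsRoot x y I m χ κ z) : phiS x y I m (conj z) = (χ, κ) := by
  refine h.phiS_of_fK hz ?_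
  have him : z.im ≠ 0 := by
    have := im_pos_of_mem_sector h.one_le hz
    rw [Complex.conj_im] at this
    linarith
  rw [fK_conj, hr.fK_eq' fun _ => sub_ofReal_ne_zero him _, Complex.conj_ofReal]

theorem isOpen_sector (hm : 1 ≤ m) : IsOpen (sector m) := by
  refine isOpen_iff_mem_nhds.mpr fun z hz => ?_
  have hsl : z ∈ Complex.slitPlane := Or.inr (im_pos_of_mem_sector hm hz).ne'
  exact (Complex.continuousAt_arg hsl).eventually (Ioo_mem_nhds hz.1 hz.2)

theorem isPreconnected_sector (hm : 1 ≤ m) : IsPreconnected (sector m) := by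
  have : sector m = (fun p : ℝ × ℝ => pt p.1 p.2) '' (Set.Ioi 0 ×ˢ Set.Ioo (lo m) 1) := by
    ext z
    rw [mem_sector_iff hm]
    constructor
    · rintro ⟨ρ, u, hρ, hu, rfl⟩
      exact ⟨(ρ, u), ⟨hρ, hu⟩, rfl⟩
    · rintro ⟨⟨ρ, u⟩, ⟨hρ, hu⟩, rfl⟩
      exact ⟨ρ, u, hρ, hu, rfl⟩
  rw [this]
  exact (isPreconnected_Ioi.prod isPreconnected_Ioo).image _ continuous_pt.continuousOn

theorem Admissible.mem_regDom_of_mem_sector (h : Admissible x y I m) {z : ℂ} (hz : z ∈ sector m) :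
    z ∈ regDom x y I m := by
  have hκ := h.kapS_mem hz
  rw [← h.zK_kapS hz]
  exact h.zK_mem_regDom (norm_pos_iff.mpr (ne_zero_of_mem_sector hz)) (Or.inl hκ.2) (Or.inl hκ.1)

theorem Admissible.continuousOn_phiS (h : Admissible x y I m) :
    ContinuousOn (phiS x y I m) (sector m) := by
  intro z hz
  have hd := h.mem_regDom_of_mem_sector hz
  have hE : ContinuousAt (fun z => U y I z - V x z) z :=
    ((differentiableAt_U hd.1).sub
      (differentiableAt_V fun _ => ne_of_pow_ne (hd.2 _))).continuousAt
  have hκ : ContinuousAt (kapS x y I m) z :=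
    (Complex.continuous_im.continuousAt.comp
      (differentiableAt_G hd.2).continuousAt).neg.div
      (Complex.continuous_im.continuousAt.comp hE) (h.im_U_sub_V_pos hz).ne'
  refine (ContinuousAt.prodMk ?_ hκ).continuousWithinAt
  exact Complex.continuous_re.continuousAt.comp
    (ContinuousAt.comp (g := fun p : ℝ × ℂ => fK x y I m p.1 p.2)
      (f := fun z => (kapS x y I m z, z)) (continuousAt_fK hd) (hκ.prodMk continuousAt_id))

theorem isOpen_openRegion (I : Finset (Fin n)) (m : ℕ) :
    IsOpen {p : ℝ × ℝ | 0 < p.2 ∧ p.2 < 1 ∧ 0 < p.1 ∧ p.1 < rightEnd I m p.2} := by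
  unfold rightEnd
  refine (isOpen_lt continuous_const continuous_snd).inter
    ((isOpen_lt continuous_snd continuous_const).inter
    ((isOpen_lt continuous_const continuous_fst).inter
    (isOpen_lt continuous_fst (by fun_prop))))

theorem openRegion_subset (I : Finset (Fin n)) (m : ℕ) :
    {p : ℝ × ℝ | 0 < p.2 ∧ p.2 < 1 ∧ 0 < p.1 ∧ p.1 < rightEnd I m p.2} ⊆ rootDomain I m :=
  fun _ hp => ⟨hp.1.le, hp.2.1.le, hp.2.2.1.le, hp.2.2.2⟩

/-- The image is the preimage of the open sector under the continuous left inverse `zRoot`, so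
invariance of domain is not needed. -/
theorem Admissible.isOpen_image_phiS (h : Admissible x y I m) :
    IsOpen (phiS x y I m '' sector m) := by
  have hO := isOpen_openRegion I m
  have : phiS x y I m '' sector m =
      {p : ℝ × ℝ | 0 < p.2 ∧ p.2 < 1 ∧ 0 < p.1 ∧ p.1 < rightEnd I m p.2}
        ∩ zRoot x y I m ⁻¹' sector m := by
    ext p
    constructor
    · rintro ⟨z, hz, rfl⟩
      refine ⟨h.phiS_mem hz, ?_⟩
      rw [Set.mem_preimage, h.zRoot_phiS hz]
      exact hz
    · rintro ⟨hp, hz⟩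
      exact ⟨_, hz, h.phiS_of_isRoot hz
        (h.isDistinguishedRoot_zRoot.isRoot p (openRegion_subset I m hp))⟩
  rw [this]
  exact (h.continuousOn_zRoot.mono (openRegion_subset I m)).isOpen_inter_preimage hO
    (isOpen_sector h.one_le)

/-! ### Arbitrary distinguished roots and the liquid region -/

/-- The part `0 < χ`, `0 < κ` of the domain of a distinguished root. -/
def posDomain (I : Finset (Fin n)) (m : ℕ) : Set (ℝ × ℝ) :=
  {p | 0 < p.2 ∧ p.2 ≤ 1 ∧ 0 < p.1 ∧ p.1 < rightEnd I m p.2}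

theorem posDomain_subset : posDomain I m ⊆ rootDomain I m :=
  fun _ hp => ⟨hp.1.le, hp.2.1, hp.2.2.1.le, hp.2.2.2⟩

theorem convex_posDomain : Convex ℝ (posDomain I m) := by
  have h1 := (LinearMap.fst ℝ ℝ ℝ).isLinear
  have h2 := (LinearMap.snd ℝ ℝ ℝ).isLinear
  have h3 := (LinearMap.fst ℝ ℝ ℝ - ((I.card : ℝ) / n - 1) • LinearMap.snd ℝ ℝ ℝ).isLinear
  have hset : posDomain I m = {p | 0 < LinearMap.snd ℝ ℝ ℝ p} ∩ ({p | LinearMap.snd ℝ ℝ ℝ p ≤ 1} ∩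
      ({p | 0 < LinearMap.fst ℝ ℝ ℝ p} ∩
        {p | (LinearMap.fst ℝ ℝ ℝ - ((I.card : ℝ) / n - 1) • LinearMap.snd ℝ ℝ ℝ) p < m})) := by
    ext p
    simp only [posDomain, rightEnd, Set.mem_inter_iff, Set.mem_ofPred_eq, LinearMap.fst_apply,
      LinearMap.snd_apply, LinearMap.sub_apply, LinearMap.smul_apply, smul_eq_mul,
      sub_lt_iff_lt_add]
  rw [hset]
  exact (convex_halfSpace_gt h2 0).inter ((convex_halfSpace_le h2 1).inter
    ((convex_halfSpace_gt h1 0).inter (convex_halfSpace_lt h3 m)))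

variable {z₀ : ℝ × ℝ → ℂ}

theorem Admissible.ne_zero_of_isRoot (h : Admissible x y I m) {χ κ : ℝ} {z : ℂ} (hχ : χ ≠ 0)
    (hr : IsRoot x y I m χ κ z) : z ≠ 0 := by
  rintro rfl
  have h1 := hr.fK_eq' fun j => by
    have := (h.x_pos j).ne'
    simpa using this
  have h0 : fK x y I m κ 0 = 0 := by simp [fK, U, V, W]
  rw [h0] at h1
  exact hχ (by exact_mod_cast h1.symm)

/-- On the rays Arg z = ±π/m the sum N vanishes, so Im f is sin θ/(2n) times κ D, which is not 0. -/
theorem Admissible.cos_arg_ne_lo (h : Admissible x y I m) (hm : 2 ≤ m) {χ κ : ℝ} {z : ℂ}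
    (hκ : 0 < κ) (hz : z ≠ 0) (hr : IsRoot x y I m χ κ z) : Real.cos z.arg ≠ lo m := by
  intro he
  have hl1 := lo_lt_one h.one_le
  have hl0 := lo_nonneg hm
  have hρ := norm_pos_iff.mpr hz
  have hs : Real.sin z.arg ≠ 0 := fun h0 => by
    have := Real.sin_sq_add_cos_sq z.arg
    rw [h0, he] at this
    nlinarith
  have him : z.im ≠ 0 := by
    rw [← Complex.norm_mul_sin_arg]
    exact mul_ne_zero hρ.ne' hs
  have hf := congrArg Complex.im (hr.fK_eq' fun _ => sub_ofReal_ne_zero him _)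
  have hIm := im_fK (I := I) h.one_le h.x_pos h.y_pos hρ κ z.arg
  rw [Complex.norm_mul_exp_arg_mul_I, hf, Complex.ofReal_im, he] at hIm
  have hn : (0 : ℝ) < n := by exact_mod_cast h.n_pos
  have hN : numK m (cx x ‖z‖) (lo m) = 0 := by simp [numK, chebT'_lo hm]
  have hD := denK_pos (I := I) h.n_pos (h.lt_cx hρ hl1) (h.dy_add_pos hρ (u := lo m) (by linarith))
  rw [bal, hN, sub_zero] at hIm
  have : Real.sin z.arg / (2 * n) * (κ * denK I (cx x ‖z‖) (dy y ‖z‖) (lo m)) ≠ 0 := by positivity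
  exact this hIm.symm

/-- For `2 ≤ m` a distinguished root stays in `|Arg z| < π / m`. -/
theorem Admissible.abs_arg_lt (h : Admissible x y I m) (hm : 2 ≤ m)
    (hz : IsDistinguishedRoot x y I m z₀) {p : ℝ × ℝ} (hp : p ∈ posDomain I m) :
    |(z₀ p).arg| < Real.pi / m := by
  have hne : ∀ q ∈ posDomain I m, z₀ q ≠ 0 := fun q hq =>
    h.ne_zero_of_isRoot hq.2.2.1.ne' (hz.isRoot q (posDomain_subset hq))
  -- This is the cosine of the argument, continuous even across the negative axis, where the
  -- argument jumps. It equals 1 on the top edge and never equals `lo m`, so it stays above `lo m`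
  -- on the connected domain.
  have hcont : ContinuousOn (fun q => (z₀ q).re / ‖z₀ q‖) (posDomain I m) := by
    have h0 := hz.continuousOn.mono posDomain_subset
    exact (Complex.continuous_re.comp_continuousOn h0).div h0.norm
      fun q hq => norm_ne_zero_iff.mpr (hne q hq)
  have hA := h.rightEnd_pos zero_le_one le_rfl
  have hq : (rightEnd I m 1 / 2, (1 : ℝ)) ∈ posDomain I m :=
    ⟨one_pos, le_rfl, by simpa using hA, by simpa using hA⟩
  obtain ⟨t, ht, hzt⟩ := hz.top (rightEnd I m 1 / 2) (by linarith) (by linarith)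
  have hq1 : (z₀ (rightEnd I m 1 / 2, 1)).re / ‖z₀ (rightEnd I m 1 / 2, 1)‖ = 1 := by
    have hne' := hne _ hq
    rw [hzt] at hne' ⊢
    rw [Complex.ofReal_re, Complex.norm_real, Real.norm_of_nonneg ht]
    exact div_self (by exact_mod_cast hne')
  have hgt : lo m < (z₀ p).re / ‖z₀ p‖ := by
    by_contra! hle
    obtain ⟨q, hqd, hqe⟩ := convex_posDomain.isPreconnected.intermediate_value hp hq hcont
      ⟨hle, by rw [hq1]; exact (lo_lt_one h.one_le).le⟩
    simp only at hqe
    rw [← Complex.cos_arg (hne q hqd)] at hqe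
    exact h.cos_arg_ne_lo hm hqd.1 (hne q hqd) (hz.isRoot q (posDomain_subset hqd)) hqe
  rw [← Complex.cos_arg (hne p hp), ← Real.cos_abs, lo] at hgt
  by_contra! hle
  exact (Real.cos_le_cos_of_nonneg_of_le_pi (by positivity) (Complex.abs_arg_le_pi _) hle).not_gt hgt

/-- Along a vertical segment the root passes from Arg z = π/m at κ = 0 to the positive axis at κ =
1, so an intermediate value lies in the sector. -/
theorem Admissible.exists_mem_sector (h : Admissible x y I m)
    (hz : IsDistinguishedRoot x y I m z₀) :
    ∃ p ∈ rootDomain I m, z₀ p ∈ sector m := by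
  have hA := h.rightEnd_pos zero_le_one le_rfl
  have hm1 : (1 : ℝ) ≤ m := by exact_mod_cast h.one_le
  -- Lying below A(0) = m and A(1), this value lies below the affine function A throughout.
  set χ : ℝ := min (m : ℝ) (rightEnd I m 1) / 2 with hχ
  have hχ0 : 0 < χ := by
    have : 0 < min (m : ℝ) (rightEnd I m 1) := lt_min (by linarith) hA
    linarith
  have hχm : χ < m := by
    have := min_le_left (m : ℝ) (rightEnd I m 1)
    linarith
  have hχA : χ < rightEnd I m 1 := by
    have := min_le_right (m : ℝ) (rightEnd I m 1)
    linarith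
  have hdom : ∀ κ ∈ Set.Icc (0 : ℝ) 1, χ < rightEnd I m κ := fun κ hκ => by
    have : rightEnd I m κ = (1 - κ) * m + κ * rightEnd I m 1 := by simp only [rightEnd]; ring
    rw [this]
    rcases hκ.1.eq_or_lt with h0 | h0
    · rw [← h0]; linarith
    · nlinarith [hκ.2]
  have hmem : ∀ κ ∈ Set.Icc (0 : ℝ) 1, (χ, κ) ∈ rootDomain I m := fun κ hκ =>
    ⟨hκ.1, hκ.2, hχ0.le, hdom κ hκ⟩
  have hpath : ContinuousOn (fun κ => z₀ (χ, κ)) (Set.Icc 0 1) :=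
    hz.continuousOn.comp (by fun_prop) hmem
  have hne : ∀ κ ∈ Set.Icc (0 : ℝ) 1, z₀ (χ, κ) ≠ 0 := fun κ hκ =>
    h.ne_zero_of_isRoot hχ0.ne' (hz.isRoot _ (hmem κ hκ))
  have hbot := hz.arg_bottom χ hχ0 hχm
  obtain ⟨t, ht, hzt⟩ := hz.top χ hχ0.le hχA
  rcases h.one_le.eq_or_lt with rfl | hm
  · have hre0 : (z₀ (χ, 0)).re ≤ 0 := by
      rw [Nat.cast_one, div_one] at hbot
      exact (Complex.arg_eq_pi_iff.mp hbot).1.le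
    have hre1 : 0 ≤ (z₀ (χ, 1)).re := by rw [hzt]; simpa using ht
    obtain ⟨κ, hκ, hre⟩ := intermediate_value_Icc zero_le_one
      (Complex.continuous_re.comp_continuousOn hpath) ⟨hre0, hre1⟩
    simp only [Function.comp_apply] at hre
    have him : 0 < (z₀ (χ, κ)).im := lt_of_le_of_ne (hz.im_nonneg rfl _ (hmem κ hκ))
      fun h0 => hne κ hκ (Complex.ext hre h0.symm)
    refine ⟨_, hmem κ hκ, ?_⟩
    have harg := Complex.arg_eq_pi_div_two_iff.mpr ⟨hre, him⟩
    rw [sector, Set.mem_ofPred_eq, harg, Nat.cast_one, div_one]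
    constructor <;> linarith [Real.pi_pos]
  · have hpm : Real.pi / m ≤ Real.pi / 2 :=
      div_le_div_of_nonneg_left Real.pi_pos.le two_pos (by exact_mod_cast hm)
    have hpm0 : 0 < Real.pi / m := by positivity
    have habs : ∀ κ ∈ Set.Icc (0 : ℝ) 1, |(z₀ (χ, κ)).arg| ≤ Real.pi / m := fun κ hκ => by
      rcases hκ.1.eq_or_lt with h0 | h0
      · rw [← h0, hbot, abs_of_pos hpm0]
      · exact (h.abs_arg_lt hm hz ⟨h0, hκ.2, hχ0, hdom κ hκ⟩).le
    have harg : ContinuousOn (fun κ => (z₀ (χ, κ)).arg) (Set.Icc 0 1) := fun κ hκ => by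
      refine (Complex.continuousAt_arg ?_).comp_continuousWithinAt (hpath κ hκ)
      rw [Complex.mem_slitPlane_iff_arg]
      refine ⟨fun he => ?_, hne κ hκ⟩
      have := habs κ hκ
      rw [he, abs_of_pos Real.pi_pos] at this
      linarith [Real.pi_pos]
    have htop : (z₀ (χ, 1)).arg = 0 := by rw [hzt]; exact Complex.arg_ofReal_of_nonneg ht
    obtain ⟨κ, hκ, he⟩ := intermediate_value_Icc' zero_le_one harg
      (show Real.pi / m / 2 ∈ _ by rw [hbot, htop]; constructor <;> linarith)
    simp only at he
    refine ⟨_, hmem κ hκ, ?_⟩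
    rw [sector, Set.mem_ofPred_eq, he]
    constructor <;> linarith

/-- Every distinguished root inverts `phiS` on the sector. -/
theorem Admissible.apply_phiS (h : Admissible x y I m) (hz : IsDistinguishedRoot x y I m z₀)
    {z : ℂ} (hzs : z ∈ sector m) : z₀ (phiS x y I m z) = z := by
  have hdom : Set.MapsTo (phiS x y I m) (sector m) (rootDomain I m) := fun w hw =>
    openRegion_subset I m (h.phiS_mem hw)
  have hcont : ContinuousOn (fun w => z₀ (phiS x y I m w)) (sector m) :=
    hz.continuousOn.comp h.continuousOn_phiS hdom
  have hS := isOpen_sector h.one_le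
  have heq : ∀ w ∈ sector m, z₀ (phiS x y I m w) ∈ sector m → z₀ (phiS x y I m w) = w :=
    fun w hw hw0 => by
      have h1 := h.zRoot_phiS hw0
      rw [h.phiS_of_isRoot hw0 (hz.isRoot _ (hdom hw)), Prod.mk.eta, h.zRoot_phiS hw] at h1
      exact h1.symm
  -- The sector is covered by two disjoint open sets: where z₀ ∘ `phiS` lands in the sector, and
  -- there it is the identity by `heq`, and where it is not the identity. The first is nonempty, so
  -- by connectedness it is everything.
  have hA := hcont.isOpen_inter_preimage hS hS
  have hB : IsOpen (sector m ∩ (fun w => z₀ (phiS x y I m w) - w) ⁻¹' {0}ᶜ) :=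
    (hcont.sub continuousOn_id).isOpen_inter_preimage hS isOpen_compl_singleton
  obtain ⟨p, hp, hps⟩ := h.exists_mem_sector hz
  have hpe : phiS x y I m (z₀ p) = p := h.phiS_of_isRoot hps (hz.isRoot p hp)
  have hsub := (isPreconnected_sector h.one_le).subset_left_of_subset_union hA hB
    (Set.disjoint_left.mpr fun w hw hw' => hw'.2 (sub_eq_zero.mpr (heq w hw.1 hw.2)))
    (fun w hw => by
      by_cases hw0 : z₀ (phiS x y I m w) = w
      · exact Or.inl ⟨hw, by rw [Set.mem_preimage, hw0]; exact hw⟩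
      · exact Or.inr ⟨hw, sub_ne_zero.mpr hw0⟩)
    ⟨z₀ p, hps, hps, by rw [Set.mem_preimage, hpe]; exact hps⟩
  exact heq z hzs (hsub hzs).2

/-- An interior point has κ > 0, so z₀ or its conjugate lies in the sector, and either way the point
is a value of `phiS`. Conversely the image of `phiS` is open, and z₀ is not real on it by
`apply_phiS`. -/
theorem Admissible.interior_liquidRegion (h : Admissible x y I m)
    (hz : IsDistinguishedRoot x y I m z₀) :
    interior (liquidRegion I m z₀) = phiS x y I m '' sector m := by
  apply subset_antisymm
  · intro p hp
    have hpL := interior_subset hp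
    have hκ : 0 < p.2 := by
      -- The bottom edge κ = 0 may belong to the liquid region, but not to its interior: points just
      -- below it have κ < 0.
      refine lt_of_le_of_ne hpL.1.1 fun h0 => ?_
      have hc : ContinuousAt (fun t : ℝ => (p.1, t)) 0 := by fun_prop
      have hev := hc.eventually (by
        simpa [h0] using isOpen_interior.mem_nhds hp :
          interior (liquidRegion I m z₀) ∈ 𝓝 (p.1, (0 : ℝ)))
      obtain ⟨t, ht, ht0⟩ := ((hev.filter_mono (nhdsWithin_le_nhds (s := Set.Iio 0))).and
        self_mem_nhdsWithin).exists
      exact (not_lt.mpr (interior_subset ht).1.1) ht0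
    have hpd : p ∈ posDomain I m := ⟨hκ, hpL.1.2.1.le, hpL.1.2.2⟩
    have hr := hz.isRoot p (posDomain_subset hpd)
    have him := hpL.2
    have hsec : z₀ p ∈ sector m ∨ conj (z₀ p) ∈ sector m := by
      rcases h.one_le.eq_or_lt with rfl | hm
      · left
        have hpos := lt_of_le_of_ne (hz.im_nonneg rfl p (posDomain_subset hpd)) him.symm
        have h1 : 0 ≤ (z₀ p).arg := Complex.arg_nonneg_iff.mpr hpos.le
        rw [sector, Set.mem_ofPred_eq, Nat.cast_one, div_one]
        refine ⟨lt_of_le_of_ne h1 fun h0 => ?_, lt_of_le_of_ne (Complex.arg_le_pi _) fun h0 => ?_⟩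
        · exact hpos.ne' (Complex.arg_eq_zero_iff.mp h0.symm).2
        · exact hpos.ne' (Complex.arg_eq_pi_iff.mp h0).2
      · have habs := abs_lt.mp (h.abs_arg_lt hm hz hpd)
        have h0 : (z₀ p).arg ≠ 0 := fun h0 => him (Complex.arg_eq_zero_iff.mp h0).2
        rcases lt_or_gt_of_ne h0 with hneg | hpos
        · right
          have hpi : (z₀ p).arg ≠ Real.pi := fun h1 => him (Complex.arg_eq_pi_iff.mp h1).2
          rw [sector, Set.mem_ofPred_eq, Complex.arg_conj, if_neg hpi]
          constructor <;> linarith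
        · exact Or.inl ⟨hpos, habs.2⟩
    rcases hsec with hs | hs
    · exact ⟨_, hs, h.phiS_of_isRoot hs hr⟩
    · exact ⟨_, hs, h.phiS_conj_of_isRoot hs hr⟩
  · refine interior_maximal ?_ h.isOpen_image_phiS
    rintro _ ⟨z, hzs, rfl⟩
    have hp := h.phiS_mem hzs
    refine ⟨⟨hp.1.le, hp.2⟩, ?_⟩
    rw [h.apply_phiS hz hzs]
    exact (im_pos_of_mem_sector h.one_le hzs).ne'

/-- The homeomorphism from the interior of the liquid region onto the sector. -/
def Admissible.liquidHomeo (h : Admissible x y I m) (hz : IsDistinguishedRoot x y I m z₀) :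
    interior (liquidRegion I m z₀) ≃ₜ sector m where
  toFun p := ⟨z₀ p, by
    obtain ⟨z, hzs, he⟩ := (h.interior_liquidRegion hz).subset p.2
    rw [← he, h.apply_phiS hz hzs]
    exact hzs⟩
  invFun z := ⟨phiS x y I m z, by
    rw [h.interior_liquidRegion hz]
    exact Set.mem_image_of_mem _ z.2⟩
  left_inv p := by
    obtain ⟨z, hzs, he⟩ := (h.interior_liquidRegion hz).subset p.2
    apply Subtype.ext
    simp only
    rw [← he, h.apply_phiS hz hzs]
  right_inv z := Subtype.ext (h.apply_phiS hz z.2)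
  continuous_toFun := by
    refine Continuous.subtype_mk ?_ _
    refine continuousOn_iff_continuous_domRestrict.mp (hz.continuousOn.mono fun p hp => ?_)
    have hp := (interior_subset hp).1
    exact ⟨hp.1, hp.2.1.le, hp.2.2.1.le, hp.2.2.2⟩
  continuous_invFun := by
    refine Continuous.subtype_mk ?_ _
    exact continuousOn_iff_continuous_domRestrict.mp h.continuousOn_phiS

end

end SquareHexagon

end

theorem lemmal46 {n : ℕ} (hn : 0 < n) (m : ℕ) (hm : 1 ≤ m)
    (x y : Fin n → ℝ) (I : Finset (Fin n))
    (hx : ∀ j, 0 < x j) (hx_distinct : Function.Injective x) (hy : ∀ i ∈ I, 0 < y i)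
    (hnondeg : 2 ≤ m ∨ I.Nonempty) :
    (∃ z₀ : ℝ × ℝ → ℂ, SquareHexagon.IsDistinguishedRoot x y I m z₀) ∧
    ∀ z₀ : ℝ × ℝ → ℂ, SquareHexagon.IsDistinguishedRoot x y I m z₀ →
      ∃ T : interior (SquareHexagon.liquidRegion I m z₀) ≃ₜ SquareHexagon.sector m,
        (∀ p : interior (SquareHexagon.liquidRegion I m z₀), (T p : ℂ) = z₀ p) ∧
        ∀ z : SquareHexagon.sector m,
          SquareHexagon.den x y I z ≠ 0 ∧
          (((T.symm z : ℝ × ℝ).1 : ℝ) : ℂ) = SquareHexagon.chiL x y I m z ∧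
          (((T.symm z : ℝ × ℝ).2 : ℝ) : ℂ) = SquareHexagon.kappaL x y I m z := by
  have h : SquareHexagon.Admissible x y I m := ⟨hn, hm, hx, hx_distinct, hy, hnondeg⟩
  refine ⟨⟨_, h.isDistinguishedRoot_zRoot⟩, fun z₀ hz => ⟨h.liquidHomeo hz, fun p => rfl,
    fun z => ?_⟩⟩
  have hd := h.den_ne_zero z.2
  obtain ⟨h1, h2⟩ := SquareHexagon.kappaL_eq_and_chiL_eq (h.fK_phiS z.2) hd
  exact ⟨hd, h1.symm, h2.symm⟩
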